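/- Let $X_1,\dots,X_n$ be independent real-valued random variables, let $T=T(X_1,\dots,X_n)$ with $T:\mathbb R^n\to\mathbb R$ Borel measurable, and let $g_1,\dots,g_n:\mathbb R\to\mathbb R$ be Borel measurable functions with $$\mathbb E\,g_i(X_i)=0\quad(1\le i\le n),\qquad \sum_{i=1}^n\mathbb E\,g_i^2(X_i)=1 .$$ Put $W=\sum_{i=1}^n g_i(X_i)$ and $\Delta=T-W$. Write $\|Y\|_2=(\mathbb E Y^2)^{1/2}\in[0,\infty]$, with the convention $0\cdot\infty=0$, and let $\Phi$ be the standard normal distribution function. For each $1\le i\le n$ let $\Delta_i$ be a random variable such that $X_i$ and $(\Delta_i,\{X_j,\ j\ne i\})$ are independent. (a) For every $\delta>0$ satisfying $\sum_{i=1}^n\mathbb E\,|g_i(X_i)|\min(\delta,|g_i(X_i)|)\ge \tfrac12$ and every $z\in\mathbb R$, $$|P(T\le z)-P(W\le z)|\le\gamma_z+e^{-|z|/3}\,\tau ,$$ where $$\gamma_z=P\Big(|\Delta|>\tfrac{|z|+1}{3}\Big)+\sum_{i=1}^nP\Big(|g_i(X_i)|>\tfrac{|z|+1}{3}\Big)+\sum_{i=1}^nP\Big(|W-g_i(X_i)|>\tfrac{|z|-2}{3}\Big)\,P\big(|g_i(X_i)|>1\big),$$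 $$\tau=22\,\delta+8.5\,\|\Delta\|_2+3.6\sum_{i=1}^n\|g_i(X_i)\|_2\,\|\Delta-\Delta_i\|_2 .$$ (b) There is an absolute constant $C>0$ (depending on nothing: not on $n$, $p$, $z$, $T$, the $g_i$, the $\Delta_i$ or the distribution of the $X_i$) such that, if $2<p\le3$ and $\mathbb E|g_i(X_i)|^p<\infty$ for all $i$, then for every $z\in\mathbb R$ $$|P(T\le z)-\Phi(z)|\le P\Big(|\Delta|>\tfrac{|z|+1}{3}\Big)+C(|z|+1)^{-p}\Big(\|\Delta\|_2+\sum_{i=1}^n\|g_i(X_i)\|_2\,\|\Delta-\Delta_i\|_2+\sum_{i=1}^n\mathbb E|g_i(X_i)|^p\Big).$$ -/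

import Mathlib

open MeasureTheory ProbabilityTheory
open scoped ENNReal

noncomputable section

/-- The standing setting: `X 1, …, X n` are independent real random variables on `(Ω, P)`, the
`g i` are Borel functions, the `g i (X i)` are square integrable and centred, and their variances
sum to `1`; the statistic is `T (X 1, …, X n)` for a Borel function `T` of `n` real variables. -/
structure StandingAssumptions {Ω : Type*} [MeasurableSpace Ω] (P : Measure Ω) {n : ℕ}
    (X : Fin n → Ω → ℝ) (g : Fin n → ℝ → ℝ) (T : (Fin n → ℝ) → ℝ) : Prop where
  measurable_X : ∀ i, Measurable (X i)
  indep_X : iIndepFun X P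
  measurable_g : ∀ i, Measurable (g i)
  measurable_T : Measurable T
  memLp_g : ∀ i, MemLp (fun ω => g i (X i ω)) 2 P
  mean_g : ∀ i, ∫ ω, g i (X i ω) ∂P = 0
  var_g : ∑ i, ∫ ω, (g i (X i ω)) ^ 2 ∂P = 1

/-- The statistic `T(X 1, …, X n)` as a random variable. -/
def statT {Ω : Type*} {n : ℕ} (X : Fin n → Ω → ℝ) (T : (Fin n → ℝ) → ℝ) (ω : Ω) : ℝ :=
  T (fun i => X i ω)

/-- The linear statistic `W = ∑ i, g i (X i)`. -/
def statW {Ω : Type*} {n : ℕ} (X : Fin n → Ω → ℝ) (g : Fin n → ℝ → ℝ) (ω : Ω) : ℝ :=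
  ∑ i, g i (X i ω)

/-- The error term `Δ = T - W`. -/
def statDelta {Ω : Type*} {n : ℕ} (X : Fin n → Ω → ℝ) (g : Fin n → ℝ → ℝ)
    (T : (Fin n → ℝ) → ℝ) (ω : Ω) : ℝ :=
  statT X T ω - statW X g ω

/-- For each `i`, `D i` is a random variable such that `X i` is independent of
`(D i, (X j)_{j ≠ i})`. -/
def IsLeaveOneOut {Ω : Type*} [MeasurableSpace Ω] (P : Measure Ω) {n : ℕ}
    (X : Fin n → Ω → ℝ) (D : Fin n → Ω → ℝ) : Prop :=
  ∀ i, Measurable (D i) ∧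
    IndepFun (X i) (fun ω => (D i ω, fun j : {j : Fin n // j ≠ i} => X j ω)) P

/-- The admissibility condition on `δ`. -/
def IsAdmissible {Ω : Type*} [MeasurableSpace Ω] (P : Measure Ω) {n : ℕ}
    (X : Fin n → Ω → ℝ) (g : Fin n → ℝ → ℝ) (δ : ℝ) : Prop :=
  0 < δ ∧ 1 / 2 ≤ ∑ i, ∫ ω, |g i (X i ω)| * min δ |g i (X i ω)| ∂P

/-- The tail term `γ_z`. -/
def gammaTerm {Ω : Type*} [MeasurableSpace Ω] (P : Measure Ω) {n : ℕ}
    (X : Fin n → Ω → ℝ) (g : Fin n → ℝ → ℝ) (T : (Fin n → ℝ) → ℝ) (z : ℝ) : ℝ≥0∞ :=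
  P {ω | (|z| + 1) / 3 < |statDelta X g T ω|}
    + ∑ i, P {ω | (|z| + 1) / 3 < |g i (X i ω)|}
    + ∑ i, P {ω | (|z| - 2) / 3 < |statW X g ω - g i (X i ω)|} * P {ω | 1 < |g i (X i ω)|}

/-- The sum `∑ i, ‖g i (X i)‖₂ ‖Δ - Δ i‖₂`, with values in `[0, ∞]`
(and `0 * ∞ = 0`); `eLpNorm f 2 P` is the `L₂` norm, which is `∞` for `f` not in `L₂`. -/
def crossTerm {Ω : Type*} [MeasurableSpace Ω] (P : Measure Ω) {n : ℕ}
    (X : Fin n → Ω → ℝ) (g : Fin n → ℝ → ℝ) (T : (Fin n → ℝ) → ℝ) (D : Fin n → Ω → ℝ) : ℝ≥0∞ :=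
  ∑ i, eLpNorm (fun ω => g i (X i ω)) 2 P * eLpNorm (fun ω => statDelta X g T ω - D i ω) 2 P

/-- The term `τ = 22 δ + 8.5 ‖Δ‖₂ + 3.6 ∑ i, ‖g i (X i)‖₂ ‖Δ - Δ i‖₂`. -/
def tauTerm {Ω : Type*} [MeasurableSpace Ω] (P : Measure Ω) {n : ℕ}
    (X : Fin n → Ω → ℝ) (g : Fin n → ℝ → ℝ) (T : (Fin n → ℝ) → ℝ) (D : Fin n → Ω → ℝ)
    (δ : ℝ) : ℝ≥0∞ :=
  ENNReal.ofReal (22 * δ) + ENNReal.ofReal 8.5 * eLpNorm (statDelta X g T) 2 P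
    + ENNReal.ofReal 3.6 * crossTerm P X g T D

end

set_option linter.unusedSectionVars false

/-! Write ξ_i = g_i(X_i). The events T ≤ z and W ≤ z differ only when W lies between z and z ± |Δ|,
so (a) is a bound on the probability that W falls in a random interval of length |Δ| with one end at
z; passing from ξ to -ξ reduces to z ≥ 0.

The engine is a randomized concentration inequality, `Summands.concentration`. Let R be the sum of
the φ(ξ_i), where φ is the identity or a truncation, and let f_U be a ramp of slope one across the
random interval, widened by δ at both ends, times the weight e^{θw}. On the event in question, Σ ξ_i
(f_U(R) - f_U(R - φ(ξ_i))) is at least e^{θR} Σ |ξ_i| min(δ, |φ(ξ_i)|), and this last sum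
concentrates around its mean, which admissibility of δ keeps above 1/2. From the other side, E ξ_i
f_{V_i}(R - φ(ξ_i)) = 0 by independence, so the expectation is controlled by the interval length U
and by |U - V_i|. With U = |Δ| and V_i = |Δ_i|, both cut at (|z|+1)/3, these give the norms in τ.
Truncating the summands from above at 1 gives exponential moments through Bennett's inequality, and
the weight θ = 1/2 yields the factor e^{-|z|/3}.

Truncation changes W only if some ξ_i > 1. If |Δ| and all ξ_i are at most L = (z+1)/3, the remaining
summands then add up to at least (z-2)/3, which is the last sum of γ_z except that γ_z asks for
strict inequality. The boundary case, with ξ_i = L and the rest exactly (z-2)/3, is charged to δ: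
the concentration inequality for an interval of length zero bounds the atoms of leave-one-out sums.
For L > 3, two summands may equal L while W = 2L - 1; this event is paid for by the overcounting in
the union bound (`Summands.measureReal_union_iUnion_le`).

For (b) let β = Σ E|ξ_i|^p. If β > 1/8, tail bounds of order (|z|+1)^{-p} suffice. If β ≤ 1/8, then
δ = 2β is admissible and (a) applies; Markov and Fuk–Nagaev bounds make the tail sums of γ_z of
order β(|z|+1)^{-p}. What remains is a nonuniform Berry–Esseen bound for W, proved by Stein's method
for the summands clipped to [-1, 1]: the Stein solution at level z decays exponentially in z, and
the jump of its derivative at z is handled by the same concentration inequality. -/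

/-! ### Elementary exponential inequalities -/

theorem exp_le_quadratic_of_nonpos {u : ℝ} (hu : u ≤ 0) : Real.exp u ≤ 1 + u + u ^ 2 / 2 := by
  have h := Real.quadratic_le_exp_of_nonneg (neg_nonneg.2 hu)
  have h2 : Real.exp u * Real.exp (-u) = 1 := by rw [← Real.exp_add]; simp
  have h3 := Real.exp_pos u
  -- The product is at least 1 = e^u e^{-u}, while e^{-u} dominates the second factor; so e^u cannot
  -- exceed the first.
  have h4 : (1 + u + u ^ 2 / 2) * (1 - u + u ^ 2 / 2) = 1 + u ^ 4 / 4 := by ring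
  by_contra! hc
  have h5 : 0 < 1 - u + u ^ 2 / 2 := by nlinarith [sq_nonneg u]
  nlinarith [mul_lt_mul_of_pos_right hc h5, sq_nonneg (u ^ 2), mul_le_mul_of_nonneg_left h h3.le]

/-- The pointwise form of Bennett's inequality. For x ≤ 0 the two sides are separated by quadratics;
for 0 ≤ x ≤ 1 their difference vanishes at t = 0 and is nondecreasing in t, because the chord bound
e^{sx} ≤ x e^s + 1 - x makes its derivative nonnegative. -/
theorem exp_mul_le_quadratic {t x : ℝ} (ht : 0 ≤ t) (hx : x ≤ 1) :
    Real.exp (t * x) ≤ 1 + t * x + (Real.exp t - 1 - t) * x ^ 2 := by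
  rcases le_total x 0 with h0 | h0
  · have h1 := exp_le_quadratic_of_nonpos (mul_nonpos_of_nonneg_of_nonpos ht h0)
    have h2 := Real.quadratic_le_exp_of_nonneg ht
    nlinarith [sq_nonneg x]
  · have hder : ∀ s : ℝ, HasDerivAt
        (fun s : ℝ => (Real.exp s - 1 - s) * x ^ 2 - (Real.exp (s * x) - 1 - s * x))
        ((Real.exp s - 1) * x ^ 2 - (Real.exp (s * x) * x - x)) s := by
      intro s
      have h1 := (((Real.hasDerivAt_exp s).sub_const 1).sub (hasDerivAt_id s)).mul_const (x ^ 2)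
      have h2 := (((hasDerivAt_id s).mul_const x).exp.sub_const 1).sub
        ((hasDerivAt_id s).mul_const x)
      have h3 := h1.sub h2
      simp only [id, one_mul] at h3
      exact h3
    have hmono : Monotone
        (fun s : ℝ => (Real.exp s - 1 - s) * x ^ 2 - (Real.exp (s * x) - 1 - s * x)) := by
      apply monotone_of_deriv_nonneg (fun s => (hder s).differentiableAt)
      intro s
      rw [(hder s).deriv]
      have hc := convexOn_exp.2 (Set.mem_univ s) (Set.mem_univ 0) h0 (sub_nonneg.2 hx) (by ring)
      simp only [smul_eq_mul, mul_zero, add_zero, Real.exp_zero, mul_one] at hc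
      rw [mul_comm x s] at hc
      nlinarith
    have := hmono ht
    simp at this
    linarith

/-- Independent centred square integrable random variables with total variance at most one. -/
structure Summands {Ω : Type*} [MeasurableSpace Ω] (P : Measure Ω) {ι : Type*} [Fintype ι]
    (ξ : ι → Ω → ℝ) : Prop where
  meas : ∀ i, Measurable (ξ i)
  indep : iIndepFun ξ P
  memLp : ∀ i, MemLp (ξ i) 2 P
  mean : ∀ i, ∫ ω, ξ i ω ∂P = 0
  var : ∑ i, ∫ ω, ξ i ω ^ 2 ∂P ≤ 1

/-- The family with the `i`-th summand replaced by zero. -/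
def zeroAt {Ω ι : Type*} [DecidableEq ι] (i : ι) (ξ : ι → Ω → ℝ) (j : ι) (ω : Ω) : ℝ :=
  if j = i then 0 else ξ j ω

/-! ### The weighted ramp used as a test function -/

section Ramp

/-- A ramp of slope one around the interval `[z - c u, z + (1 - c) u]`, with exponential weight. -/
noncomputable def ramp (θ δ c z u w : ℝ) : ℝ :=
  Real.exp (θ * w) * max 0 (min (w - z + c * u + δ) (u + 2 * δ))

variable {θ δ c z u v w s x : ℝ}

theorem ramp_nonneg : 0 ≤ ramp θ δ c z u w :=
  mul_nonneg (Real.exp_pos _).le (le_max_left _ _)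

theorem ramp_le (hδ : 0 ≤ δ) (hu : 0 ≤ u) :
    ramp θ δ c z u w ≤ Real.exp (θ * w) * (u + 2 * δ) :=
  mul_le_mul_of_nonneg_left (max_le (by positivity) (min_le_right _ _)) (Real.exp_pos _).le

theorem ramp_mono (hθ : 0 ≤ θ) : Monotone (ramp θ δ c z u) := by
  intro a b hab
  unfold ramp
  gcongr

/-- Changing the interval length moves the lower edge by c|u - v| and the height by |u - v|. This is
the source of the cross terms |U - V_i|. -/
theorem abs_ramp_sub_le (hc0 : 0 ≤ c) (hc1 : c ≤ 1) :
    |ramp θ δ c z u w - ramp θ δ c z v w| ≤ Real.exp (θ * w) * |u - v| := by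
  unfold ramp
  rw [← mul_sub, abs_mul, abs_of_pos (Real.exp_pos _)]
  refine mul_le_mul_of_nonneg_left ?_ (Real.exp_pos _).le
  refine (abs_max_sub_max_le_max _ _ _ _).trans ?_
  rw [sub_self, abs_zero, max_eq_right (abs_nonneg _)]
  refine (abs_min_sub_min_le_max _ _ _ _).trans (max_le ?_ ?_)
  · rw [show w - z + c * u + δ - (w - z + c * v + δ) = c * (u - v) by ring, abs_mul,
      abs_of_nonneg hc0]
    exact mul_le_of_le_one_left (abs_nonneg _) hc1
  · rw [show u + 2 * δ - (v + 2 * δ) = u - v by ring]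

theorem ramp_eq (h1 : z - c * u - δ ≤ w) (h2 : w ≤ z + (1 - c) * u + δ) :
    ramp θ δ c z u w = Real.exp (θ * w) * (w - z + c * u + δ) := by
  unfold ramp
  rw [min_eq_left (by linarith), max_eq_right (by linarith)]

/-- By monotonicity of the ramp; it allows terms off the interval to be dropped. -/
theorem mul_ramp_sub_nonneg (hθ : 0 ≤ θ) (hx : 0 ≤ x * s) :
    0 ≤ x * (ramp θ δ c z u w - ramp θ δ c z u (w - s)) := by
  rcases lt_trichotomy s 0 with h | h | h
  · have hx' : x ≤ 0 := by nlinarith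
    exact mul_nonneg_of_nonpos_of_nonpos hx'
      (sub_nonpos.2 (ramp_mono hθ (by linarith)))
  · simp [h]
  · have hx' : 0 ≤ x := by nlinarith
    exact mul_nonneg hx' (sub_nonneg.2 (ramp_mono hθ (by linarith)))

/-- From a point of the inner interval the ramp keeps slope one for a further distance δ in both
directions, so a step of length min(δ, |s|) changes it by at least that length times e^{θw}. The
exponential factor is increasing and only helps. -/
theorem le_mul_ramp_sub (hθ : 0 ≤ θ) (hδ : 0 ≤ δ) (hx : 0 ≤ x * s)
    (h1 : z - c * u ≤ w) (h2 : w ≤ z + (1 - c) * u) :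
    Real.exp (θ * w) * (|x| * min δ |s|) ≤ x * (ramp θ δ c z u w - ramp θ δ c z u (w - s)) := by
  have hm0 : 0 ≤ min δ |s| := le_min hδ (abs_nonneg _)
  have hmδ : min δ |s| ≤ δ := min_le_left _ _
  have hms : min δ |s| ≤ |s| := min_le_right _ _
  set m := min δ |s| with hm
  rcases lt_trichotomy s 0 with h | h | h
  · have hx' : x ≤ 0 := by nlinarith
    rw [abs_of_neg h] at hms
    have e1 : Real.exp (θ * w) * m ≤ ramp θ δ c z u (w - s) - ramp θ δ c z u w := by
      have a1 : ramp θ δ c z u (w + m) ≤ ramp θ δ c z u (w - s) := ramp_mono hθ (by linarith)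
      rw [ramp_eq (by linarith) (by linarith)] at a1
      rw [ramp_eq (w := w) (by linarith) (by linarith)]
      have a2 : Real.exp (θ * w) ≤ Real.exp (θ * (w + m)) := by
        apply Real.exp_le_exp.2; nlinarith
      have a3 : 0 ≤ w + m - z + c * u + δ := by linarith
      nlinarith [mul_le_mul_of_nonneg_right a2 a3]
    rw [abs_of_nonpos hx']
    nlinarith
  · have : m = 0 := by rw [hm, h]; simp [hδ]
    simp [this, h]
  · have hx' : 0 ≤ x := by nlinarith
    rw [abs_of_pos h] at hms
    have e1 : Real.exp (θ * w) * m ≤ ramp θ δ c z u w - ramp θ δ c z u (w - s) := by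
      have a1 : ramp θ δ c z u (w - s) ≤ ramp θ δ c z u (w - m) := ramp_mono hθ (by linarith)
      rw [ramp_eq (w := w - m) (by linarith) (by linarith)] at a1
      rw [ramp_eq (w := w) (by linarith) (by linarith)]
      have a2 : Real.exp (θ * (w - m)) ≤ Real.exp (θ * w) := by
        apply Real.exp_le_exp.2; nlinarith
      have a3 : 0 ≤ w - m - z + c * u + δ := by linarith
      nlinarith [mul_le_mul_of_nonneg_right a2 a3]
    rw [abs_of_nonneg hx']
    nlinarith

theorem measurable_ramp : Measurable (fun p : ℝ × ℝ => ramp θ δ c z p.1 p.2) := by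
  unfold ramp; fun_prop

end Ramp

/-! ### Leave-one-out families and second moments -/

section

variable {Ω : Type*} [MeasurableSpace Ω] {P : Measure Ω} {ι : Type*} [Fintype ι] [DecidableEq ι]
  {ξ : ι → Ω → ℝ}

theorem integral_mul_abs_le_sqrt {f g : Ω → ℝ} (hf : MemLp f 2 P) (hg : MemLp g 2 P) :
    ∫ ω, |f ω| * |g ω| ∂P ≤ √(∫ ω, f ω ^ 2 ∂P) * √(∫ ω, g ω ^ 2 ∂P) := by
  have h := integral_mul_le_Lp_mul_Lq_of_nonneg (μ := P) (p := 2) (q := 2)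
    Real.HolderConjugate.two_two (f := fun ω => |f ω|) (g := fun ω => |g ω|)
    (Filter.Eventually.of_forall fun _ => abs_nonneg _)
    (Filter.Eventually.of_forall fun _ => abs_nonneg _)
    (by rw [ENNReal.ofReal_ofNat]; exact hf.abs) (by rw [ENNReal.ofReal_ofNat]; exact hg.abs)
  simp only [Real.rpow_ofNat, sq_abs] at h
  rwa [← Real.sqrt_eq_rpow, ← Real.sqrt_eq_rpow] at h

/-- Zeroing the `i`-th entry instead of deleting it keeps the index type, so that every result on
`Summands` applies verbatim to the leave-one-out family. -/
theorem iIndepFun.indepFun_zeroAt (hI : iIndepFun ξ P) (hm : ∀ i, Measurable (ξ i)) (i : ι)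
    {β : Type*} [MeasurableSpace β] {G : (ι → ℝ) → β} (hG : Measurable G) :
    IndepFun (ξ i) (fun ω => G (fun j => zeroAt i ξ j ω)) P := by
  have h := hI.indepFun_finset {i} (Finset.univ.erase i) (by simp) hm
  have hE : Measurable (fun (v : ((Finset.univ.erase i : Finset ι) : Type _) → ℝ) (j : ι) =>
      if h : j ∈ Finset.univ.erase i then v ⟨j, h⟩ else 0) := by
    refine measurable_pi_lambda _ fun j => ?_
    by_cases hj : j ∈ Finset.univ.erase i
    · simp only [hj, dite_true]; exact measurable_pi_apply _
    · simp only [hj, dite_false]; exact measurable_const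
  have h2 := h.comp (measurable_pi_apply (⟨i, by simp⟩ : ({i} : Finset ι))) (hG.comp hE)
  have e : (fun ω => G (fun j => zeroAt i ξ j ω)) =
      (G ∘ fun (v : ((Finset.univ.erase i : Finset ι) : Type _) → ℝ) (j : ι) =>
        if h : j ∈ Finset.univ.erase i then v ⟨j, h⟩ else 0) ∘ fun ω j => ξ (↑j) ω := by
    funext ω
    simp only [Function.comp]
    congr 1
    funext j
    by_cases hj : j = i <;> simp [zeroAt, hj]
  rw [e]
  exact h2

theorem measurable_zeroAt (hm : ∀ i, Measurable (ξ i)) (i j : ι) : Measurable (zeroAt i ξ j) := by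
  unfold zeroAt
  by_cases h : j = i
  · simp only [h, if_true]; exact measurable_const
  · simp only [h, if_false]; exact hm j

theorem zeroAt_eq_comp (i j : ι) :
    zeroAt i ξ j = (if j = i then fun _ => 0 else id) ∘ ξ j := by
  funext ω; unfold zeroAt; by_cases h : j = i <;> simp [h]

theorem Summands.zeroAt (h : Summands P ξ) (i : ι) : Summands P (zeroAt i ξ) where
  meas j := measurable_zeroAt h.meas i j
  indep := by
    have := h.indep.comp (fun j => if j = i then fun _ => (0 : ℝ) else id) (fun j => by
      by_cases hj : j = i
      · simp only [hj, if_true]; exact measurable_const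
      · simp only [hj, if_false]; exact measurable_id)
    convert this using 2 with j
    exact zeroAt_eq_comp i j
  memLp j := by
    by_cases hj : j = i
    · have : _root_.zeroAt i ξ j = fun _ => 0 := by funext ω; simp [_root_.zeroAt, hj]
      rw [this]; exact MemLp.zero
    · have : _root_.zeroAt i ξ j = ξ j := by funext ω; simp [_root_.zeroAt, hj]
      rw [this]; exact h.memLp j
  mean j := by
    by_cases hj : j = i
    · simp [_root_.zeroAt, hj]
    · simpa [_root_.zeroAt, hj] using h.mean j
  var := by
    refine le_trans (Finset.sum_le_sum fun j _ => ?_) h.var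
    by_cases hj : j = i
    · simp only [_root_.zeroAt, hj, if_true, ne_eq, OfNat.ofNat_ne_zero, not_false_eq_true,
        zero_pow, integral_zero]
      exact integral_nonneg fun _ => sq_nonneg _
    · simp [_root_.zeroAt, hj]

theorem Summands.neg (h : Summands P ξ) : Summands P (fun i ω => -ξ i ω) where
  meas i := (h.meas i).neg
  indep := h.indep.comp (fun _ x => -x) (fun _ => measurable_neg)
  memLp i := (h.memLp i).neg
  mean i := by rw [integral_neg, h.mean i, neg_zero]
  var := by simpa using h.var

theorem sum_zeroAt {φ : ℝ → ℝ} (hφ : φ 0 = 0) (i : ι) (ω : Ω) :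
    ∑ j, φ (zeroAt i ξ j ω) = ∑ j, φ (ξ j ω) - φ (ξ i ω) := by
  rw [← Finset.add_sum_erase _ _ (Finset.mem_univ i),
    ← Finset.add_sum_erase _ (fun j => φ (ξ j ω)) (Finset.mem_univ i)]
  simp only [zeroAt, if_true, hφ, zero_add, add_sub_cancel_left]
  refine Finset.sum_congr rfl fun j hj => ?_
  simp [Finset.ne_of_mem_erase hj]

theorem sum_zeroAt_id (i : ι) (ω : Ω) :
    ∑ j, zeroAt i ξ j ω = ∑ j, ξ j ω - ξ i ω :=
  sum_zeroAt (φ := id) rfl i ω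

theorem Summands.indep_sub (h : Summands P ξ) {φ : ℝ → ℝ} (hφm : Measurable φ) (hφ : φ 0 = 0)
    (i : ι) : IndepFun (ξ i) (fun ω => ∑ j, φ (ξ j ω) - φ (ξ i ω)) P := by
  have := iIndepFun.indepFun_zeroAt h.indep h.meas i
    (G := fun v => ∑ j, φ (v j)) (by fun_prop)
  simpa only [sum_zeroAt hφ] using this

theorem Summands.integrable [IsProbabilityMeasure P] (h : Summands P ξ) (i : ι) :
    Integrable (ξ i) P := (h.memLp i).integrable one_le_two

theorem Summands.memLp_sum (h : Summands P ξ) :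
    MemLp (fun ω => ∑ i, ξ i ω) 2 P := memLp_finsetSum _ fun i _ => h.memLp i

theorem Summands.integral_sum_sq [IsProbabilityMeasure P] (h : Summands P ξ) :
    ∫ ω, (∑ i, ξ i ω) ^ 2 ∂P = ∑ i, ∫ ω, ξ i ω ^ 2 ∂P := by
  have h0 : ∫ ω, (∑ i, ξ i) ω ∂P = 0 := by
    simp only [Finset.sum_apply]
    rw [integral_finsetSum _ fun i _ => h.integrable i]
    simp [h.mean]
  have h1 := IndepFun.variance_sum (μ := P) (X := ξ) (s := Finset.univ) (fun i _ => h.memLp i)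
    (fun i _ j _ hij => h.indep.indepFun hij)
  rw [variance_of_integral_eq_zero (Finset.aemeasurable_sum _ fun i _ => (h.meas i).aemeasurable)
    h0] at h1
  simp only [Finset.sum_apply] at h1
  rw [h1]
  exact Finset.sum_congr rfl fun i _ =>
    variance_of_integral_eq_zero (h.meas i).aemeasurable (h.mean i)

end

/-! ### The randomized concentration inequality -/

section

variable {Ω : Type*} [MeasurableSpace Ω] {P : Measure Ω} [IsProbabilityMeasure P]
  {ι : Type*} [Fintype ι] [DecidableEq ι] {ξ : ι → Ω → ℝ}

/-- This bound grows with the number of summands and serves only integrability. The alternative θ =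
0 lets the same machinery treat untruncated sums without weight. -/
theorem exp_mul_sum_le {φ : ℝ → ℝ} {θ : ℝ} (hθ : 0 ≤ θ) (hbdd : θ = 0 ∨ ∀ x, φ x ≤ 1)
    (v : ι → ℝ) : Real.exp (θ * ∑ j, φ (v j)) ≤ Real.exp (θ * Fintype.card ι) := by
  rcases hbdd with h0 | h1
  · simp [h0]
  · refine Real.exp_le_exp.2 (mul_le_mul_of_nonneg_left ?_ hθ)
    calc ∑ j, φ (v j) ≤ ∑ _j : ι, (1 : ℝ) := Finset.sum_le_sum fun j _ => h1 _
      _ = _ := by simp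

/-- The smoothed concentration inequality for the (transformed) sum `∑ φ (ξ i)` over a random
interval with end points determined by `U`. -/
theorem Summands.integral_indicator_le (h : Summands P ξ) {φ : ℝ → ℝ} (hφm : Measurable φ)
    (hφ0 : φ 0 = 0) (hφs : ∀ x, 0 ≤ x * φ x) {θ δ c z K : ℝ} (hθ : 0 ≤ θ) (hδ : 0 ≤ δ)
    (hc0 : 0 ≤ c) (hc1 : c ≤ 1) (hbdd : θ = 0 ∨ ∀ x, φ x ≤ 1)
    {U : Ω → ℝ} (hUm : Measurable U) (hU0 : ∀ ω, 0 ≤ U ω) (hUK : ∀ ω, U ω ≤ K)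
    {V : ι → Ω → ℝ} (hVm : ∀ i, Measurable (V i)) (hV0 : ∀ i ω, 0 ≤ V i ω)
    (hVK : ∀ i ω, V i ω ≤ K)
    (hind : ∀ i, IndepFun (ξ i) (fun ω => (V i ω, ∑ j, φ (ξ j ω) - φ (ξ i ω))) P) :
    ∫ ω, {ω | z - c * U ω ≤ ∑ j, φ (ξ j ω) ∧ ∑ j, φ (ξ j ω) ≤ z + (1 - c) * U ω}.indicator
        (fun ω => Real.exp (θ * ∑ j, φ (ξ j ω)) * ∑ i, |ξ i ω| * min δ |φ (ξ i ω)|) ω ∂P ≤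
      ∫ ω, |∑ j, ξ j ω| * (Real.exp (θ * ∑ j, φ (ξ j ω)) * (U ω + 2 * δ)) ∂P +
      ∑ i, ∫ ω, |ξ i ω| * (Real.exp (θ * (∑ j, φ (ξ j ω) - φ (ξ i ω))) * |U ω - V i ω|) ∂P := by
  have hm := h.meas
  set R : Ω → ℝ := fun ω => ∑ j, φ (ξ j ω) with hR
  have hRm : Measurable R := by fun_prop
  have hRim : ∀ i, Measurable (fun ω => R ω - φ (ξ i ω)) := fun i => by fun_prop
  set B : ℝ := Real.exp (θ * Fintype.card ι) with hB
  have hRB : ∀ ω, Real.exp (θ * R ω) ≤ B := fun ω => exp_mul_sum_le hθ hbdd _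
  have hRiB : ∀ i ω, Real.exp (θ * (R ω - φ (ξ i ω))) ≤ B := by
    intro i ω
    simp only [hR]
    rw [← sum_zeroAt hφ0]
    exact exp_mul_sum_le hθ hbdd _
  have hB0 : 0 ≤ B := (Real.exp_pos _).le
  have hK0 : ∀ _ : Ω, 0 ≤ K := fun ω => (hU0 ω).trans (hUK ω)
  have hrB : ∀ (u w : Ω → ℝ), (∀ ω, 0 ≤ u ω) → (∀ ω, u ω ≤ K) →
      (∀ ω, Real.exp (θ * w ω) ≤ B) → ∀ᵐ ω ∂P, ‖ramp θ δ c z (u ω) (w ω)‖ ≤ B * (K + 2 * δ) := by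
    intro u w hu0 huK hw
    refine Filter.Eventually.of_forall fun ω => ?_
    rw [Real.norm_of_nonneg ramp_nonneg]
    refine (ramp_le hδ (hu0 ω)).trans ?_
    exact mul_le_mul (hw ω) (by linarith [huK ω]) (by linarith [hu0 ω]) hB0
  have mr : ∀ (u w : Ω → ℝ), Measurable u → Measurable w →
      AEStronglyMeasurable (fun ω => ramp θ δ c z (u ω) (w ω)) P := fun u w hu hw =>
    (measurable_ramp.comp (hu.prodMk hw)).aestronglyMeasurable
  have I1 : ∀ i, Integrable (fun ω => ξ i ω * ramp θ δ c z (U ω) (R ω)) P := fun i =>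
    (h.integrable i).mul_bdd (mr _ _ hUm hRm) (hrB _ _ hU0 hUK hRB)
  have I2 : ∀ i, Integrable (fun ω => ξ i ω * ramp θ δ c z (U ω) (R ω - φ (ξ i ω))) P := fun i =>
    (h.integrable i).mul_bdd (mr _ _ hUm (hRim i)) (hrB _ _ hU0 hUK (hRiB i))
  have I3 : ∀ i, Integrable (fun ω => ξ i ω * ramp θ δ c z (V i ω) (R ω - φ (ξ i ω))) P := fun i =>
    (h.integrable i).mul_bdd (mr _ _ (hVm i) (hRim i)) (hrB _ _ (hV0 i) (hVK i) (hRiB i))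
  -- The centred ξ_i is independent of the pair formed by `V i` and the leave-one-out sum. This is
  -- where the leave-one-out variables are needed.
  have Z : ∀ i, ∫ ω, ξ i ω * ramp θ δ c z (V i ω) (R ω - φ (ξ i ω)) ∂P = 0 := by
    intro i
    have := ((hind i).comp measurable_id
      (measurable_ramp (θ := θ) (δ := δ) (c := c) (z := z))).integral_fun_mul_eq_mul_integral
      (hm i).aestronglyMeasurable (mr _ _ (hVm i) (hRim i))
    simp only [Function.comp, id] at this
    rw [this, h.mean i, zero_mul]
  have IS : Integrable (fun ω => ∑ i, ξ i ω) P := integrable_finsetSum _ fun i _ => h.integrable i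
  have I12 : ∀ i, Integrable (fun ω => ξ i ω * ramp θ δ c z (U ω) (R ω) -
      ξ i ω * ramp θ δ c z (U ω) (R ω - φ (ξ i ω))) P := fun i => (I1 i).sub (I2 i)
  have J1 : Integrable (fun ω => |∑ j, ξ j ω| * (Real.exp (θ * R ω) * (U ω + 2 * δ))) P := by
    refine IS.abs.mul_bdd (c := B * (K + 2 * δ)) (by fun_prop)
      (Filter.Eventually.of_forall fun ω => ?_)
    have := hU0 ω
    rw [Real.norm_of_nonneg (by positivity)]
    exact mul_le_mul (hRB ω) (by linarith [hUK ω]) (by linarith) hB0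
  have J2 : ∀ i, Integrable (fun ω => |ξ i ω| * (Real.exp (θ * (R ω - φ (ξ i ω))) *
      |U ω - V i ω|)) P := by
    intro i
    refine (h.integrable i).abs.mul_bdd (c := B * K)
      (Measurable.aestronglyMeasurable (by have := hRim i; have := hVm i; fun_prop))
      (Filter.Eventually.of_forall fun ω => ?_)
    have := hU0 ω
    rw [Real.norm_of_nonneg (by positivity)]
    refine mul_le_mul (hRiB i ω) (abs_le.2 ⟨?_, ?_⟩) (abs_nonneg _) hB0
    · linarith [hVK i ω]
    · linarith [hUK ω, hV0 i ω]
  set A := {ω | z - c * U ω ≤ R ω ∧ R ω ≤ z + (1 - c) * U ω} with hA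
  -- Lower bound for the increments of the ramp: `le_mul_ramp_sub` on `A`, mere nonnegativity off
  -- `A`.
  have step1 : ∫ ω, A.indicator
        (fun ω => Real.exp (θ * R ω) * ∑ i, |ξ i ω| * min δ |φ (ξ i ω)|) ω ∂P ≤
      ∫ ω, ∑ i, (ξ i ω * ramp θ δ c z (U ω) (R ω) -
        ξ i ω * ramp θ δ c z (U ω) (R ω - φ (ξ i ω))) ∂P := by
    refine integral_mono_of_nonneg (Filter.Eventually.of_forall fun ω => ?_)
      (integrable_finsetSum _ fun i _ => I12 i)
      (Filter.Eventually.of_forall fun ω => ?_)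
    · refine Set.indicator_nonneg (fun ω _ => ?_) ω
      exact mul_nonneg (Real.exp_pos _).le (Finset.sum_nonneg fun i _ =>
        mul_nonneg (abs_nonneg _) (le_min hδ (abs_nonneg _)))
    · by_cases hω : ω ∈ A
      · rw [Set.indicator_of_mem hω]
        simp only [Finset.mul_sum]
        refine Finset.sum_le_sum fun i _ => ?_
        rw [← mul_sub]
        exact le_mul_ramp_sub hθ hδ (hφs _) hω.1 hω.2
      · rw [Set.indicator_of_notMem hω]
        refine Finset.sum_nonneg fun i _ => ?_
        rw [← mul_sub]
        exact mul_ramp_sub_nonneg hθ (hφs _)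
  refine step1.trans ?_
  rw [integral_finsetSum _ fun i _ => I12 i]
  -- The vanishing integral `Z i` is inserted. What is left besides E ξ_i f_U(R) only sees the
  -- replacement of `U` by `V i`.
  have e : ∀ i, ∫ ω, (ξ i ω * ramp θ δ c z (U ω) (R ω) -
        ξ i ω * ramp θ δ c z (U ω) (R ω - φ (ξ i ω))) ∂P =
      ∫ ω, ξ i ω * ramp θ δ c z (U ω) (R ω) ∂P +
      ∫ ω, (ξ i ω * ramp θ δ c z (V i ω) (R ω - φ (ξ i ω)) -
        ξ i ω * ramp θ δ c z (U ω) (R ω - φ (ξ i ω))) ∂P := by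
    intro i
    rw [integral_sub (I1 i) (I2 i), integral_sub (I3 i) (I2 i), Z i]
    ring
  simp only [e, Finset.sum_add_distrib]
  refine add_le_add ?_ (Finset.sum_le_sum fun i _ => ?_)
  · rw [← integral_finsetSum _ fun i _ => I1 i]
    refine integral_mono (integrable_finsetSum _ fun i _ => I1 i) J1 fun ω => ?_
    simp only [← Finset.sum_mul]
    refine mul_le_mul (le_abs_self _) (ramp_le hδ (hU0 ω)) ramp_nonneg (abs_nonneg _)
  · refine integral_mono ((I3 i).sub (I2 i)) (J2 i) fun ω => ?_
    simp only [← mul_sub]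
    refine (le_abs_self _).trans ?_
    rw [abs_mul]
    refine mul_le_mul_of_nonneg_left ?_ (abs_nonneg _)
    rw [abs_sub_comm (U ω)]
    exact abs_ramp_sub_le hc0 hc1

theorem memLp_exp_mul_sum (hm : ∀ i, Measurable (ξ i)) {φ : ℝ → ℝ} (hφm : Measurable φ) {θ : ℝ}
    (hθ : 0 ≤ θ) (hbdd : θ = 0 ∨ ∀ x, φ x ≤ 1) (p : ℝ≥0∞) :
    MemLp (fun ω => Real.exp (θ * ∑ j, φ (ξ j ω))) p P := by
  refine MemLp.of_bound (C := Real.exp (θ * Fintype.card ι))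
    (Measurable.aestronglyMeasurable (by fun_prop))
    (Filter.Eventually.of_forall fun ω => ?_)
  rw [Real.norm_of_nonneg (Real.exp_pos _).le]
  exact exp_mul_sum_le hθ hbdd _

theorem Summands.integral_abs_mul_exp_le (h : Summands P ξ) {φ : ℝ → ℝ} (hφm : Measurable φ)
    {θ M : ℝ} (hθ : 0 ≤ θ) (hbdd : θ = 0 ∨ ∀ x, φ x ≤ 1)
    (hM : ∫ ω, Real.exp (2 * θ * ∑ j, φ (ξ j ω)) ∂P ≤ M) :
    ∫ ω, |∑ j, ξ j ω| * Real.exp (θ * ∑ j, φ (ξ j ω)) ∂P ≤ √M := by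
  have h1 := integral_mul_abs_le_sqrt h.memLp_sum (memLp_exp_mul_sum h.meas hφm hθ hbdd 2)
  simp only [abs_of_pos (Real.exp_pos _)] at h1
  rw [h.integral_sum_sq] at h1
  refine h1.trans ?_
  rw [← one_mul (√M)]
  refine mul_le_mul (Real.sqrt_le_one.2 h.var) (Real.sqrt_le_sqrt ?_) (Real.sqrt_nonneg _)
    zero_le_one
  refine le_trans (le_of_eq ?_) hM
  congr 1
  funext ω
  rw [← Real.exp_nat_mul]
  congr 1
  push_cast; ring

/-- The sum is made of independent terms bounded by δ|ξ_i|, so its variance is at most δ²;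
Cauchy–Schwarz separates it from the exponential weight. -/
theorem Summands.integral_exp_mul_abs_sub_le (h : Summands P ξ) {φ : ℝ → ℝ} (hφm : Measurable φ)
    {θ δ M : ℝ} (hθ : 0 ≤ θ) (hδ : 0 ≤ δ) (hbdd : θ = 0 ∨ ∀ x, φ x ≤ 1)
    (hM : ∫ ω, Real.exp (2 * θ * ∑ j, φ (ξ j ω)) ∂P ≤ M) :
    ∫ ω, Real.exp (θ * ∑ j, φ (ξ j ω)) * |∑ i, |ξ i ω| * min δ |φ (ξ i ω)| -
      ∑ i, ∫ ω, |ξ i ω| * min δ |φ (ξ i ω)| ∂P| ∂P ≤ √M * δ := by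
  have hm := h.meas
  set Y : ι → Ω → ℝ := fun i ω => |ξ i ω| * min δ |φ (ξ i ω)| with hY
  have hYm : ∀ i, Measurable (Y i) := fun i => by
    have := hm i
    fun_prop
  have hYle : ∀ i ω, ‖Y i ω‖ ≤ ‖δ * ξ i ω‖ := by
    intro i ω
    have : 0 ≤ min δ |φ (ξ i ω)| := le_min hδ (abs_nonneg _)
    rw [Real.norm_of_nonneg (by positivity), norm_mul, Real.norm_of_nonneg hδ, mul_comm δ]
    exact mul_le_mul_of_nonneg_left (min_le_left _ _) (abs_nonneg _)
  have hYL : ∀ i, MemLp (Y i) 2 P := fun i =>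
    ((h.memLp i).const_mul δ).mono (hYm i).aestronglyMeasurable
      (Filter.Eventually.of_forall (hYle i))
  have hS : MemLp (fun ω => ∑ i, Y i ω) 2 P := memLp_finsetSum _ fun i _ => hYL i
  have hSL : MemLp (fun ω => ∑ i, Y i ω - ∑ i, ∫ ω, Y i ω ∂P) 2 P := hS.sub (memLp_const _)
  have h1 := integral_mul_abs_le_sqrt (memLp_exp_mul_sum h.meas hφm hθ hbdd 2) hSL
  simp only [abs_of_pos (Real.exp_pos _)] at h1
  refine h1.trans ?_
  refine mul_le_mul (Real.sqrt_le_sqrt ?_) ?_ (Real.sqrt_nonneg _) (Real.sqrt_nonneg _)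
  · refine le_trans (le_of_eq ?_) hM
    congr 1
    funext ω
    rw [← Real.exp_nat_mul]
    congr 1
    push_cast; ring
  · refine Real.sqrt_le_iff.2 ⟨hδ, ?_⟩
    have hv := IndepFun.variance_sum (μ := P) (X := Y) (s := Finset.univ) (fun i _ => hYL i)
      (fun i _ j _ hij => (h.indep.indepFun hij).comp
        (φ := fun x => |x| * min δ |φ x|) (ψ := fun x => |x| * min δ |φ x|)
        (by fun_prop) (by fun_prop))
    rw [variance_eq_integral (Finset.aemeasurable_sum _ fun i _ => (hYm i).aemeasurable)] at hv
    simp only [Finset.sum_apply] at hv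
    rw [integral_finsetSum _ fun i _ => (hYL i).integrable one_le_two] at hv
    rw [hv]
    calc ∑ i, Var[Y i; P] ≤ ∑ i, δ ^ 2 * ∫ ω, ξ i ω ^ 2 ∂P := by
          refine Finset.sum_le_sum fun i _ => ?_
          refine (variance_le_expectation_sq (hYm i).aestronglyMeasurable).trans ?_
          rw [← integral_const_mul]
          refine integral_mono (hYL i).integrable_sq ((h.memLp i).integrable_sq.const_mul _) ?_
          intro ω
          have := hYle i ω
          simp only [Pi.pow_apply]
          rw [← mul_pow, ← sq_abs, ← sq_abs (δ * _)]
          exact pow_le_pow_left₀ (abs_nonneg _) this 2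
      _ ≤ δ ^ 2 := by
          rw [← Finset.mul_sum]
          exact mul_le_of_le_one_right (sq_nonneg _) h.var

/-- Randomized concentration inequality for the (transformed) sum `∑ φ (ξ i)`. -/
theorem Summands.concentration (h : Summands P ξ) {φ : ℝ → ℝ} (hφm : Measurable φ)
    (hφ0 : φ 0 = 0) (hφs : ∀ x, 0 ≤ x * φ x) {θ δ c z K κ M E : ℝ} (hθ : 0 ≤ θ) (hδ : 0 ≤ δ)
    (hc0 : 0 ≤ c) (hc1 : c ≤ 1) (hbdd : θ = 0 ∨ ∀ x, φ x ≤ 1)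
    (hM : ∫ ω, Real.exp (2 * θ * ∑ j, φ (ξ j ω)) ∂P ≤ M)
    (hκ0 : 0 ≤ κ) (hκ : κ ≤ ∑ i, ∫ ω, |ξ i ω| * min δ |φ (ξ i ω)| ∂P)
    {U : Ω → ℝ} (hUm : Measurable U) (hU0 : ∀ ω, 0 ≤ U ω) (hUK : ∀ ω, U ω ≤ K)
    {V : ι → Ω → ℝ} (hVm : ∀ i, Measurable (V i)) (hV0 : ∀ i ω, 0 ≤ V i ω)
    (hVK : ∀ i ω, V i ω ≤ K)
    (hind : ∀ i, IndepFun (ξ i) (fun ω => (V i ω, ∑ j, φ (ξ j ω) - φ (ξ i ω))) P)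
    {A : Set Ω} (hA : MeasurableSet A)
    (hAz : ∀ ω ∈ A, z - c * U ω ≤ ∑ j, φ (ξ j ω) ∧ ∑ j, φ (ξ j ω) ≤ z + (1 - c) * U ω)
    (hAE : ∀ ω ∈ A, E ≤ Real.exp (θ * ∑ j, φ (ξ j ω))) :
    κ * (E * P.real A) ≤ ∫ ω, |∑ j, ξ j ω| * (Real.exp (θ * ∑ j, φ (ξ j ω)) * U ω) ∂P +
      3 * δ * √M +
      ∑ i, ∫ ω, |ξ i ω| * (Real.exp (θ * (∑ j, φ (ξ j ω) - φ (ξ i ω))) * |U ω - V i ω|) ∂P := by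
  have hm := h.meas
  have h1 := h.integral_indicator_le hφm hφ0 hφs (z := z) hθ hδ hc0 hc1 hbdd hUm hU0 hUK hVm hV0
    hVK hind
  have h2 := h.integral_abs_mul_exp_le hφm hθ hbdd hM
  have h3 := h.integral_exp_mul_abs_sub_le hφm hθ hδ hbdd hM
  set R : Ω → ℝ := fun ω => ∑ j, φ (ξ j ω) with hR
  have hRm : Measurable R := by fun_prop
  set η : Ω → ℝ := fun ω => ∑ i, |ξ i ω| * min δ |φ (ξ i ω)| with hη
  have hη0 : ∀ ω, 0 ≤ η ω := fun ω => Finset.sum_nonneg fun i _ =>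
        mul_nonneg (abs_nonneg _) (le_min hδ (abs_nonneg _))
  set m := ∑ i, ∫ ω, |ξ i ω| * min δ |φ (ξ i ω)| ∂P with hm'
  have hexp : ∀ ω, ‖Real.exp (θ * R ω)‖ ≤ Real.exp (θ * Fintype.card ι) := fun ω => by
    rw [Real.norm_of_nonneg (Real.exp_pos _).le]
    exact exp_mul_sum_le hθ hbdd _
  have hηI : Integrable η P := by
    refine integrable_finsetSum _ fun i _ => ?_
    refine (h.integrable i).abs.mul_bdd (c := δ)
      (Measurable.aestronglyMeasurable (by have := hm i; fun_prop))
      (Filter.Eventually.of_forall fun ω => ?_)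
    rw [Real.norm_of_nonneg (le_min hδ (abs_nonneg _))]
    exact min_le_left _ _
  have heI : Integrable (fun ω => Real.exp (θ * R ω) * |η ω - m|) P :=
    (hηI.sub (integrable_const m)).abs.bdd_mul (by fun_prop) (Filter.Eventually.of_forall hexp)
  have heη : Integrable (fun ω => Real.exp (θ * R ω) * η ω) P :=
    hηI.bdd_mul (by fun_prop) (Filter.Eventually.of_forall hexp)
  have hS : Integrable (fun ω => |∑ j, ξ j ω|) P :=
    (integrable_finsetSum _ fun i _ => h.integrable i).abs
  have hSe : Integrable (fun ω => |∑ j, ξ j ω| * Real.exp (θ * R ω)) P :=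
    hS.mul_bdd (by fun_prop) (Filter.Eventually.of_forall hexp)
  have hSU : Integrable (fun ω => |∑ j, ξ j ω| * (Real.exp (θ * R ω) * U ω)) P := by
    refine hS.mul_bdd (c := Real.exp (θ * Fintype.card ι) * K) (by fun_prop)
      (Filter.Eventually.of_forall fun ω => ?_)
    rw [norm_mul]
    refine mul_le_mul (hexp ω) ?_ (norm_nonneg _) (Real.exp_pos _).le
    rw [Real.norm_of_nonneg (hU0 ω)]
    exact hUK ω
  set A' := {ω | z - c * U ω ≤ R ω ∧ R ω ≤ z + (1 - c) * U ω} with hA'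
  have hA'm : MeasurableSet A' :=
    (measurableSet_le (by fun_prop) hRm).inter (measurableSet_le hRm (by fun_prop))
  -- The random sum `η` is replaced by its mean `m`, which is at least κ, at the price of its
  -- weighted fluctuation.
  have hlow : κ * (E * P.real A) - ∫ ω, Real.exp (θ * R ω) * |η ω - m| ∂P ≤
      ∫ ω, A'.indicator (fun ω => Real.exp (θ * R ω) * η ω) ω ∂P := by
    have hc : κ * (E * P.real A) = ∫ ω, A.indicator (fun _ => κ * E) ω ∂P := by
      rw [integral_indicator_const _ hA, smul_eq_mul]; ring
    have hAI : Integrable (A.indicator (fun _ => κ * E)) P := (integrable_const _).indicator hA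
    rw [hc, ← integral_sub hAI heI]
    refine integral_mono (hAI.sub heI) (heη.indicator hA'm) fun ω => ?_
    have hpos := Real.exp_pos (θ * R ω)
    by_cases hω : ω ∈ A
    · have hω' : ω ∈ A' := hAz ω hω
      simp only [Set.indicator_of_mem hω, Set.indicator_of_mem hω']
      have e1 : E ≤ Real.exp (θ * R ω) := hAE ω hω
      have e2 := neg_abs_le (η ω - m)
      have e3 : κ * E ≤ m * Real.exp (θ * R ω) :=
        (mul_le_mul_of_nonneg_left e1 hκ0).trans (mul_le_mul_of_nonneg_right hκ hpos.le)
      nlinarith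
    · simp only [Set.indicator_of_notMem hω, zero_sub]
      refine le_trans (b := 0) (neg_nonpos.2 (by positivity)) (Set.indicator_nonneg (fun ω _ => ?_) ω)
      exact mul_nonneg (Real.exp_pos _).le (hη0 ω)
  -- The margins of the ramp cost 2δ√M; together with the fluctuation of `η`, which costs δ√M, they
  -- make up 3δ√M.
  have hsplit : ∫ ω, |∑ j, ξ j ω| * (Real.exp (θ * R ω) * (U ω + 2 * δ)) ∂P =
      ∫ ω, |∑ j, ξ j ω| * (Real.exp (θ * R ω) * U ω) ∂P +
      2 * δ * ∫ ω, |∑ j, ξ j ω| * Real.exp (θ * R ω) ∂P := by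
    rw [← integral_const_mul, ← integral_add hSU (hSe.const_mul _)]
    congr 1
    funext ω
    ring
  rw [hsplit] at h1
  have := mul_le_mul_of_nonneg_left h2 (by positivity : 0 ≤ 2 * δ)
  linarith

end

/-! ### Exponential moments of sums truncated from above -/

section

variable {Ω : Type*} [MeasurableSpace Ω] {P : Measure Ω} [IsProbabilityMeasure P]
  {ι : Type*} [Fintype ι] [DecidableEq ι] {ξ : ι → Ω → ℝ}

theorem abs_min_one_le (x : ℝ) : |min x 1| ≤ |x| := by
  rcases le_total x 1 with h | h
  · rw [min_eq_left h]
  · rw [min_eq_right h, abs_one, abs_of_nonneg (by linarith)]; exact h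

theorem mul_min_one_nonneg (x : ℝ) : 0 ≤ x * min x 1 := by
  rcases le_total x 1 with h | h
  · rw [min_eq_left h]; exact mul_self_nonneg x
  · rw [min_eq_right h]; linarith

/-- This is why δ ≤ 1 is assumed later: the admissibility condition, stated for the untruncated
summands, is then not affected by truncation. -/
theorem min_abs_min_one {δ : ℝ} (hδ : δ ≤ 1) (x : ℝ) : min δ |min x 1| = min δ |x| := by
  rcases le_total x 1 with h | h
  · rw [min_eq_left h]
  · rw [min_eq_right h, abs_one, abs_of_nonneg (by linarith), min_eq_left hδ,
      min_eq_left (hδ.trans h)]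

/-- In the Bennett bound the linear term min(X, a) may be replaced by X, which has mean zero:
truncation from above only lowers the mean. Hence one-sided truncation needs no correction. -/
theorem integral_exp_mul_min_le {X : Ω → ℝ} (hX : MemLp X 2 P)
    (hX0 : ∫ ω, X ω ∂P = 0) {t a : ℝ} (ht : 0 ≤ t) (ha : 0 < a) :
    ∫ ω, Real.exp (t * min (X ω) a) ∂P ≤
      Real.exp ((Real.exp (t * a) - 1 - t * a) / a ^ 2 * ∫ ω, X ω ^ 2 ∂P) := by
  have hk : 0 ≤ (Real.exp (t * a) - 1 - t * a) / a ^ 2 := by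
    have := Real.add_one_le_exp (t * a)
    apply div_nonneg <;> nlinarith
  have hpt : ∀ ω, Real.exp (t * min (X ω) a) ≤
      1 + t * X ω + (Real.exp (t * a) - 1 - t * a) / a ^ 2 * X ω ^ 2 := by
    intro ω
    have h1 := exp_mul_le_quadratic (t := t * a) (x := min (X ω) a / a) (by positivity)
      ((div_le_one ha).2 (min_le_right _ _))
    rw [show t * a * (min (X ω) a / a) = t * min (X ω) a by field_simp, div_pow] at h1
    refine h1.trans ?_
    have h2 : min (X ω) a ^ 2 ≤ X ω ^ 2 := by
      rcases le_total (X ω) a with h | h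
      · rw [min_eq_left h]
      · rw [min_eq_right h]; nlinarith
    have h3 : t * min (X ω) a ≤ t * X ω := mul_le_mul_of_nonneg_left (min_le_left _ _) ht
    have h4 := mul_le_mul_of_nonneg_left h2 hk
    have h5 : (Real.exp (t * a) - 1 - t * a) * (min (X ω) a ^ 2 / a ^ 2) =
      (Real.exp (t * a) - 1 - t * a) / a ^ 2 * min (X ω) a ^ 2 := by ring
    linarith
  have hi1 : Integrable X P := hX.integrable one_le_two
  have hi2 := hX.integrable_sq
  have hi3 : Integrable (fun ω => 1 + t * X ω) P := (integrable_const _).add (hi1.const_mul _)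
  refine (integral_mono_of_nonneg (Filter.Eventually.of_forall fun _ => (Real.exp_pos _).le)
    (hi3.add (hi2.const_mul _)) (Filter.Eventually.of_forall hpt)).trans ?_
  simp only [Pi.add_apply]
  rw [integral_add hi3 (hi2.const_mul _), integral_add (integrable_const _) (hi1.const_mul _),
    integral_const_mul, integral_const_mul, hX0]
  simp only [integral_const, probReal_univ, smul_eq_mul, mul_one, mul_zero, add_zero]
  linarith [Real.add_one_le_exp ((Real.exp (t * a) - 1 - t * a) / a ^ 2 * ∫ ω, X ω ^ 2 ∂P)]

theorem Summands.integral_exp_sum_le (h : Summands P ξ) {φ : ℝ → ℝ} (hφm : Measurable φ)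
    {t κ : ℝ} (hκ : 0 ≤ κ)
    (hexp : ∀ i, ∫ ω, Real.exp (t * φ (ξ i ω)) ∂P ≤ Real.exp (κ * ∫ ω, ξ i ω ^ 2 ∂P)) :
    ∫ ω, Real.exp (t * ∑ i, φ (ξ i ω)) ∂P ≤ Real.exp κ := by
  have hI := h.indep.comp (fun _ => φ) (fun _ => hφm)
  have h1 := hI.mgf_sum (t := t) (fun i => hφm.comp (h.meas i)) Finset.univ
  simp only [mgf, Finset.sum_apply, Function.comp] at h1
  rw [h1]
  calc ∏ i, ∫ ω, Real.exp (t * φ (ξ i ω)) ∂P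
      ≤ ∏ i, Real.exp (κ * ∫ ω, ξ i ω ^ 2 ∂P) :=
        Finset.prod_le_prod (fun i _ => integral_nonneg fun _ => (Real.exp_pos _).le)
          fun i _ => hexp i
    _ = Real.exp (κ * ∑ i, ∫ ω, ξ i ω ^ 2 ∂P) := by rw [← Real.exp_sum, Finset.mul_sum]
    _ ≤ Real.exp κ := Real.exp_le_exp.2 (mul_le_of_le_one_right hκ h.var)

theorem Summands.integral_exp_sum_min_le (h : Summands P ξ) {t a : ℝ} (ht : 0 ≤ t) (ha : 0 < a) :
    ∫ ω, Real.exp (t * ∑ i, min (ξ i ω) a) ∂P ≤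
      Real.exp ((Real.exp (t * a) - 1 - t * a) / a ^ 2) := by
  have hk : 0 ≤ (Real.exp (t * a) - 1 - t * a) / a ^ 2 := by
    have := Real.add_one_le_exp (t * a)
    apply div_nonneg <;> nlinarith
  exact h.integral_exp_sum_le (φ := fun x => min x a) (by fun_prop) hk fun i =>
    integral_exp_mul_min_le (h.memLp i) (h.mean i) ht ha

theorem Summands.integral_exp_sum_min_one_le (h : Summands P ξ) {t : ℝ} (ht : 0 ≤ t) :
    ∫ ω, Real.exp (t * ∑ i, min (ξ i ω) 1) ∂P ≤ Real.exp (Real.exp t - 1 - t) := by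
  simpa using h.integral_exp_sum_min_le ht one_pos

theorem abs_exp_sub_one_le {u : ℝ} (hu : u ≤ 1) :
    |Real.exp u - 1| ≤ (Real.exp 1 - 1) * |u| := by
  have he : 2 ≤ Real.exp 1 := by have := Real.add_one_le_exp (1 : ℝ); linarith
  rcases le_total u 0 with h | h
  · have h1 : Real.exp u ≤ 1 := Real.exp_le_one_iff.2 h
    have h2 := Real.add_one_le_exp u
    rw [abs_of_nonpos (by linarith), abs_of_nonpos h]
    nlinarith
  · have h1 : 1 ≤ Real.exp u := Real.one_le_exp h
    have hc := convexOn_exp.2 (Set.mem_univ 1) (Set.mem_univ 0) h (sub_nonneg.2 hu) (by ring)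
    simp only [smul_eq_mul, mul_zero, add_zero, Real.exp_zero, mul_one] at hc
    rw [abs_of_nonneg (by linarith), abs_of_nonneg h]
    linarith

theorem Summands.integral_mul_exp_sum (h : Summands P ξ) {φ : ℝ → ℝ} (hφm : Measurable φ)
    (hφ0 : φ 0 = 0) {F : ℝ → ℝ} (hF : Measurable F) (i : ι) :
    ∫ ω, F (ξ i ω) * Real.exp (∑ j, φ (ξ j ω)) ∂P =
      (∫ ω, F (ξ i ω) * Real.exp (φ (ξ i ω)) ∂P) *
        ∫ ω, Real.exp (∑ j, φ (_root_.zeroAt i ξ j ω)) ∂P := by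
  have h1 := (iIndepFun.indepFun_zeroAt h.indep h.meas i
    (G := fun v => Real.exp (∑ j, φ (v j))) (by fun_prop)).comp
    (φ := fun x => F x * Real.exp (φ x)) (ψ := id) (by fun_prop) measurable_id
  have h2 := h1.integral_fun_mul_eq_mul_integral
    (Measurable.aestronglyMeasurable (by have := h.meas i; fun_prop))
    (Measurable.aestronglyMeasurable (by have := fun j => measurable_zeroAt h.meas i j; fun_prop))
  simp only [Function.comp, id] at h2
  rw [← h2]
  congr 1
  funext ω
  rw [sum_zeroAt hφ0, mul_assoc, ← Real.exp_add]
  ring_nf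

/-- Since ξ_i is centred, 1 can be subtracted from the exponential, which gains a second factor
|ξ_i|. -/
theorem Summands.abs_integral_mul_exp_min_le (h : Summands P ξ) (i : ι) :
    |∫ ω, ξ i ω * Real.exp (min (ξ i ω) 1) ∂P| ≤ (Real.exp 1 - 1) * ∫ ω, ξ i ω ^ 2 ∂P := by
  have hm := h.meas i
  have hI : Integrable (fun ω => ξ i ω * Real.exp (min (ξ i ω) 1)) P := by
    refine (h.integrable i).mul_bdd (c := Real.exp 1)
      (Measurable.aestronglyMeasurable (by fun_prop)) (Filter.Eventually.of_forall fun ω => ?_)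
    rw [Real.norm_of_nonneg (Real.exp_pos _).le]
    exact Real.exp_le_exp.2 (min_le_right _ _)
  have e : ∫ ω, ξ i ω * Real.exp (min (ξ i ω) 1) ∂P =
      ∫ ω, ξ i ω * (Real.exp (min (ξ i ω) 1) - 1) ∂P := by
    simp only [mul_sub, mul_one]
    rw [integral_sub hI (h.integrable i), h.mean i, sub_zero]
  rw [e, ← integral_const_mul]
  refine abs_integral_le_integral_abs.trans ?_
  refine integral_mono_of_nonneg (Filter.Eventually.of_forall fun _ => abs_nonneg _)
    ((h.memLp i).integrable_sq.const_mul _) (Filter.Eventually.of_forall fun ω => ?_)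
  simp only
  rw [abs_mul, ← sq_abs]
  have h1 := abs_exp_sub_one_le (min_le_right (ξ i ω) 1)
  have h2 := abs_min_one_le (ξ i ω)
  have h3 : 0 ≤ Real.exp 1 - 1 := by have := Real.add_one_le_exp (1 : ℝ); linarith
  nlinarith [abs_nonneg (ξ i ω), mul_le_mul_of_nonneg_left h2 h3]

/-- The square is expanded and the weight factorizes by independence. Let v_i be the variances and M
the bound for the exponential moment. A diagonal term is at most M e v_i; an off-diagonal one is at
most M (e-1)² v_i v_j, both factors being centred. As the v_i sum to at most 1, the bound is free of
the number of summands. -/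
theorem Summands.integral_sq_mul_exp_min_le (h : Summands P ξ) :
    ∫ ω, (∑ i, ξ i ω) ^ 2 * Real.exp (∑ j, min (ξ j ω) 1) ∂P ≤
      Real.exp (Real.exp 1 - 2) * (Real.exp 1 + (Real.exp 1 - 1) ^ 2) := by
  have hm := h.meas
  set M := Real.exp (Real.exp 1 - 2) with hM
  have hM0 : 0 < M := Real.exp_pos _
  have he : 0 ≤ Real.exp 1 - 1 := by have := Real.add_one_le_exp (1 : ℝ); linarith
  set v : ι → ℝ := fun i => ∫ ω, ξ i ω ^ 2 ∂P with hv
  have hv0 : ∀ i, 0 ≤ v i := fun i => integral_nonneg fun _ => sq_nonneg _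
  have hexpM : ∀ {ζ : ι → Ω → ℝ}, Summands P ζ → ∫ ω, Real.exp (∑ j, min (ζ j ω) 1) ∂P ≤ M := by
    intro ζ hζ
    have := hζ.integral_exp_sum_min_one_le zero_le_one
    simp only [one_mul] at this
    convert this using 2
    ring
  have hexp0 : ∀ (ζ : ι → Ω → ℝ), 0 ≤ ∫ ω, Real.exp (∑ j, min (ζ j ω) 1) ∂P := fun ζ =>
    integral_nonneg fun _ => (Real.exp_pos _).le
  have hI : ∀ i j, Integrable (fun ω => ξ i ω * ξ j ω * Real.exp (∑ j, min (ξ j ω) 1)) P := by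
    intro i j
    refine ((h.memLp i).integrable_mul (h.memLp j)).mul_bdd (c := Real.exp (Fintype.card ι))
      (Measurable.aestronglyMeasurable (by fun_prop)) (Filter.Eventually.of_forall fun ω => ?_)
    rw [Real.norm_of_nonneg (Real.exp_pos _).le]
    have := exp_mul_sum_le (φ := fun x => min x 1) zero_le_one (Or.inr fun x => min_le_right _ _)
      (fun j => ξ j ω)
    simpa using this
  have hdiag : ∀ i, ∫ ω, ξ i ω * ξ i ω * Real.exp (∑ j, min (ξ j ω) 1) ∂P ≤
      M * Real.exp 1 * v i := by
    intro i
    have h1 := h.integral_mul_exp_sum (φ := fun x => min x 1) (by fun_prop) (by simp)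
      (F := fun x => x * x) (by fun_prop) i
    rw [h1]
    have h2 : ∫ ω, ξ i ω * ξ i ω * Real.exp (min (ξ i ω) 1) ∂P ≤ Real.exp 1 * v i := by
      rw [← integral_const_mul]
      refine integral_mono_of_nonneg (Filter.Eventually.of_forall fun _ =>
        mul_nonneg (mul_self_nonneg _) (Real.exp_pos _).le)
        ((h.memLp i).integrable_sq.const_mul _) (Filter.Eventually.of_forall fun ω => ?_)
      simp only
      have := Real.exp_le_exp.2 (min_le_right (ξ i ω) 1)
      nlinarith [mul_self_nonneg (ξ i ω)]
    calc _ ≤ (Real.exp 1 * v i) * M := mul_le_mul h2 (hexpM (h.zeroAt i)) (hexp0 _)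
          (mul_nonneg (Real.exp_pos _).le (hv0 i))
      _ = _ := by ring
  have hoff : ∀ i j, i ≠ j → ∫ ω, ξ i ω * ξ j ω * Real.exp (∑ j, min (ξ j ω) 1) ∂P ≤
      M * (Real.exp 1 - 1) ^ 2 * (v i * v j) := by
    intro i j hij
    have hji : j ≠ i := hij.symm
    have h1 := (iIndepFun.indepFun_zeroAt h.indep h.meas i
      (G := fun v => v j * Real.exp (∑ k, min (v k) 1)) (by fun_prop)).comp
      (φ := fun x => x * Real.exp (min x 1)) (ψ := id) (by fun_prop) measurable_id
    have h2 := h1.integral_fun_mul_eq_mul_integral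
      (Measurable.aestronglyMeasurable (by fun_prop))
      (Measurable.aestronglyMeasurable (by have := fun j => measurable_zeroAt h.meas i j; fun_prop))
    simp only [Function.comp, id] at h2
    have h3 := (h.zeroAt i).integral_mul_exp_sum (φ := fun x => min x 1) (by fun_prop) (by simp)
      (F := fun x => x) measurable_id j
    rw [h3] at h2
    have e : ∫ ω, ξ i ω * ξ j ω * Real.exp (∑ j, min (ξ j ω) 1) ∂P =
        ∫ ω, ξ i ω * Real.exp (min (ξ i ω) 1) *
          (_root_.zeroAt i ξ j ω * Real.exp (∑ k, min (_root_.zeroAt i ξ k ω) 1)) ∂P := by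
      congr 1
      funext ω
      rw [sum_zeroAt (φ := fun x => min x 1) (by simp), _root_.zeroAt, if_neg hji, Real.exp_sub]
      field_simp
    rw [e, h2]
    refine (le_abs_self _).trans ?_
    rw [abs_mul, abs_mul, abs_of_nonneg (hexp0 _)]
    have b1 := h.abs_integral_mul_exp_min_le i
    have b2 := (h.zeroAt i).abs_integral_mul_exp_min_le j
    have b3 : ∫ ω, _root_.zeroAt i ξ j ω ^ 2 ∂P = v j := by
      simp [_root_.zeroAt, hji, hv]
    rw [b3] at b2
    have b4 := hexpM ((h.zeroAt i).zeroAt j)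
    calc _ ≤ (Real.exp 1 - 1) * v i * ((Real.exp 1 - 1) * v j * M) := by
          refine mul_le_mul b1 (mul_le_mul b2 b4 (hexp0 _) ?_) ?_ ?_
          · exact mul_nonneg he (hv0 j)
          · exact mul_nonneg (abs_nonneg _) (hexp0 _)
          · exact mul_nonneg he (hv0 i)
      _ = _ := by ring
  calc ∫ ω, (∑ i, ξ i ω) ^ 2 * Real.exp (∑ j, min (ξ j ω) 1) ∂P
      = ∑ i, ∑ j, ∫ ω, ξ i ω * ξ j ω * Real.exp (∑ j, min (ξ j ω) 1) ∂P := by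
        rw [← Finset.sum_congr rfl fun i _ => integral_finsetSum _ fun j _ => hI i j,
          ← integral_finsetSum _ fun i _ => integrable_finsetSum _ fun j _ => hI i j]
        congr 1
        funext ω
        rw [pow_two, Finset.sum_mul_sum, Finset.sum_mul]
        exact Finset.sum_congr rfl fun i _ => Finset.sum_mul _ _ _
    _ ≤ ∑ i, (M * Real.exp 1 * v i + ∑ j, M * (Real.exp 1 - 1) ^ 2 * (v i * v j)) := by
        refine Finset.sum_le_sum fun i _ => ?_
        rw [← Finset.add_sum_erase _ _ (Finset.mem_univ i)]
        refine add_le_add (hdiag i) ?_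
        refine (Finset.sum_le_sum fun j hj => hoff i j (Finset.ne_of_mem_erase hj).symm).trans ?_
        exact Finset.sum_le_sum_of_subset_of_nonneg (Finset.erase_subset _ _) fun j _ _ =>
          mul_nonneg (mul_nonneg hM0.le (sq_nonneg _)) (mul_nonneg (hv0 i) (hv0 j))
    _ = M * Real.exp 1 * (∑ i, v i) + M * (Real.exp 1 - 1) ^ 2 * ((∑ i, v i) * ∑ i, v i) := by
        rw [Finset.sum_add_distrib, Finset.sum_mul_sum]
        simp only [Finset.mul_sum]
    _ ≤ M * (Real.exp 1 + (Real.exp 1 - 1) ^ 2) := by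
        have hs : ∑ i, v i ≤ 1 := h.var
        have hs0 : 0 ≤ ∑ i, v i := Finset.sum_nonneg fun i _ => hv0 i
        have c1 : M * Real.exp 1 * (∑ i, v i) ≤ M * Real.exp 1 * 1 :=
          mul_le_mul_of_nonneg_left hs (by positivity)
        have c2 : M * (Real.exp 1 - 1) ^ 2 * ((∑ i, v i) * ∑ i, v i) ≤
            M * (Real.exp 1 - 1) ^ 2 * 1 :=
          mul_le_mul_of_nonneg_left (by nlinarith) (by positivity)
        linarith

end

/-! ### Numerical constants, and concentration of the truncated sum -/

theorem exp_exp_one_sub_two_le : Real.exp (Real.exp 1 - 2) ≤ 2.1 := by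
  have h1 := Real.exp_one_lt_d9
  calc Real.exp (Real.exp 1 - 2) ≤ Real.exp 0.72 := Real.exp_le_exp.2 (by linarith)
    _ ≤ _ := Real.exp_bound' (by norm_num) (by norm_num) (n := 5) (by norm_num)
    _ ≤ 2.1 := by norm_num [Finset.sum_range_succ, Nat.factorial]

theorem exp_exp_two_sub_three_le : Real.exp (Real.exp 2 - 3) ≤ 84 := by
  have h1 := Real.exp_one_lt_d9
  have h0 := Real.exp_one_gt_d9
  have h2 : Real.exp 2 ≤ 7.39 := by
    rw [show (2 : ℝ) = 1 + 1 by norm_num, Real.exp_add]; nlinarith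
  have h3 : Real.exp 0.39 ≤ 1.48 :=
    (Real.exp_bound' (by norm_num) (by norm_num) (n := 5) (by norm_num)).trans
      (by norm_num [Finset.sum_range_succ, Nat.factorial])
  have h4 : Real.exp 4 ≤ 54.7 := by
    rw [show (4 : ℝ) = 2 + 2 by norm_num, Real.exp_add]
    nlinarith [Real.exp_pos 2]
  calc Real.exp (Real.exp 2 - 3) ≤ Real.exp (4 + 0.39) := Real.exp_le_exp.2 (by linarith)
    _ = Real.exp 4 * Real.exp 0.39 := Real.exp_add _ _
    _ ≤ 54.7 * 1.48 := mul_le_mul h4 h3 (Real.exp_pos _).le (by norm_num)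
    _ ≤ 84 := by norm_num

theorem exp_sixth_le : Real.exp (1 / 6) ≤ 1.19 :=
  (Real.exp_bound' (by norm_num) (by norm_num) (n := 3) (by norm_num)).trans
    (by norm_num [Finset.sum_range_succ, Nat.factorial])

theorem exp_two_thirds_le : Real.exp (2 / 3) ≤ 1.95 :=
  (Real.exp_bound' (by norm_num) (by norm_num) (n := 5) (by norm_num)).trans
    (by norm_num [Finset.sum_range_succ, Nat.factorial])

section

variable {Ω : Type*} [MeasurableSpace Ω] {P : Measure Ω} [IsProbabilityMeasure P]
  {ι : Type*} [Fintype ι] [DecidableEq ι] {ξ : ι → Ω → ℝ}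

/-- Cauchy–Schwarz in `ℝ≥0∞`, so that infinite norms of Δ or Δ - Δ_i need no separate treatment. -/
theorem ofReal_integral_abs_mul_le {f g : Ω → ℝ} (hf : AEStronglyMeasurable f P)
    (hg : AEStronglyMeasurable g P) :
    ENNReal.ofReal (∫ ω, |f ω| * |g ω| ∂P) ≤ eLpNorm f 2 P * eLpNorm g 2 P := by
  have h1 := eLpNorm_smul_le_mul_eLpNorm (p := 2) (q := 2) (r := 1) hg hf
  refine le_trans ?_ h1
  rw [eLpNorm_one_eq_lintegral_enorm]
  refine (Real.ofReal_le_enorm _).trans ((enorm_integral_le_lintegral_enorm _).trans (le_of_eq ?_))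
  congr 1
  funext ω
  simp [enorm_mul]

theorem eLpNorm_two_eq_ofReal_sqrt {f : Ω → ℝ} (hf : MemLp f 2 P) :
    eLpNorm f 2 P = ENNReal.ofReal (√(∫ ω, f ω ^ 2 ∂P)) := by
  rw [hf.eLpNorm_eq_integral_rpow_norm (by norm_num) (by norm_num), Real.sqrt_eq_rpow]
  simp

theorem Summands.integral_exp_half (h : Summands P ξ) :
    ∫ ω, Real.exp (2 * (1 / 2) * ∑ i, min (ξ i ω) 1) ∂P ≤ 2.1 := by
  have := h.integral_exp_sum_min_one_le zero_le_one
  norm_num at this ⊢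
  refine this.trans (le_trans (Real.exp_le_exp.2 ?_) (exp_exp_one_sub_two_le.trans (by norm_num)))
  linarith

/-- Cauchy–Schwarz with the weight attached to the sum; `integral_sq_mul_exp_min_le` gives 2.1 ·
5.68 ≤ 3.47². -/
theorem Summands.ofReal_integral_main_le (h : Summands P ξ) {U Δ : Ω → ℝ} (hUm : Measurable U)
    (hU0 : ∀ ω, 0 ≤ U ω) (hUΔ : ∀ ω, U ω ≤ |Δ ω|) :
    ENNReal.ofReal (∫ ω, |∑ j, ξ j ω| * (Real.exp (1 / 2 * ∑ j, min (ξ j ω) 1) * U ω) ∂P) ≤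
      ENNReal.ofReal 3.47 * eLpNorm Δ 2 P := by
  have hm := h.meas
  set f : Ω → ℝ := fun ω => (∑ j, ξ j ω) * Real.exp (1 / 2 * ∑ j, min (ξ j ω) 1) with hf
  have hfm : Measurable f := by fun_prop
  have hfL : MemLp f 2 P := by
    refine h.memLp_sum.of_le_mul (c := Real.exp (1 / 2 * Fintype.card ι)) hfm.aestronglyMeasurable
      (Filter.Eventually.of_forall fun ω => ?_)
    rw [norm_mul, mul_comm, Real.norm_of_nonneg (Real.exp_pos _).le]
    exact mul_le_mul_of_nonneg_right (exp_mul_sum_le (φ := fun x => min x 1) (by norm_num)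
      (Or.inr fun x => min_le_right _ _) _) (norm_nonneg _)
  have h1 := ofReal_integral_abs_mul_le (P := P) hfm.aestronglyMeasurable hUm.aestronglyMeasurable
  have e : ∀ ω, |f ω| * |U ω| =
      |∑ j, ξ j ω| * (Real.exp (1 / 2 * ∑ j, min (ξ j ω) 1) * U ω) := by
    intro ω
    rw [hf, abs_mul, abs_of_pos (Real.exp_pos _), abs_of_nonneg (hU0 ω)]
    ring
  simp only [e] at h1
  refine h1.trans (mul_le_mul' ?_ ?_)
  · rw [eLpNorm_two_eq_ofReal_sqrt hfL]
    refine ENNReal.ofReal_le_ofReal (Real.sqrt_le_iff.2 ⟨by norm_num, ?_⟩)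
    have e2 : ∫ ω, f ω ^ 2 ∂P = ∫ ω, (∑ i, ξ i ω) ^ 2 * Real.exp (∑ j, min (ξ j ω) 1) ∂P := by
      congr 1
      funext ω
      simp only [hf]
      rw [mul_pow, ← Real.exp_nat_mul]
      congr 2
      push_cast; ring
    rw [e2]
    refine h.integral_sq_mul_exp_min_le.trans ?_
    have a1 := exp_exp_one_sub_two_le
    have a2 := Real.exp_one_lt_d9
    have a3 := Real.exp_one_gt_d9
    calc _ ≤ (2.1 : ℝ) * 5.68 := mul_le_mul a1 (by nlinarith) (by positivity) (by norm_num)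
      _ ≤ _ := by norm_num
  · refine eLpNorm_mono fun ω => ?_
    rw [Real.norm_of_nonneg (hU0 ω)]
    exact hUΔ ω

/-- The weight involves only the other summands, so the second moment of its product with ξ_i
factorizes; 2.1 ≤ 1.45². -/
theorem Summands.ofReal_integral_cross_le (h : Summands P ξ) {U Δ V D : Ω → ℝ} (i : ι)
    (hUm : Measurable U) (hVm : Measurable V) (hUV : ∀ ω, |U ω - V ω| ≤ |Δ ω - D ω|) :
    ENNReal.ofReal (∫ ω, |ξ i ω| * (Real.exp (1 / 2 * (∑ j, min (ξ j ω) 1 - min (ξ i ω) 1)) *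
      |U ω - V ω|) ∂P) ≤
      ENNReal.ofReal 1.45 * (eLpNorm (ξ i) 2 P * eLpNorm (fun ω => Δ ω - D ω) 2 P) := by
  have hm := h.meas
  set f : Ω → ℝ := fun ω => ξ i ω * Real.exp (1 / 2 * (∑ j, min (ξ j ω) 1 - min (ξ i ω) 1)) with hf
  have hfm : Measurable f := by fun_prop
  have hz : ∀ ω, ∑ j, min (ξ j ω) 1 - min (ξ i ω) 1 = ∑ j, min (_root_.zeroAt i ξ j ω) 1 :=
    fun ω => (sum_zeroAt (φ := fun x => min x 1) (by simp) i ω).symm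
  have hfL : MemLp f 2 P := by
    refine (h.memLp i).of_le_mul (c := Real.exp (1 / 2 * Fintype.card ι)) hfm.aestronglyMeasurable
      (Filter.Eventually.of_forall fun ω => ?_)
    simp only [hf]
    rw [norm_mul, mul_comm, Real.norm_of_nonneg (Real.exp_pos _).le, hz]
    exact mul_le_mul_of_nonneg_right (exp_mul_sum_le (φ := fun x => min x 1) (by norm_num)
      (Or.inr fun x => min_le_right _ _) _) (norm_nonneg _)
  have h1 := ofReal_integral_abs_mul_le (P := P) hfm.aestronglyMeasurable
    (hUm.sub hVm).aestronglyMeasurable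
  have e : ∀ ω, |f ω| * |(U - V) ω| = |ξ i ω| *
      (Real.exp (1 / 2 * (∑ j, min (ξ j ω) 1 - min (ξ i ω) 1)) * |U ω - V ω|) := by
    intro ω
    rw [hf, abs_mul, abs_of_pos (Real.exp_pos _), Pi.sub_apply]
    ring
  simp only [e] at h1
  refine h1.trans ?_
  rw [← mul_assoc]
  refine mul_le_mul' ?_ ?_
  · rw [eLpNorm_two_eq_ofReal_sqrt hfL, eLpNorm_two_eq_ofReal_sqrt (h.memLp i),
      ← ENNReal.ofReal_mul (by norm_num)]
    refine ENNReal.ofReal_le_ofReal (Real.sqrt_le_iff.2 ⟨by positivity, ?_⟩)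
    rw [mul_pow, Real.sq_sqrt (integral_nonneg fun _ => sq_nonneg _)]
    have e2 : ∫ ω, f ω ^ 2 ∂P =
        (∫ ω, ξ i ω ^ 2 ∂P) * ∫ ω, Real.exp (∑ j, min (ξ j ω) 1 - min (ξ i ω) 1) ∂P := by
      have h2 := ((h.indep_sub (φ := fun x => min x 1) (by fun_prop) (by simp) i).comp
        (φ := fun x => x ^ 2) (ψ := Real.exp) (by fun_prop)
          (by fun_prop)).integral_fun_mul_eq_mul_integral
          (Measurable.aestronglyMeasurable (by fun_prop))
          (Measurable.aestronglyMeasurable (by fun_prop))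
      simp only [Function.comp] at h2
      rw [← h2]
      congr 1
      funext ω
      simp only [hf]
      rw [mul_pow, ← Real.exp_nat_mul]
      congr 2
      push_cast; ring
    have e3 : ∫ ω, Real.exp (∑ j, min (ξ j ω) 1 - min (ξ i ω) 1) ∂P ≤ 2.1 := by
      simp only [hz]
      have := (h.zeroAt i).integral_exp_half
      norm_num at this ⊢
      exact this
    rw [e2, mul_comm]
    exact mul_le_mul_of_nonneg_right (e3.trans (by norm_num)) (integral_nonneg fun _ => sq_nonneg _)
  · exact eLpNorm_mono fun ω => hUV ω

/-- The randomized concentration inequality with exponentially decaying bound, for the sum of the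
summands truncated at `1`. -/
theorem Summands.measure_truncated_le (h : Summands P ξ) {Δ : Ω → ℝ} (hΔ : Measurable Δ)
    {D : ι → Ω → ℝ} (hD : ∀ i, Measurable (D i))
    (hind : ∀ i, IndepFun (ξ i) (fun ω => (D i ω, ∑ j, min (ξ j ω) 1 - min (ξ i ω) 1)) P)
    {z δ c : ℝ} (hz : 0 ≤ z) (hδ : 0 ≤ δ) (hδ1 : δ ≤ 1) (hc0 : 0 ≤ c) (hc1 : c ≤ 1)
    (hκ : 1 / 2 ≤ ∑ i, ∫ ω, |ξ i ω| * min δ |ξ i ω| ∂P)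
    {A : Set Ω} (hA : MeasurableSet A) (hAΔ : ∀ ω ∈ A, |Δ ω| ≤ (z + 1) / 3)
    (hAz : ∀ ω ∈ A, z - c * |Δ ω| ≤ ∑ j, min (ξ j ω) 1 ∧
      ∑ j, min (ξ j ω) 1 ≤ z + (1 - c) * |Δ ω|) :
    P A ≤ ENNReal.ofReal (Real.exp (-z / 3)) * (ENNReal.ofReal (10.4 * δ) +
      ENNReal.ofReal 8.5 * eLpNorm Δ 2 P +
      ENNReal.ofReal 3.6 * ∑ i, eLpNorm (ξ i) 2 P * eLpNorm (fun ω => Δ ω - D i ω) 2 P) := by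
  have hL : 0 ≤ (z + 1) / 3 := by linarith
  set L := (z + 1) / 3 with hLdef
  -- Cutting |Δ| and |D_i| at `L` makes the ramps bounded, changes nothing on `A`, and does not
  -- increase the distance between them.
  have hUA : ∀ ω ∈ A, min |Δ ω| L = |Δ ω| := fun ω hω => min_eq_left (hAΔ ω hω)
  -- On `A` the truncated sum is at least z - L = (2z-1)/3, so the weight with θ = 1/2 is at least
  -- e^{z/3 - 1/6} ≥ e^{z/3}/1.19.
  have h1 := h.concentration (φ := fun x => min x 1) (by fun_prop) (by simp) mul_min_one_nonneg
    (θ := 1 / 2) (δ := δ) (c := c) (z := z) (K := L) (κ := 1 / 2) (M := 2.1)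
    (E := Real.exp (z / 3) / 1.19) (by norm_num) hδ hc0 hc1 (Or.inr fun x => min_le_right _ _)
    h.integral_exp_half (by norm_num) (by simpa only [min_abs_min_one hδ1] using hκ)
    (U := fun ω => min |Δ ω| L) (by fun_prop) (fun ω => le_min (abs_nonneg _) hL)
    (fun ω => min_le_right _ _) (V := fun i ω => min |D i ω| L)
    (fun i => by have := hD i; fun_prop) (fun i ω => le_min (abs_nonneg _) hL)
    (fun i ω => min_le_right _ _)
    (fun i => (hind i).comp (φ := id) (ψ := fun p : ℝ × ℝ => (min |p.1| L, p.2)) measurable_id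
      (by fun_prop)) hA
    (fun ω hω => by simp only [hUA ω hω]; exact hAz ω hω)
    (fun ω hω => by
      have a1 := (hAz ω hω).1
      have a2 := hAΔ ω hω
      have a3 : c * |Δ ω| ≤ L := (mul_le_of_le_one_left (abs_nonneg _) hc1).trans a2
      rw [div_le_iff₀ (by norm_num)]
      calc Real.exp (z / 3) ≤ Real.exp (1 / 2 * ∑ j, min (ξ j ω) 1 + 1 / 6) :=
            Real.exp_le_exp.2 (by linarith)
        _ = Real.exp (1 / 2 * ∑ j, min (ξ j ω) 1) * Real.exp (1 / 6) := Real.exp_add _ _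
        _ ≤ _ := mul_le_mul_of_nonneg_left exp_sixth_le (Real.exp_pos _).le)
  have t1 := h.ofReal_integral_main_le (U := fun ω => min |Δ ω| L) (Δ := Δ) (by fun_prop)
    (fun ω => le_min (abs_nonneg _) hL) (fun ω => min_le_left _ _)
  have t2 := fun i => h.ofReal_integral_cross_le (U := fun ω => min |Δ ω| L) (Δ := Δ)
    (V := fun ω => min |D i ω| L) (D := D i) i (by fun_prop) (by have := hD i; fun_prop)
    (fun ω => by
      refine (abs_min_sub_min_le_max _ _ _ _).trans (max_le ?_ (by simp))
      exact abs_abs_sub_abs_le _ _)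
  set I1 := ∫ ω, |∑ j, ξ j ω| * (Real.exp (1 / 2 * ∑ j, min (ξ j ω) 1) * min |Δ ω| L) ∂P with hI1
  set I2 : ι → ℝ := fun i => ∫ ω, |ξ i ω| * (Real.exp (1 / 2 *
    (∑ j, min (ξ j ω) 1 - min (ξ i ω) 1)) * |min |Δ ω| L - min |D i ω| L|) ∂P with hI2
  have hI1n : 0 ≤ I1 := integral_nonneg fun ω => by
    have : 0 ≤ min |Δ ω| L := le_min (abs_nonneg _) hL
    positivity
  have hI2n : ∀ i, 0 ≤ I2 i := fun i => integral_nonneg fun ω => by positivity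
  have hs : √(2.1 : ℝ) ≤ 1.45 := Real.sqrt_le_iff.2 ⟨by norm_num, by norm_num⟩
  -- The factor 2.38 is 2 · 1.19, from κ = 1/2 and the lower bound for the weight. It leads to 2.38
  -- · 3 · 1.45 ≤ 10.4, 2.38 · 3.47 ≤ 8.5 and 2.38 · 1.45 ≤ 3.6.
  have h2 : P.real A ≤ Real.exp (-z / 3) * (10.4 * δ + 2.38 * I1 + 2.38 * ∑ i, I2 i) := by
    have e1 : Real.exp (-z / 3) * Real.exp (z / 3) = 1 := by
      rw [← Real.exp_add]; ring_nf; exact Real.exp_zero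
    have h3 : Real.exp (z / 3) * P.real A ≤ 10.4 * δ + 2.38 * I1 + 2.38 * ∑ i, I2 i := by
      have : 3 * δ * √2.1 ≤ 3 * δ * 1.45 := mul_le_mul_of_nonneg_left hs (by positivity)
      have h1' : 1 / 2 * (Real.exp (z / 3) / 1.19 * P.real A) ≤ I1 + 3 * δ * √2.1 + ∑ i, I2 i := h1
      have e2 : Real.exp (z / 3) * P.real A =
        2.38 * (1 / 2 * (Real.exp (z / 3) / 1.19 * P.real A)) := by ring
      rw [e2]
      linarith
    calc P.real A = Real.exp (-z / 3) * (Real.exp (z / 3) * P.real A) := by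
          rw [← mul_assoc, e1, one_mul]
      _ ≤ _ := mul_le_mul_of_nonneg_left h3 (Real.exp_pos _).le
  rw [← ofReal_measureReal]
  refine (ENNReal.ofReal_le_ofReal h2).trans ?_
  rw [ENNReal.ofReal_mul (Real.exp_pos _).le]
  refine mul_le_mul' le_rfl ?_
  rw [ENNReal.ofReal_add (by positivity)
      (mul_nonneg (by norm_num) (Finset.sum_nonneg fun i _ => hI2n i)),
    ENNReal.ofReal_add (by positivity) (by positivity), ENNReal.ofReal_mul (by norm_num : (0:ℝ) ≤ 2.38),
    ENNReal.ofReal_mul (by norm_num : (0:ℝ) ≤ 2.38), ENNReal.ofReal_sum_of_nonneg fun i _ => hI2n i]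
  refine add_le_add (add_le_add le_rfl ?_) ?_
  · calc ENNReal.ofReal 2.38 * ENNReal.ofReal I1
        ≤ ENNReal.ofReal 2.38 * (ENNReal.ofReal 3.47 * eLpNorm Δ 2 P) := mul_le_mul' le_rfl t1
      _ = ENNReal.ofReal (2.38 * 3.47) * eLpNorm Δ 2 P := by
        rw [← mul_assoc, ← ENNReal.ofReal_mul (by norm_num)]
      _ ≤ _ := mul_le_mul' (ENNReal.ofReal_le_ofReal (by norm_num)) le_rfl
  · calc ENNReal.ofReal 2.38 * ∑ i, ENNReal.ofReal (I2 i)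
        ≤ ENNReal.ofReal 2.38 * ∑ i, ENNReal.ofReal 1.45 *
          (eLpNorm (ξ i) 2 P * eLpNorm (fun ω => Δ ω - D i ω) 2 P) :=
          mul_le_mul' le_rfl (Finset.sum_le_sum fun i _ => t2 i)
      _ = ENNReal.ofReal (2.38 * 1.45) *
          ∑ i, eLpNorm (ξ i) 2 P * eLpNorm (fun ω => Δ ω - D i ω) 2 P := by
        rw [← Finset.mul_sum, ← mul_assoc, ← ENNReal.ofReal_mul (by norm_num)]
      _ ≤ _ := mul_le_mul' (ENNReal.ofReal_le_ofReal (by norm_num)) le_rfl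

end

/-! ### Atoms of leave-one-out sums and the boundary event -/

section

variable {Ω : Type*} [MeasurableSpace Ω] {P : Measure Ω} [IsProbabilityMeasure P]
  {ι : Type*} [Fintype ι] [DecidableEq ι] {ξ : ι → Ω → ℝ}

theorem Summands.integrable_abs_mul_min (h : Summands P ξ) {δ : ℝ} (hδ : 0 ≤ δ) (i : ι) :
    Integrable (fun ω => |ξ i ω| * min δ |ξ i ω|) P := by
  have := h.meas i
  refine (h.integrable i).abs.mul_bdd (c := δ)
    (Measurable.aestronglyMeasurable (by fun_prop)) (Filter.Eventually.of_forall fun ω => ?_)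
  rw [Real.norm_of_nonneg (le_min hδ (abs_nonneg _))]
  exact min_le_left _ _

theorem Summands.integral_sq_le_one (h : Summands P ξ) (i : ι) : ∫ ω, ξ i ω ^ 2 ∂P ≤ 1 :=
  (Finset.single_le_sum (f := fun i => ∫ ω, ξ i ω ^ 2 ∂P)
    (fun _ _ => integral_nonneg fun _ => sq_nonneg _) (Finset.mem_univ i)).trans h.var

theorem Summands.integral_abs_le_one (h : Summands P ξ) (i : ι) : ∫ ω, |ξ i ω| ∂P ≤ 1 := by
  have h1 : ∫ ω, |ξ i ω| ∂P ≤ ∫ ω, (1 / 2 + 1 / 2 * ξ i ω ^ 2) ∂P := by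
    refine integral_mono (h.integrable i).abs
      ((integrable_const _).add ((h.memLp i).integrable_sq.const_mul _)) fun ω => ?_
    simp only
    rw [← sq_abs]
    nlinarith [sq_nonneg (|ξ i ω| - 1)]
  rw [integral_add (integrable_const _) ((h.memLp i).integrable_sq.const_mul _),
    integral_const_mul] at h1
  simp only [integral_const, probReal_univ, smul_eq_mul, one_mul] at h1
  linarith [h.integral_sq_le_one i]

/-- Removing one summand costs at most δ E|ξ_i| ≤ δ. -/
theorem Summands.sub_le_sum_zeroAt (h : Summands P ξ) {δ κ : ℝ} (hδ : 0 ≤ δ)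
    (hκ : κ ≤ ∑ i, ∫ ω, |ξ i ω| * min δ |ξ i ω| ∂P) (i : ι) :
    κ - δ ≤ ∑ j, ∫ ω, |_root_.zeroAt i ξ j ω| * min δ |_root_.zeroAt i ξ j ω| ∂P := by
  have h1 : ∫ ω, |ξ i ω| * min δ |ξ i ω| ∂P ≤ δ := by
    calc _ ≤ ∫ ω, |ξ i ω| * δ ∂P := by
          refine integral_mono (h.integrable_abs_mul_min hδ i)
            ((h.integrable i).abs.mul_const _) fun ω => ?_
          exact mul_le_mul_of_nonneg_left (min_le_left _ _) (abs_nonneg _)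
      _ ≤ δ := by
          rw [integral_mul_const]
          exact mul_le_of_le_one_left hδ (h.integral_abs_le_one i)
  rw [← Finset.add_sum_erase _ _ (Finset.mem_univ i)] at hκ ⊢
  have e : ∑ j ∈ Finset.univ.erase i,
      ∫ ω, |_root_.zeroAt i ξ j ω| * min δ |_root_.zeroAt i ξ j ω| ∂P =
      ∑ j ∈ Finset.univ.erase i, ∫ ω, |ξ j ω| * min δ |ξ j ω| ∂P := by
    refine Finset.sum_congr rfl fun j hj => ?_
    simp [_root_.zeroAt, Finset.ne_of_mem_erase hj]
  rw [e]
  have e2 : ∫ ω, |_root_.zeroAt i ξ i ω| * min δ |_root_.zeroAt i ξ i ω| ∂P = 0 := by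
    simp [_root_.zeroAt]
  rw [e2]
  linarith

/-- The concentration inequality for the leave-one-out family and a degenerate interval, U = V = 0:
only the term 3δ√M survives. -/
theorem Summands.atom_le (h : Summands P ξ) {φ : ℝ → ℝ} (hφm : Measurable φ)
    (hφ0 : φ 0 = 0) (hφs : ∀ x, 0 ≤ x * φ x) {θ δ x M κ : ℝ} (hθ : 0 ≤ θ) (hδ : 0 ≤ δ)
    (hφδ : ∀ x, min δ |φ x| = min δ |x|) (hbdd : θ = 0 ∨ ∀ x, φ x ≤ 1)
    (hM : ∀ ζ : ι → Ω → ℝ, Summands P ζ → ∫ ω, Real.exp (2 * θ * ∑ j, φ (ζ j ω)) ∂P ≤ M)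
    (hδκ : δ ≤ κ) (hκ : κ ≤ ∑ i, ∫ ω, |ξ i ω| * min δ |ξ i ω| ∂P) (i : ι) :
    (κ - δ) * (Real.exp (θ * x) * P.real {ω | ∑ j, φ (ξ j ω) - φ (ξ i ω) = x}) ≤
      3 * δ * √M := by
  have hm := h.meas
  have h1 := (h.zeroAt i).concentration hφm hφ0 hφs (θ := θ) (δ := δ) (c := 0) (z := x)
    (K := 0) (κ := κ - δ) (M := M) (E := Real.exp (θ * x)) hθ hδ le_rfl zero_le_one hbdd
    (hM _ (h.zeroAt i)) (by linarith)
    (by simp only [hφδ]; exact h.sub_le_sum_zeroAt hδ hκ i)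
    (U := fun _ => 0) measurable_const (fun _ => le_rfl) (fun _ => le_rfl)
    (V := fun _ _ => 0) (fun _ => measurable_const) (fun _ _ => le_rfl) (fun _ _ => le_rfl)
    (fun j => ((h.zeroAt i).indep_sub hφm hφ0 j).comp (φ := id)
      (ψ := fun r : ℝ => ((0 : ℝ), r)) measurable_id (by fun_prop))
    (A := {ω | ∑ j, φ (ξ j ω) - φ (ξ i ω) = x})
    (measurableSet_eq_fun (by fun_prop) measurable_const)
    (fun ω hω => by
      have : ∑ j, φ (_root_.zeroAt i ξ j ω) = x := by rw [sum_zeroAt hφ0]; exact hω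
      simp [this])
    (fun ω hω => by
      have : ∑ j, φ (_root_.zeroAt i ξ j ω) = x := by rw [sum_zeroAt hφ0]; exact hω
      simp [this])
  simpa using h1

theorem Summands.sum_measure_eq_mul_sq_le (h : Summands P ξ) {L : ℝ} :
    (∑ i, P.real {ω | ξ i ω = L}) * L ^ 2 ≤ 1 := by
  refine le_trans ?_ h.var
  rw [Finset.sum_mul]
  refine Finset.sum_le_sum fun i _ => ?_
  have hs : MeasurableSet {ω | ξ i ω = L} := measurableSet_eq_fun (h.meas i) measurable_const
  rw [← smul_eq_mul, ← integral_indicator_const _ hs]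
  refine integral_mono ((integrable_const _).indicator hs) (h.memLp i).integrable_sq fun ω => ?_
  by_cases hω : ω ∈ {ω | ξ i ω = L}
  · rw [Set.indicator_of_mem hω]
    have : ξ i ω = L := hω
    simp [this]
  · rw [Set.indicator_of_notMem hω]
    positivity

/-- The function x² - |x| min(δ, |x|) is nonnegative and equals L² - Lδ at L ≥ δ; the total of its
expectations is at most 1 - 1/2. -/
theorem Summands.sum_measure_eq_mul_le (h : Summands P ξ) {δ L : ℝ} (hδ : 0 ≤ δ) (hδL : δ ≤ L)
    (hκ : 1 / 2 ≤ ∑ i, ∫ ω, |ξ i ω| * min δ |ξ i ω| ∂P) :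
    (∑ i, P.real {ω | ξ i ω = L}) * (L ^ 2 - L * δ) ≤ 1 / 2 := by
  have h1 : (∑ i, P.real {ω | ξ i ω = L}) * (L ^ 2 - L * δ) ≤
      ∑ i, (∫ ω, ξ i ω ^ 2 ∂P - ∫ ω, |ξ i ω| * min δ |ξ i ω| ∂P) := by
    rw [Finset.sum_mul]
    refine Finset.sum_le_sum fun i _ => ?_
    have hs : MeasurableSet {ω | ξ i ω = L} := measurableSet_eq_fun (h.meas i) measurable_const
    rw [← smul_eq_mul, ← integral_indicator_const _ hs,
      ← integral_sub (h.memLp i).integrable_sq (h.integrable_abs_mul_min hδ i)]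
    refine integral_mono ((integrable_const _).indicator hs)
      ((h.memLp i).integrable_sq.sub (h.integrable_abs_mul_min hδ i)) fun ω => ?_
    by_cases hω : ω ∈ {ω | ξ i ω = L}
    · rw [Set.indicator_of_mem hω]
      have : ξ i ω = L := hω
      simp [this, abs_of_nonneg (hδ.trans hδL), min_eq_left hδL]
    · rw [Set.indicator_of_notMem hω]
      simp only
      rw [← sq_abs, pow_two, ← mul_sub]
      exact mul_nonneg (abs_nonneg _) (sub_nonneg.2 (min_le_right _ _))
  rw [Finset.sum_sub_distrib] at h1
  linarith [h.var]

theorem Summands.measure_le_of_subset (h : Summands P ξ) {φ : ℝ → ℝ} (hφm : Measurable φ)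
    (hφ0 : φ 0 = 0) {L x q : ℝ} (hq : ∀ i, P.real {ω | ∑ j, φ (ξ j ω) - φ (ξ i ω) = x} ≤ q)
    {B : Set Ω} (hB : ∀ ω ∈ B, ∃ i, ξ i ω = L ∧ ∑ j, φ (ξ j ω) - φ (ξ i ω) = x) :
    P.real B ≤ (∑ i, P.real {ω | ξ i ω = L}) * q := by
  calc P.real B
      ≤ P.real (⋃ i, {ω | ξ i ω = L} ∩ {ω | ∑ j, φ (ξ j ω) - φ (ξ i ω) = x}) :=
        measureReal_mono (fun ω hω => by
          obtain ⟨i, hi⟩ := hB ω hω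
          exact Set.mem_iUnion.2 ⟨i, hi⟩)
    _ ≤ ∑ i, P.real ({ω | ξ i ω = L} ∩ {ω | ∑ j, φ (ξ j ω) - φ (ξ i ω) = x}) :=
        measureReal_iUnion_fintype_le _
    _ = ∑ i, P.real {ω | ξ i ω = L} * P.real {ω | ∑ j, φ (ξ j ω) - φ (ξ i ω) = x} := by
        refine Finset.sum_congr rfl fun i _ => ?_
        have := (h.indep_sub hφm hφ0 i).measure_inter_preimage_eq_mul {L} {x}
          (measurableSet_singleton _) (measurableSet_singleton _)
        simp only [Measure.real, ← ENNReal.toReal_mul]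
        exact congrArg ENNReal.toReal this
    _ ≤ _ := by
        rw [Finset.sum_mul]
        exact Finset.sum_le_sum fun i _ => mul_le_mul_of_nonneg_left (hq i) measureReal_nonneg

/-- `gammaTerm` counts only strict exceedances, so the event that both values are attained exactly
must be charged to δ. For L ≤ 3 the unweighted, untruncated atom bound is enough, because e^{z/3} is
comparable with L² and the mass of the summands at `L` is of order L^{-2}. -/
theorem Summands.boundary_le_of_le_three (h : Summands P ξ) {δ z : ℝ} (hδ : 0 ≤ δ)
    (hκ : 1 / 2 ≤ ∑ i, ∫ ω, |ξ i ω| * min δ |ξ i ω| ∂P) (hL1 : 1 ≤ (z + 1) / 3)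
    (hL3 : (z + 1) / 3 ≤ 3) {B : Set Ω}
    (hB : ∀ ω ∈ B, ∃ i, ξ i ω = (z + 1) / 3 ∧ ∑ j, ξ j ω - ξ i ω = (z - 2) / 3) :
    P.real B ≤ Real.exp (-z / 3) * (11.6 * δ) := by
  set L := (z + 1) / 3 with hLdef
  set p := ∑ i, P.real {ω | ξ i ω = L} with hp
  have hp0 : 0 ≤ p := Finset.sum_nonneg fun i _ => measureReal_nonneg
  have hexp : Real.exp (z / 3) ≤ 1.95 * L ^ 2 := by
    have e1 : Real.exp (z / 3) = Real.exp (2 / 3) * Real.exp ((L - 1) / 2) ^ 2 := by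
      rw [← Real.exp_nat_mul, ← Real.exp_add]
      congr 1
      rw [hLdef]; push_cast; ring
    have hs1 : (L - 1) / 2 ≤ 1 := by linarith
    have e2 : Real.exp ((L - 1) / 2) ≤ L := by
      have hc := (le_abs_self _).trans (abs_exp_sub_one_le hs1)
      rw [abs_of_nonneg (by linarith)] at hc
      have := Real.exp_one_lt_d9
      nlinarith
    rw [e1]
    exact mul_le_mul exp_two_thirds_le (pow_le_pow_left₀ (Real.exp_pos _).le e2 2)
      (by positivity) (by norm_num)
  have key : Real.exp (z / 3) * P.real B ≤ 11.6 * δ := by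
    -- Below the threshold, 1/2 - δ ≥ 0.33 and L² - Lδ ≥ 0.83 L². Above it, the trivial bound 1.95
    -- is less than 11.6 · 0.17.
    rcases le_total δ 0.17 with hδ1 | hδ1
    · have hq : ∀ i, P.real {ω | ∑ j, ξ j ω - ξ i ω = (z - 2) / 3} ≤ 3 * δ / 0.33 := by
        intro i
        have := h.atom_le (φ := fun x => x) measurable_id rfl (fun x => mul_self_nonneg x)
          (θ := 0) (x := (z - 2) / 3) (M := 1) (κ := 1 / 2) le_rfl hδ (fun _ => rfl) (Or.inl rfl)
          (fun ζ _ => by simp) (by linarith) hκ i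
        simp only [zero_mul, Real.exp_zero, one_mul, Real.sqrt_one, mul_one] at this
        rw [le_div_iff₀ (by norm_num), mul_comm]
        exact (mul_le_mul_of_nonneg_right (by linarith) measureReal_nonneg).trans this
      have h1 := h.measure_le_of_subset (φ := fun x => x) measurable_id rfl (L := L) hq hB
      have h2 := h.sum_measure_eq_mul_le hδ (hδ1.trans (by linarith)) (L := L) hκ
      rw [← hp] at h1 h2
      have h3 : p * L ^ 2 * 0.83 ≤ 1 / 2 := by
        refine le_trans ?_ h2
        rw [mul_assoc]
        refine mul_le_mul_of_nonneg_left ?_ hp0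
        nlinarith
      calc Real.exp (z / 3) * P.real B ≤ (1.95 * L ^ 2) * (p * (3 * δ / 0.33)) :=
            mul_le_mul hexp h1 measureReal_nonneg (by positivity)
        _ = 1.95 * (3 * δ / 0.33) / 0.83 * (p * L ^ 2 * 0.83) := by ring
        _ ≤ 1.95 * (3 * δ / 0.33) / 0.83 * (1 / 2) :=
            mul_le_mul_of_nonneg_left h3 (by positivity)
        _ = 1.95 * 3 / 0.33 / 0.83 / 2 * δ := by ring
        _ ≤ 11.6 * δ := mul_le_mul_of_nonneg_right (by norm_num) hδ
    · have h1 := h.measure_le_of_subset (φ := fun x => x) measurable_id rfl (L := L) (q := 1)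
        (fun i => measureReal_le_one) hB
      have h2 := h.sum_measure_eq_mul_sq_le (L := L)
      rw [← hp] at h1 h2
      calc Real.exp (z / 3) * P.real B ≤ (1.95 * L ^ 2) * (p * 1) :=
            mul_le_mul hexp h1 measureReal_nonneg (by positivity)
        _ = 1.95 * (p * L ^ 2) := by ring
        _ ≤ 11.6 * δ := by linarith
  have e1 : Real.exp (-z / 3) * Real.exp (z / 3) = 1 := by
    rw [← Real.exp_add]; ring_nf; exact Real.exp_zero
  calc P.real B = Real.exp (-z / 3) * (Real.exp (z / 3) * P.real B) := by
        rw [← mul_assoc, e1, one_mul]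
    _ ≤ _ := mul_le_mul_of_nonneg_left key (Real.exp_pos _).le

/-- For large L a weight is needed: atoms of the truncated leave-one-out sum, taken with θ = 1,
carry the factor e^{-x}, and e^{z/3} = e^{2/3} e^x. -/
theorem Summands.boundary_le_of_three_le (h : Summands P ξ) {δ z : ℝ} (hδ : 0 ≤ δ)
    (hκ : 1 / 2 ≤ ∑ i, ∫ ω, |ξ i ω| * min δ |ξ i ω| ∂P) (hL3 : 3 ≤ (z + 1) / 3) {B : Set Ω}
    (hB : ∀ ω ∈ B, ∃ i, ξ i ω = (z + 1) / 3 ∧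
      ∑ j, min (ξ j ω) 1 - min (ξ i ω) 1 = (z - 2) / 3) :
    P.real B ≤ Real.exp (-z / 3) * (11.6 * δ) := by
  set L := (z + 1) / 3 with hLdef
  set x := (z - 2) / 3 with hx
  have hxL : x = L - 1 := by rw [hx, hLdef]; ring
  set p := ∑ i, P.real {ω | ξ i ω = L} with hp
  have hp0 : 0 ≤ p := Finset.sum_nonneg fun i _ => measureReal_nonneg
  have hexp : Real.exp (z / 3) ≤ 1.95 * Real.exp x := by
    have e1 : Real.exp (z / 3) = Real.exp (2 / 3) * Real.exp x := by
      rw [← Real.exp_add]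
      congr 1
      rw [hx]; ring
    rw [e1]
    exact mul_le_mul_of_nonneg_right exp_two_thirds_le (Real.exp_pos _).le
  have fin : ∀ q, 0 ≤ q → (∀ i, Real.exp x *
      P.real {ω | ∑ j, min (ξ j ω) 1 - min (ξ i ω) 1 = x} ≤ q) →
      Real.exp (z / 3) * P.real B ≤ 1.95 * (p * q) := by
    intro q hq0 hq
    have h1 := h.measure_le_of_subset (φ := fun x => min x 1) (by fun_prop) (by simp) (L := L)
      (q := q / Real.exp x)
      (fun i => by rw [le_div_iff₀ (Real.exp_pos _), mul_comm]; exact hq i) hB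
    rw [← hp] at h1
    calc Real.exp (z / 3) * P.real B ≤ (1.95 * Real.exp x) * (p * (q / Real.exp x)) :=
          mul_le_mul hexp h1 measureReal_nonneg (by positivity)
      _ = 1.95 * (p * q) := by field_simp
  have key : Real.exp (z / 3) * P.real B ≤ 11.6 * δ := by
    -- Small δ: the atom bound with M = 84, and L² - Lδ ≥ 9 - 3 · 0.17 = 8.49. Large δ: Markov's
    -- inequality with exponential moment 2.1, and total mass at `L` at most 1/9.
    rcases le_total δ 0.17 with hδ1 | hδ1
    · have hs : √(84 : ℝ) ≤ 9.17 := Real.sqrt_le_iff.2 ⟨by norm_num, by norm_num⟩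
      have h1 := fin (3 * δ * 9.17 / 0.33) (by positivity) fun i => by
        have := h.atom_le (φ := fun x => min x 1) (by fun_prop) (by simp) mul_min_one_nonneg
          (θ := 1) (x := x) (M := 84) (κ := 1 / 2) zero_le_one hδ
          (min_abs_min_one (by linarith)) (Or.inr fun x => min_le_right _ _)
          (fun ζ hζ => by
            have := hζ.integral_exp_sum_min_one_le zero_le_two
            norm_num at this ⊢
            refine this.trans (le_trans (Real.exp_le_exp.2 ?_) exp_exp_two_sub_three_le)
            linarith) (by linarith) hκ i
        simp only [one_mul] at this
        rw [le_div_iff₀ (by norm_num), mul_comm]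
        refine (mul_le_mul_of_nonneg_right (by linarith)
          (mul_nonneg (Real.exp_pos _).le measureReal_nonneg)).trans (this.trans ?_)
        exact mul_le_mul_of_nonneg_left hs (by positivity)
      have h2 := h.sum_measure_eq_mul_le hδ (hδ1.trans (by linarith)) (L := L) hκ
      rw [← hp] at h2
      have h3 : p * 8.49 ≤ 1 / 2 := by
        refine le_trans ?_ h2
        refine mul_le_mul_of_nonneg_left ?_ hp0
        nlinarith
      have h4 : p * (3 * δ * 9.17 / 0.33) ≤ 1 / 2 / 8.49 * (3 * δ * 9.17 / 0.33) :=
        mul_le_mul_of_nonneg_right (by linarith) (by positivity)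
      calc Real.exp (z / 3) * P.real B ≤ 1.95 * (1 / 2 / 8.49 * (3 * δ * 9.17 / 0.33)) :=
            h1.trans (mul_le_mul_of_nonneg_left h4 (by norm_num))
        _ = 1.95 / 2 / 8.49 * 3 * 9.17 / 0.33 * δ := by ring
        _ ≤ 11.6 * δ := mul_le_mul_of_nonneg_right (by norm_num) hδ
    · have h1 := fin 2.1 (by norm_num) fun i => by
        have hm := h.meas
        have h2 := (h.zeroAt i).integral_exp_sum_min_one_le zero_le_one
        have hz : ∀ ω, ∑ j, min (_root_.zeroAt i ξ j ω) 1 = ∑ j, min (ξ j ω) 1 - min (ξ i ω) 1 :=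
          sum_zeroAt (φ := fun x => min x 1) (by simp) i
        have hs : MeasurableSet {ω | ∑ j, min (ξ j ω) 1 - min (ξ i ω) 1 = x} :=
          measurableSet_eq_fun (by fun_prop) measurable_const
        rw [mul_comm, ← smul_eq_mul, ← integral_indicator_const _ hs]
        have h3 : ∫ ω, Real.exp (1 * ∑ j, min (_root_.zeroAt i ξ j ω) 1) ∂P ≤ 2.1 :=
          h2.trans ((Real.exp_le_exp.2 (by linarith)).trans exp_exp_one_sub_two_le)
        refine (integral_mono ((integrable_const _).indicator hs)
          ((memLp_exp_mul_sum (h.zeroAt i).meas (φ := fun x => min x 1) (by fun_prop) zero_le_one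
            (Or.inr fun x => min_le_right _ _) 1).integrable le_rfl) fun ω => ?_).trans h3
        by_cases hω : ω ∈ {ω | ∑ j, min (ξ j ω) 1 - min (ξ i ω) 1 = x}
        · rw [Set.indicator_of_mem hω]
          have : ∑ j, min (ξ j ω) 1 - min (ξ i ω) 1 = x := hω
          simp [hz, this]
        · rw [Set.indicator_of_notMem hω]
          exact (Real.exp_pos _).le
      have h2 := h.sum_measure_eq_mul_sq_le (L := L)
      rw [← hp] at h2
      have h3 : p * 9 ≤ 1 := by
        refine le_trans (mul_le_mul_of_nonneg_left ?_ hp0) h2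
        nlinarith
      linarith
  have e1 : Real.exp (-z / 3) * Real.exp (z / 3) = 1 := by
    rw [← Real.exp_add]; ring_nf; exact Real.exp_zero
  calc P.real B = Real.exp (-z / 3) * (Real.exp (z / 3) * P.real B) := by
        rw [← mul_assoc, e1, one_mul]
    _ ≤ _ := mul_le_mul_of_nonneg_left key (Real.exp_pos _).le

end

/-! ### Two summands at the same level -/

section

variable {Ω : Type*} [MeasurableSpace Ω] {P : Measure Ω} [IsProbabilityMeasure P]
  {ι : Type*} [Fintype ι] [DecidableEq ι] {ξ : ι → Ω → ℝ}

/-- A quadratic test function with nonnegative mean, used to compare how often the sum of the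
summands different from `L` falls above and below `-1`. -/
noncomputable def levelTest (L : ℝ) (v : ι → ℝ) : ℝ :=
  1 - (∑ l, (if v l = L then 0 else v l) - 1) ^ 2 / 2 - (∑ l, if v l = L then 1 else 0) / 3

theorem measurable_levelTest (L : ℝ) : Measurable (levelTest (ι := ι) L) := by
  have h1 : ∀ l : ι, Measurable (fun v : ι → ℝ => if v l = L then (0 : ℝ) else v l) := fun l =>
    Measurable.ite (measurableSet_eq_fun (measurable_pi_apply l) measurable_const)
      measurable_const (measurable_pi_apply l)
  have h2 : ∀ l : ι, Measurable (fun v : ι → ℝ => if v l = L then (1 : ℝ) else 0) := fun l =>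
    Measurable.ite (measurableSet_eq_fun (measurable_pi_apply l) measurable_const)
      measurable_const measurable_const
  unfold levelTest
  fun_prop

theorem Summands.memLp_level (h : Summands P ξ) (L : ℝ) (i : ι) :
    MemLp (fun ω => if ξ i ω = L then 0 else ξ i ω) 2 P := by
  refine (h.memLp i).mono (Measurable.aestronglyMeasurable (Measurable.ite
    (measurableSet_eq_fun (h.meas i) measurable_const) measurable_const (h.meas i)))
    (Filter.Eventually.of_forall fun ω => ?_)
  split_ifs <;> simp

theorem Summands.integrable_indicator_eq (h : Summands P ξ) (L : ℝ) (i : ι) :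
    Integrable (fun ω => if ξ i ω = L then (1 : ℝ) else 0) P := by
  refine Integrable.of_bound (C := 1) (Measurable.aestronglyMeasurable (Measurable.ite
    (measurableSet_eq_fun (h.meas i) measurable_const) measurable_const measurable_const))
    (Filter.Eventually.of_forall fun ω => ?_)
  split_ifs <;> simp

theorem Summands.integral_indicator_eq (h : Summands P ξ) (L : ℝ) (i : ι) :
    ∫ ω, (if ξ i ω = L then (1 : ℝ) else 0) ∂P = P.real {ω | ξ i ω = L} := by
  have hs : MeasurableSet {ω | ξ i ω = L} := measurableSet_eq_fun (h.meas i) measurable_const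
  rw [← mul_one (P.real _), ← smul_eq_mul, ← integral_indicator_const _ hs]
  congr 1

theorem Summands.integrable_levelTest (h : Summands P ξ) (L : ℝ) :
    Integrable (fun ω => levelTest L (fun l => ξ l ω)) P := by
  have hS : MemLp (fun ω => ∑ l, (if ξ l ω = L then 0 else ξ l ω) - 1) 2 P :=
    (memLp_finsetSum _ fun l _ => h.memLp_level L l).sub (memLp_const 1)
  exact ((integrable_const _).sub (hS.integrable_sq.div_const 2)).sub
    ((integrable_finsetSum _ fun l _ => h.integrable_indicator_eq L l).div_const 3)

/-- Let q be the total mass of the summands at `L`. The sum of the others has mean -Lq and variance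
at most 1 - L²q. Since L²q ≤ 1, the expectation is at least (q/2)(L² - 2L - 5/3), which is
nonnegative for L ≥ 3. -/
theorem Summands.integral_levelTest_nonneg (h : Summands P ξ) {L : ℝ} (hL : 3 ≤ L) :
    0 ≤ ∫ ω, levelTest L (fun l => ξ l ω) ∂P := by
  set p : ι → ℝ := fun i => P.real {ω | ξ i ω = L} with hp
  set Y : ι → Ω → ℝ := fun i ω => if ξ i ω = L then 0 else ξ i ω with hY
  have hYL : ∀ i, MemLp (Y i) 2 P := h.memLp_level L
  have hS2 : MemLp (fun ω => ∑ l, Y l ω) 2 P := memLp_finsetSum _ fun l _ => hYL l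
  have hS : MemLp (fun ω => ∑ l, Y l ω - 1) 2 P := hS2.sub (memLp_const 1)
  have hmean : ∀ i, ∫ ω, Y i ω ∂P = -(L * p i) := by
    intro i
    have e : Y i = fun ω => ξ i ω - L * (if ξ i ω = L then (1 : ℝ) else 0) := by
      funext ω
      simp only [hY]
      split_ifs with hh <;> simp [hh]
    rw [e, integral_sub (h.integrable i) ((h.integrable_indicator_eq L i).const_mul L),
      integral_const_mul, h.integral_indicator_eq, h.mean i]
    simp [hp]
  have hsq : ∀ i, ∫ ω, Y i ω ^ 2 ∂P = ∫ ω, ξ i ω ^ 2 ∂P - L ^ 2 * p i := by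
    intro i
    have e : (fun ω => Y i ω ^ 2) =
        fun ω => ξ i ω ^ 2 - L ^ 2 * (if ξ i ω = L then (1 : ℝ) else 0) := by
      funext ω
      simp only [hY]
      split_ifs with hh <;> simp [hh]
    rw [e, integral_sub (h.memLp i).integrable_sq
      ((h.integrable_indicator_eq L i).const_mul _), integral_const_mul, h.integral_indicator_eq]
  have hmS : ∫ ω, ∑ l, Y l ω ∂P = -(L * ∑ l, p l) := by
    rw [integral_finsetSum _ fun l _ => (hYL l).integrable one_le_two,
      Finset.sum_congr rfl fun l _ => hmean l, Finset.sum_neg_distrib, Finset.mul_sum]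
  have hvar : Var[fun ω => ∑ l, Y l ω; P] ≤ 1 - L ^ 2 * ∑ l, p l := by
    have hv := IndepFun.variance_sum (μ := P) (X := Y) (s := Finset.univ) (fun i _ => hYL i)
      (fun i _ j _ hij => (h.indep.indepFun hij).comp
        (φ := fun x => if x = L then 0 else x) (ψ := fun x => if x = L then 0 else x)
        (Measurable.ite (measurableSet_eq_fun measurable_id measurable_const)
          measurable_const measurable_id)
        (Measurable.ite (measurableSet_eq_fun measurable_id measurable_const)
          measurable_const measurable_id))
    have e : (∑ i, Y i) = fun ω => ∑ l, Y l ω := by funext ω; simp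
    rw [e] at hv
    rw [hv]
    calc ∑ i, Var[Y i; P] ≤ ∑ i, (∫ ω, ξ i ω ^ 2 ∂P - L ^ 2 * p i) :=
          Finset.sum_le_sum fun i _ => by
            rw [← hsq i]
            exact variance_le_expectation_sq (hYL i).aestronglyMeasurable
      _ ≤ _ := by
          rw [Finset.sum_sub_distrib, ← Finset.mul_sum]
          linarith [h.var]
  have hvar2 := variance_eq_sub hS2
  simp only [Pi.pow_apply] at hvar2
  rw [hmS] at hvar2
  have hsub : ∫ ω, (∑ l, Y l ω - 1) ^ 2 ∂P =
      ∫ ω, (∑ l, Y l ω) ^ 2 ∂P - 2 * ∫ ω, ∑ l, Y l ω ∂P + 1 := by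
    have e : ∀ ω, (∑ l, Y l ω - 1) ^ 2 = (∑ l, Y l ω) ^ 2 - 2 * ∑ l, Y l ω + 1 := fun ω => by ring
    simp only [e]
    have i1 := hS2.integrable_sq
    have i2 := (hS2.integrable one_le_two).const_mul 2
    have i3 : Integrable (fun ω => (∑ l, Y l ω) ^ 2 - 2 * ∑ l, Y l ω) P := i1.sub i2
    rw [integral_add i3 (integrable_const _), integral_sub i1 i2, integral_const_mul]
    simp
  have hP : (∑ l, p l) * L ^ 2 ≤ 1 := h.sum_measure_eq_mul_sq_le
  have hP0 : 0 ≤ ∑ l, p l := Finset.sum_nonneg fun _ _ => measureReal_nonneg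
  have e : ∫ ω, levelTest L (fun l => ξ l ω) ∂P =
      1 - (∫ ω, (∑ l, Y l ω - 1) ^ 2 ∂P) / 2 - (∑ l, p l) / 3 := by
    unfold levelTest
    have i1 := hS.integrable_sq.div_const 2
    have i2 := (integrable_finsetSum Finset.univ fun l _ => h.integrable_indicator_eq L l).div_const 3
    have i3 : Integrable (fun ω => 1 - (∑ l, Y l ω - 1) ^ 2 / 2) P := (integrable_const _).sub i1
    rw [integral_sub i3 i2, integral_sub (integrable_const _) i1, integral_div, integral_div,
      integral_finsetSum _ fun l _ => h.integrable_indicator_eq L l]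
    simp [h.integral_indicator_eq, hp]
  rw [e, hsub, hmS]
  set q := ∑ l, p l
  have : q * (L ^ 2 * q) ≤ q * 1 := mul_le_mul_of_nonneg_left (by linarith) hP0
  nlinarith [mul_nonneg hP0 (sub_nonneg.2 hL)]

theorem sum_ite_zeroAt_zeroAt {i j : ι} (hij : i ≠ j) (ω : Ω) {φ : ℝ → ℝ} (hφ : φ 0 = 0) :
    ∑ l, φ (zeroAt j (zeroAt i ξ) l ω) = ∑ l, φ (ξ l ω) - φ (ξ i ω) - φ (ξ j ω) := by
  rw [sum_zeroAt hφ, sum_zeroAt hφ]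
  simp [zeroAt, hij.symm]

/-- The events `1 < |ξ i|`, `x < |W - ξ i|` have total probability at least that of their union
together with the event that two summands equal `L` and `W = 2 L - 1`. -/
theorem Summands.measureReal_union_iUnion_le (h : Summands P ξ) {L : ℝ} (hL : 3 ≤ L) {B : Set Ω}
    (hBm : MeasurableSet B) (hB : ∀ ω ∈ B, ∑ j, ξ j ω = 2 * L - 1 ∧ ∃ i j, i ≠ j ∧ ξ i ω = L ∧ ξ j ω = L)
    {F : ι → Set Ω} (hFm : ∀ i, MeasurableSet (F i))
    (hF : ∀ i ω, ξ i ω = L → 2 * L - 1 < ∑ j, ξ j ω → ω ∈ F i) :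
    P.real (B ∪ ⋃ i, F i) ≤ ∑ i, P.real (F i) := by
  classical
  have hm := h.meas
  set χ : ι → Ω → ℝ := fun i ω => if ξ i ω = L then 1 else 0 with hχ
  set q : ι → ι → Ω → ℝ := fun i j ω =>
    levelTest L (fun l => _root_.zeroAt j (_root_.zeroAt i ξ) l ω) with hq
  have hqI : ∀ i j, Integrable (q i j) P := fun i j =>
    ((h.zeroAt i).zeroAt j).integrable_levelTest L
  have hχm : ∀ i, Measurable (χ i) := fun i => Measurable.ite
    (measurableSet_eq_fun (hm i) measurable_const) measurable_const measurable_const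
  have hχb : ∀ i ω, ‖χ i ω‖ ≤ 1 := fun i ω => by
    simp only [hχ]; split_ifs <;> simp
  have hχqI : ∀ i j, Integrable (fun ω => χ i ω * (χ j ω * q i j ω)) P := fun i j =>
    ((hqI i j).bdd_mul (hχm j).aestronglyMeasurable
      (Filter.Eventually.of_forall (hχb j))).bdd_mul (hχm i).aestronglyMeasurable
      (Filter.Eventually.of_forall (hχb i))
  -- The two indicators and `q i j`, which depends on the other summands only, are independent; so
  -- nonnegativity of the mean of `levelTest` carries over.
  have hpos : ∀ i j, i ≠ j → 0 ≤ ∫ ω, χ i ω * (χ j ω * q i j ω) ∂P := by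
    intro i j hij
    have hmχ : Measurable (fun x : ℝ => if x = L then (1 : ℝ) else 0) := Measurable.ite
      (measurableSet_eq_fun measurable_id measurable_const) measurable_const measurable_const
    have hqm : Measurable (q i j) := (measurable_levelTest L).comp
      (measurable_pi_lambda _ fun l => ((h.zeroAt i).zeroAt j).meas l)
    have hz2 : ∀ ω l, _root_.zeroAt j (_root_.zeroAt i ξ) l ω =
        if l = j then 0 else _root_.zeroAt i ξ l ω := fun _ _ => rfl
    have hmG : Measurable (fun v : ι → ℝ => levelTest L (fun l => if l = j then 0 else v l)) := by
      refine (measurable_levelTest L).comp (measurable_pi_lambda _ fun l => ?_)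
      by_cases hl : l = j
      · simp only [hl, if_true]; exact measurable_const
      · simp only [hl, if_false]; exact measurable_pi_apply l
    have a1 := ((iIndepFun.indepFun_zeroAt h.indep h.meas i
      (G := fun v => (if v j = L then (1 : ℝ) else 0) *
        levelTest L (fun l => if l = j then 0 else v l))
      ((hmχ.comp (measurable_pi_apply j)).mul hmG)).comp hmχ measurable_id)
    have hχj : ∀ ω, (if _root_.zeroAt i ξ j ω = L then (1 : ℝ) else 0) = χ j ω := fun ω => by
      simp [_root_.zeroAt, hij.symm, hχ]
    simp only [Function.comp_def, id, hχj, ← hz2] at a1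
    have b1 := a1.integral_fun_mul_eq_mul_integral (hχm i).aestronglyMeasurable
      ((hχm j).mul hqm).aestronglyMeasurable
    have a2 := ((iIndepFun.indepFun_zeroAt (h.zeroAt i).indep (h.zeroAt i).meas j
      (G := levelTest L) (measurable_levelTest L)).comp hmχ measurable_id)
    simp only [Function.comp_def, id, hχj] at a2
    have b2 := a2.integral_fun_mul_eq_mul_integral (hχm j).aestronglyMeasurable
      hqm.aestronglyMeasurable
    have b3 : ∫ ω, χ i ω * (χ j ω * q i j ω) ∂P =
      (∫ ω, χ i ω ∂P) * ((∫ ω, χ j ω ∂P) * ∫ ω, q i j ω ∂P) := b1.trans (by rw [← b2])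
    rw [b3]
    have hχ0 : ∀ i, 0 ≤ ∫ ω, χ i ω ∂P := fun i => integral_nonneg fun ω => by
      simp only [hχ]; split_ifs <;> simp
    exact mul_nonneg (hχ0 i) (mul_nonneg (hχ0 j)
      (((h.zeroAt i).zeroAt j).integral_levelTest_nonneg hL))
  set N : Ω → ℝ := fun ω => ∑ i, (F i).indicator (fun _ => (1 : ℝ)) ω with hN
  have hNI : Integrable N P := integrable_finsetSum _ fun i _ =>
    (integrable_const _).indicator (hFm i)
  -- Plan: bound the indicator of the union pointwise by `N - Q / 2`, then integrate and use E Q ≥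
  -- 0.
  set Q : Ω → ℝ := fun ω => ∑ i, ∑ j ∈ Finset.univ.erase i, χ i ω * (χ j ω * q i j ω) with hQ
  have hQI : Integrable Q P := integrable_finsetSum _ fun i _ => integrable_finsetSum _ fun j _ =>
    hχqI i j
  have hQ0 : 0 ≤ ∫ ω, Q ω ∂P := by
    simp only [hQ]
    rw [integral_finsetSum _ fun i _ => integrable_finsetSum _ fun j _ => hχqI i j]
    refine Finset.sum_nonneg fun i _ => ?_
    rw [integral_finsetSum _ fun j _ => hχqI i j]
    exact Finset.sum_nonneg fun j hj => hpos i j (Finset.ne_of_mem_erase hj).symm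
  -- All ordered pairs at level `L` contribute the same value, since it depends only on the number
  -- `k` of summands at `L` and the sum `r` of the others.
  have hQeq : ∀ ω, ∃ r : ℝ, ∃ k : ℕ, (∑ i, χ i ω = k) ∧
      r = ∑ l, ξ l ω - k * L ∧
      Q ω = k * (k - 1) * (1 - (r - 1) ^ 2 / 2 - (k - 2) / 3) := by
    intro ω
    set k : ℕ := (Finset.univ.filter fun i => ξ i ω = L).card with hk
    have hk1 : ∑ i, χ i ω = k := by
      simp only [hχ, hk, Finset.sum_boole]
    refine ⟨∑ l, ξ l ω - k * L, k, hk1, rfl, ?_⟩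
    have hτ : ∑ l, (if ξ l ω = L then 0 else ξ l ω) = ∑ l, ξ l ω - k * L := by
      rw [← hk1, Finset.sum_mul, ← Finset.sum_sub_distrib]
      refine Finset.sum_congr rfl fun l _ => ?_
      simp only [hχ]
      split_ifs with hh <;> simp [hh]
    set r := ∑ l, ξ l ω - k * L with hr
    have hL0 : (0 : ℝ) ≠ L := by linarith
    have hterm : ∀ i, ∀ j ∈ Finset.univ.erase i, χ i ω * (χ j ω * q i j ω) =
        χ i ω * χ j ω * (1 - (r - 1) ^ 2 / 2 - (k - 2) / 3) := by
      intro i j hj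
      have hij : i ≠ j := (Finset.ne_of_mem_erase hj).symm
      by_cases hi : ξ i ω = L
      · by_cases hj' : ξ j ω = L
        · have e1 : q i j ω = 1 - (r - 1) ^ 2 / 2 - (k - 2) / 3 := by
            simp only [hq, levelTest]
            rw [sum_ite_zeroAt_zeroAt hij ω (φ := fun x => if x = L then 0 else x) (by simp),
              sum_ite_zeroAt_zeroAt hij ω (φ := fun x => if x = L then 1 else 0) (by simp [hL0])]
            have hk1' : ∑ l, (if ξ l ω = L then (1 : ℝ) else 0) = k := hk1
            rw [hτ, hk1']
            simp only [hi, hj', if_true]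
            ring
          rw [e1, mul_assoc]
        · simp [hχ, hj']
      · simp [hχ, hi]
    have hχsq : ∀ i, χ i ω * χ i ω = χ i ω := fun i => by
      simp only [hχ]; split_ifs <;> simp
    simp only [hQ]
    rw [Finset.sum_congr rfl fun i _ => Finset.sum_congr rfl (hterm i)]
    simp only [← Finset.sum_mul]
    congr 1
    have : ∀ i, ∑ j ∈ Finset.univ.erase i, χ i ω * χ j ω = χ i ω * (k - 1) := by
      intro i
      rw [← Finset.mul_sum]
      have := Finset.add_sum_erase Finset.univ (fun j => χ j ω) (Finset.mem_univ i)
      simp only [hk1] at this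
      rw [show ∑ j ∈ Finset.univ.erase i, χ j ω = k - χ i ω by linarith, mul_sub, mul_sub, hχsq,
        mul_one]
    simp only [this, ← Finset.sum_mul, hk1]
  have hmeasU : MeasurableSet (⋃ i, F i) := MeasurableSet.iUnion hFm
  have hpt : ∀ ω, (B ∪ ⋃ i, F i).indicator (fun _ => (1 : ℝ)) ω ≤ N ω - Q ω / 2 := by
    intro ω
    have hN0 : 0 ≤ N ω := Finset.sum_nonneg fun i _ =>
      Set.indicator_nonneg (fun _ _ => zero_le_one) _
    have hNF : ω ∈ ⋃ i, F i → 1 ≤ N ω := by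
      intro hω
      obtain ⟨i, hi⟩ := Set.mem_iUnion.1 hω
      have := Finset.single_le_sum (f := fun i => (F i).indicator (fun _ => (1 : ℝ)) ω)
        (fun i _ => Set.indicator_nonneg (fun _ _ => zero_le_one) _) (Finset.mem_univ i)
      simpa only [Set.indicator_of_mem hi] using this
    have hind1 : (B ∪ ⋃ i, F i).indicator (fun _ => (1 : ℝ)) ω ≤ 1 :=
      Set.indicator_le_self' (fun _ _ => zero_le_one) _
    obtain ⟨r, k, hk, hr, hQk⟩ := hQeq ω
    have hkk : (0 : ℝ) ≤ k * (k - 1) := by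
      rcases Nat.eq_zero_or_pos k with h0 | h0
      · simp [h0]
      · have : (1 : ℝ) ≤ k := by exact_mod_cast h0
        nlinarith
    rcases lt_or_ge (2 * L - 1) (∑ j, ξ j ω) with hW | hW
    · have hQle : Q ω ≤ k * (k - 1) * (1 - (k - 2) / 3) := by
        rw [hQk]
        refine mul_le_mul_of_nonneg_left ?_ hkk
        nlinarith [sq_nonneg (r - 1)]
      have hNk : (k : ℝ) ≤ N ω := by
        rw [← hk]
        refine Finset.sum_le_sum fun i _ => ?_
        by_cases hi : ξ i ω = L
        · rw [Set.indicator_of_mem (hF i ω hi hW)]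
          simp [hχ, hi]
        · simp only [hχ, hi, if_false]
          exact Set.indicator_nonneg (fun _ _ => zero_le_one) _
      rcases Nat.eq_zero_or_pos k with h0 | h0
      · rw [h0] at hQle
        simp only [Nat.cast_zero, zero_mul] at hQle
        by_cases hω : ω ∈ ⋃ i, F i
        · linarith [hNF hω]
        · rw [Set.indicator_of_notMem]
          · linarith
          · rintro (hb | hf)
            · linarith [(hB ω hb).1]
            · exact hω hf
      · have hk2 : (0 : ℝ) ≤ (k - 1) * ((k - 2) * (k - 3)) := by
          have h1 : (1 : ℝ) ≤ k := by exact_mod_cast h0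
          refine mul_nonneg (by linarith) ?_
          rcases Nat.lt_or_ge k 3 with h3 | h3
          · have : (k : ℝ) ≤ 2 := by exact_mod_cast Nat.lt_succ_iff.1 h3
            nlinarith
          · have : (3 : ℝ) ≤ k := by exact_mod_cast h3
            nlinarith
        nlinarith
    · have hQ0' : Q ω ≤ 0 := by
        rw [hQk]
        rcases Nat.lt_or_ge k 2 with h2 | h2
        · interval_cases k <;> simp
        · have h2' : (2 : ℝ) ≤ k := by exact_mod_cast h2
          have : r ≤ -1 := by rw [hr]; nlinarith
          refine mul_nonpos_of_nonneg_of_nonpos hkk ?_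
          nlinarith
      by_cases hb : ω ∈ B
      · obtain ⟨-, i, j, hij, hi, hj⟩ := hB ω hb
        have hk2 : (2 : ℝ) ≤ k := by
          rw [← hk, ← Finset.add_sum_erase _ _ (Finset.mem_univ i),
            ← Finset.add_sum_erase _ _ (Finset.mem_erase.2 ⟨hij.symm, Finset.mem_univ j⟩)]
          have : 0 ≤ ∑ x ∈ (Finset.univ.erase i).erase j, χ x ω :=
            Finset.sum_nonneg fun l _ => by simp only [hχ]; split_ifs <;> simp
          simp only [hχ, hi, hj, if_true] at this ⊢
          linarith
        -- Two summands at `L` and total at most 2L - 1 force r ≤ -1, hence (r-1)²/2 ≥ 2 and Q ≤ -2.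
        -- This negative value pays for `B`.
        have : r ≤ -1 := by rw [hr]; nlinarith
        have hQ2 : Q ω ≤ -2 := by
          rw [hQk]
          have c1 : 1 - (r - 1) ^ 2 / 2 - ((k : ℝ) - 2) / 3 ≤ -1 := by nlinarith
          nlinarith
        linarith
      · by_cases hω : ω ∈ ⋃ i, F i
        · linarith [hNF hω]
        · rw [Set.indicator_of_notMem]
          · linarith
          · rintro (hb' | hf)
            · exact hb hb'
            · exact hω hf
  have hUm : MeasurableSet (B ∪ ⋃ i, F i) := hBm.union hmeasU
  calc P.real (B ∪ ⋃ i, F i)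
      = ∫ ω, (B ∪ ⋃ i, F i).indicator (fun _ => (1 : ℝ)) ω ∂P := by
        rw [integral_indicator_const _ hUm, smul_eq_mul, mul_one]
    _ ≤ ∫ ω, (N ω - Q ω / 2) ∂P := integral_mono ((integrable_const _).indicator hUm)
        (hNI.sub (hQI.div_const 2)) hpt
    _ = ∑ i, P.real (F i) - (∫ ω, Q ω ∂P) / 2 := by
        rw [integral_sub hNI (hQI.div_const 2), integral_div]
        congr 1
        simp only [hN]
        rw [integral_finsetSum _ fun i _ => (integrable_const _).indicator (hFm i)]
        exact Finset.sum_congr rfl fun i _ => by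
          rw [integral_indicator_const _ (hFm i), smul_eq_mul, mul_one]
    _ ≤ _ := by linarith

end

/-! ### The sum in a random interval -/

section

variable {Ω : Type*} [MeasurableSpace Ω] {P : Measure Ω} [IsProbabilityMeasure P]
  {ι : Type*} [Fintype ι] [DecidableEq ι] {ξ : ι → Ω → ℝ}

/-- The event that some summand exceeds `1` while the sum is at least `(2 z - 1) / 3` and no
summand exceeds `(z + 1) / 3`. -/
theorem Summands.measure_exceed_le (h : Summands P ξ) {δ z : ℝ} (hδ : 0 ≤ δ)
    (hκ : 1 / 2 ≤ ∑ i, ∫ ω, |ξ i ω| * min δ |ξ i ω| ∂P) {F : ι → Set Ω}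
    (hF : ∀ i, F i = {ω | (z - 2) / 3 < |∑ j, ξ j ω - ξ i ω|} ∩ {ω | 1 < |ξ i ω|}) {G : Set Ω}
    (hG : ∀ ω ∈ G, (2 * z - 1) / 3 ≤ ∑ j, ξ j ω ∧ (∃ i, 1 < ξ i ω) ∧
      ∀ i, ξ i ω ≤ (z + 1) / 3) :
    P.real (G ∪ ⋃ i, F i) ≤ ∑ i, P.real (F i) + Real.exp (-z / 3) * (11.6 * δ) := by
  have hm := h.meas
  have hFm : ∀ i, MeasurableSet (F i) := fun i => by
    rw [hF i]
    exact (measurableSet_lt measurable_const (by fun_prop)).inter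
      (measurableSet_lt measurable_const (by fun_prop))
  -- Outside every `F i` the rest is at most (z-2)/3, while ξ_i ≤ (z+1)/3 and the sum is at least
  -- (2z-1)/3; all three inequalities must be equalities.
  have hGF : ∀ ω ∈ G, ω ∉ ⋃ i, F i → ∀ i, 1 < ξ i ω →
      ξ i ω = (z + 1) / 3 ∧ ∑ j, ξ j ω = (2 * z - 1) / 3 := by
    intro ω hω hn i hi
    obtain ⟨h1, -, h3⟩ := hG ω hω
    have h4 : ¬ (z - 2) / 3 < |∑ j, ξ j ω - ξ i ω| := by
      intro hc
      exact hn (Set.mem_iUnion.2 ⟨i, by rw [hF i]; exact ⟨hc, hi.trans_le (le_abs_self _)⟩⟩)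
    have h5 := (le_abs_self _).trans (not_lt.1 h4)
    have h6 := h3 i
    constructor <;> linarith
  have hnn : 0 ≤ Real.exp (-z / 3) * (11.6 * δ) := by positivity
  have hUF : P.real (⋃ i, F i) ≤ ∑ i, P.real (F i) := measureReal_iUnion_fintype_le _
  rcases le_or_gt ((z + 1) / 3) 1 with hL1 | hL1
  · have : G = ∅ := Set.eq_empty_of_forall_notMem fun ω hω => by
      obtain ⟨-, ⟨i, hi⟩, h3⟩ := hG ω hω
      linarith [h3 i]
    rw [this, Set.empty_union]
    linarith
  rcases le_or_gt ((z + 1) / 3) 3 with hL3 | hL3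
  · have h1 := h.boundary_le_of_le_three hδ hκ hL1.le hL3 (B := G \ ⋃ i, F i) fun ω hω => by
      obtain ⟨-, ⟨i, hi⟩, -⟩ := hG ω hω.1
      obtain ⟨h1, h2⟩ := hGF ω hω.1 hω.2 i hi
      exact ⟨i, h1, by rw [h1, h2]; ring⟩
    rw [← Set.sdiff_union_self]
    exact (measureReal_union_le _ _).trans (by linarith)
  -- If exactly one summand exceeds 1, truncation does not affect the others and `B1` occurs. If two
  -- exceed 1, both equal (z+1)/3 and `B2` occurs.
  · set B1 : Set Ω := {ω | ∃ i, ξ i ω = (z + 1) / 3 ∧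
      ∑ j, min (ξ j ω) 1 - min (ξ i ω) 1 = (z - 2) / 3} with hB1
    set B2 : Set Ω := {ω | ∑ j, ξ j ω = 2 * ((z + 1) / 3) - 1 ∧
      ∃ i j, i ≠ j ∧ ξ i ω = (z + 1) / 3 ∧ ξ j ω = (z + 1) / 3} with hB2
    have hB2m : MeasurableSet B2 := by
      refine (measurableSet_eq_fun (by fun_prop) measurable_const).inter ?_
      have e : {ω | ∃ i j, i ≠ j ∧ ξ i ω = (z + 1) / 3 ∧ ξ j ω = (z + 1) / 3} =
          ⋃ i, ⋃ j, {_ω : Ω | i ≠ j} ∩ ({ω | ξ i ω = (z + 1) / 3} ∩ {ω | ξ j ω = (z + 1) / 3}) := by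
        ext ω; simp
      change MeasurableSet {ω | ∃ i j, i ≠ j ∧ ξ i ω = (z + 1) / 3 ∧ ξ j ω = (z + 1) / 3}
      rw [e]
      exact MeasurableSet.iUnion fun i => MeasurableSet.iUnion fun j =>
        (MeasurableSet.const _).inter ((measurableSet_eq_fun (hm i) measurable_const).inter
          (measurableSet_eq_fun (hm j) measurable_const))
    have h1 := h.boundary_le_of_three_le hδ hκ hL3.le (B := B1) fun ω hω => hω
    have h2 := h.measureReal_union_iUnion_le hL3.le hB2m (fun ω hω => hω) hFm fun i ω hi hW => by
      rw [hF i]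
      refine ⟨?_, ?_⟩
      · rw [Set.mem_ofPred_eq]
        refine lt_of_lt_of_le ?_ (le_abs_self _)
        linarith
      · rw [Set.mem_ofPred_eq, hi]
        exact hL1.trans_le (le_abs_self _)
    refine (measureReal_mono (s₂ := B1 ∪ (B2 ∪ ⋃ i, F i)) ?_).trans
      ((measureReal_union_le _ _).trans (by linarith))
    rintro ω (hω | hω)
    · by_cases hn : ω ∈ ⋃ i, F i
      · exact Or.inr (Or.inr hn)
      · obtain ⟨-, ⟨i, hi⟩, -⟩ := hG ω hω
        obtain ⟨e1, e2⟩ := hGF ω hω hn i hi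
        by_cases hj : ∃ j, i ≠ j ∧ 1 < ξ j ω
        · obtain ⟨j, hij, hj⟩ := hj
          exact Or.inr (Or.inl ⟨by rw [e2]; ring, i, j, hij, e1, (hGF ω hω hn j hj).1⟩)
        · push Not at hj
          refine Or.inl ⟨i, e1, ?_⟩
          have e3 : ∑ j, min (ξ j ω) 1 - min (ξ i ω) 1 = ∑ j, ξ j ω - ξ i ω := by
            rw [← Finset.add_sum_erase _ _ (Finset.mem_univ i),
              ← Finset.add_sum_erase _ (fun j => ξ j ω) (Finset.mem_univ i),
              add_sub_cancel_left, add_sub_cancel_left]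
            refine Finset.sum_congr rfl fun j hj' => min_eq_left ?_
            exact hj j (Finset.ne_of_mem_erase hj').symm
          rw [e3, e1, e2]
          ring
    · exact Or.inr (Or.inr hω)

/-- Only a constant is needed here: e^{R/2} ≤ 1 + e^R for the truncated sum R, then Markov's
inequality; 1.19 · 3.1 ≤ 10.4. -/
theorem Summands.measure_truncated_le_of_one_le (h : Summands P ξ) {z δ : ℝ} (hδ : 1 ≤ δ)
    {A : Set Ω} (hA : MeasurableSet A) (hAz : ∀ ω ∈ A, (2 * z - 1) / 3 ≤ ∑ j, min (ξ j ω) 1) :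
    P A ≤ ENNReal.ofReal (Real.exp (-z / 3)) * ENNReal.ofReal (10.4 * δ) := by
  rw [← ENNReal.ofReal_mul (Real.exp_pos _).le, ← ofReal_measureReal]
  refine ENNReal.ofReal_le_ofReal ?_
  have hI := (memLp_exp_mul_sum (P := P) h.meas (φ := fun x => min x 1) (θ := 1) (by fun_prop)
    zero_le_one (Or.inr fun x => min_le_right _ _) 1).integrable le_rfl
  have h2 := h.integral_exp_sum_min_one_le zero_le_one
  have h3 : ∫ ω, Real.exp (1 * ∑ j, min (ξ j ω) 1) ∂P ≤ 2.1 :=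
    h2.trans ((Real.exp_le_exp.2 (by linarith)).trans exp_exp_one_sub_two_le)
  have e1 : Real.exp (-z / 3) * Real.exp (z / 3) = 1 := by
    rw [← Real.exp_add]; ring_nf; exact Real.exp_zero
  have h4 : Real.exp (z / 3) / 1.19 * P.real A ≤ 1 + 2.1 := by
    rw [mul_comm, ← smul_eq_mul, ← integral_indicator_const _ hA]
    calc _ ≤ ∫ ω, (1 + Real.exp (1 * ∑ j, min (ξ j ω) 1)) ∂P := by
          refine integral_mono ((integrable_const _).indicator hA)
            ((integrable_const _).add hI) fun ω => ?_
          by_cases hω : ω ∈ A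
          · rw [Set.indicator_of_mem hω, div_le_iff₀ (by norm_num)]
            have a1 := hAz ω hω
            calc Real.exp (z / 3) ≤ Real.exp (1 / 2 * ∑ j, min (ξ j ω) 1 + 1 / 6) :=
                  Real.exp_le_exp.2 (by linarith)
              _ = Real.exp (1 / 2 * ∑ j, min (ξ j ω) 1) * Real.exp (1 / 6) := Real.exp_add _ _
              _ ≤ _ := mul_le_mul ?_ exp_sixth_le (Real.exp_pos _).le (by positivity)
            have : Real.exp (1 * ∑ j, min (ξ j ω) 1) =
              Real.exp (1 / 2 * ∑ j, min (ξ j ω) 1) ^ 2 := by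
              rw [← Real.exp_nat_mul]; congr 1; push_cast; ring
            rw [this]
            nlinarith [sq_nonneg (Real.exp (1 / 2 * ∑ j, min (ξ j ω) 1) - 1)]
          · rw [Set.indicator_of_notMem hω]
            positivity
      _ ≤ 1 + 2.1 := by
          rw [integral_add (integrable_const _) hI]
          simp only [integral_const, probReal_univ, smul_eq_mul, mul_one]
          linarith
  calc P.real A = Real.exp (-z / 3) * (Real.exp (z / 3) * P.real A) := by
        rw [← mul_assoc, e1, one_mul]
    _ ≤ _ := by
        refine mul_le_mul_of_nonneg_left ?_ (Real.exp_pos _).le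
        rw [div_mul_eq_mul_div, div_le_iff₀ (by norm_num)] at h4
        linarith

/-- Non-uniform bound for the probability that the sum falls in a random interval of length `|Δ|`
with one end point `z` (for `c = 0, 1`). -/
theorem Summands.measure_random_interval_le (h : Summands P ξ) {Δ : Ω → ℝ} (hΔ : Measurable Δ)
    {D : ι → Ω → ℝ} (hD : ∀ i, Measurable (D i))
    (hind : ∀ i, IndepFun (ξ i) (fun ω => (D i ω, ∑ j, min (ξ j ω) 1 - min (ξ i ω) 1)) P)
    {z δ c : ℝ} (hz : 0 ≤ z) (hδ : 0 ≤ δ) (hc0 : 0 ≤ c) (hc1 : c ≤ 1)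
    (hκ : 1 / 2 ≤ ∑ i, ∫ ω, |ξ i ω| * min δ |ξ i ω| ∂P) {S : Set Ω}
    (hS : ∀ ω ∈ S, z - c * |Δ ω| ≤ ∑ j, ξ j ω ∧ ∑ j, ξ j ω ≤ z + (1 - c) * |Δ ω|) :
    P S ≤ P {ω | (z + 1) / 3 < |Δ ω|} + ∑ i, P {ω | (z + 1) / 3 < |ξ i ω|} +
      ∑ i, P {ω | (z - 2) / 3 < |∑ j, ξ j ω - ξ i ω|} * P {ω | 1 < |ξ i ω|} +
      ENNReal.ofReal (Real.exp (-z / 3)) * (ENNReal.ofReal (22 * δ) +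
      ENNReal.ofReal 8.5 * eLpNorm Δ 2 P +
      ENNReal.ofReal 3.6 * ∑ i, eLpNorm (ξ i) 2 P * eLpNorm (fun ω => Δ ω - D i ω) 2 P) := by
  have hm := h.meas
  set L := (z + 1) / 3 with hL
  set F : ι → Set Ω := fun i => {ω | (z - 2) / 3 < |∑ j, ξ j ω - ξ i ω|} ∩ {ω | 1 < |ξ i ω|} with hF
  set A : Set Ω := {ω | |Δ ω| ≤ L} ∩ ({ω | z - c * |Δ ω| ≤ ∑ j, min (ξ j ω) 1} ∩
    {ω | ∑ j, min (ξ j ω) 1 ≤ z + (1 - c) * |Δ ω|}) with hA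
  set G : Set Ω := {ω | (2 * z - 1) / 3 ≤ ∑ j, ξ j ω ∧ (∃ i, 1 < ξ i ω) ∧ ∀ i, ξ i ω ≤ L} with hG
  have hcL : ∀ ω, |Δ ω| ≤ L → c * |Δ ω| ≤ L := fun ω hω =>
    (mul_le_of_le_one_left (abs_nonneg _) hc1).trans hω
  have hAm : MeasurableSet A := (measurableSet_le (by fun_prop) measurable_const).inter
    ((measurableSet_le (by fun_prop) (by fun_prop)).inter
      (measurableSet_le (by fun_prop) (by fun_prop)))
  -- When Δ and all summands are at most `L` in absolute value, either no summand exceeds 1, so that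
  -- the truncated sum is the sum and `A` occurs, or `G` occurs because the sum is at least z - L =
  -- (2z-1)/3.
  have hcover : S ⊆ {ω | L < |Δ ω|} ∪ ((⋃ i, {ω | L < |ξ i ω|}) ∪ (A ∪ (G ∪ ⋃ i, F i))) := by
    intro ω hω
    obtain ⟨s1, s2⟩ := hS ω hω
    by_cases h1 : L < |Δ ω|
    · exact Or.inl h1
    right
    have h1' := not_lt.1 h1
    by_cases h2 : ∃ i, L < |ξ i ω|
    · exact Or.inl (Set.mem_iUnion.2 h2)
    right
    push Not at h2
    by_cases h3 : ∃ i, 1 < ξ i ω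
    · right; left
      refine ⟨?_, h3, fun i => (le_abs_self _).trans (h2 i)⟩
      have := hcL ω h1'
      linarith
    · left
      push Not at h3
      have e : ∑ j, min (ξ j ω) 1 = ∑ j, ξ j ω :=
        Finset.sum_congr rfl fun j _ => min_eq_left (h3 j)
      refine ⟨h1', ?_, ?_⟩
      · rw [Set.mem_ofPred_eq, e]; exact s1
      · rw [Set.mem_ofPred_eq, e]; exact s2
  set T2 := ENNReal.ofReal 8.5 * eLpNorm Δ 2 P with hT2
  set T3 := ENNReal.ofReal 3.6 * ∑ i, eLpNorm (ξ i) 2 P * eLpNorm (fun ω => Δ ω - D i ω) 2 P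
  have hPA : P A ≤ ENNReal.ofReal (Real.exp (-z / 3)) *
      (ENNReal.ofReal (10.4 * δ) + T2 + T3) := by
    rcases le_total δ 1 with hδ1 | hδ1
    · exact h.measure_truncated_le hΔ hD hind hz hδ hδ1 hc0 hc1 hκ hAm (fun ω hω => hω.1)
        fun ω hω => hω.2
    · refine (h.measure_truncated_le_of_one_le hδ1 hAm fun ω hω => ?_).trans
        (mul_le_mul' le_rfl (by rw [add_assoc]; exact le_self_add))
      have a1 : z - c * |Δ ω| ≤ ∑ j, min (ξ j ω) 1 := hω.2.1
      have := hcL ω hω.1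
      linarith
  have hPG : P (G ∪ ⋃ i, F i) ≤
      ∑ i, P {ω | (z - 2) / 3 < |∑ j, ξ j ω - ξ i ω|} * P {ω | 1 < |ξ i ω|} +
      ENNReal.ofReal (Real.exp (-z / 3)) * ENNReal.ofReal (11.6 * δ) := by
    have h1 := h.measure_exceed_le hδ hκ (fun i => rfl) (G := G) (F := F) fun ω hω => hω
    rw [← ofReal_measureReal, ← ENNReal.ofReal_mul (Real.exp_pos _).le]
    refine (ENNReal.ofReal_le_ofReal h1).trans ?_
    rw [ENNReal.ofReal_add (Finset.sum_nonneg fun i _ => measureReal_nonneg) (by positivity),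
      ENNReal.ofReal_sum_of_nonneg fun i _ => measureReal_nonneg]
    refine add_le_add (Finset.sum_le_sum fun i _ => ?_) le_rfl
    rw [ofReal_measureReal, mul_comm]
    have hi := (h.indep_sub (φ := fun x => x) measurable_id rfl i).measure_inter_preimage_eq_mul
      (s := {x | 1 < |x|}) (t := {r | (z - 2) / 3 < |r|})
      (measurableSet_lt measurable_const (by fun_prop))
      (measurableSet_lt measurable_const (by fun_prop))
    simp only [hF]
    rw [Set.inter_comm]
    exact hi.le
  calc P S ≤ P {ω | L < |Δ ω|} + (∑ i, P {ω | L < |ξ i ω|} + (P A + P (G ∪ ⋃ i, F i))) := by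
        refine (measure_mono hcover).trans ((measure_union_le _ _).trans (add_le_add le_rfl ?_))
        refine (measure_union_le _ _).trans (add_le_add (measure_iUnion_fintype_le _ _) ?_)
        exact measure_union_le _ _
    _ ≤ _ := by
        rw [add_assoc, add_assoc]
        refine add_le_add le_rfl (add_le_add le_rfl ?_)
        -- The constant 22 is 10.4 from concentration plus 11.6 from the boundary event.
        have e : ENNReal.ofReal (22 * δ) =
            ENNReal.ofReal (10.4 * δ) + ENNReal.ofReal (11.6 * δ) := by
          rw [← ENNReal.ofReal_add (by positivity) (by positivity)]
          congr 1; ring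
        refine (add_le_add hPA hPG).trans (le_of_eq ?_)
        rw [e]
        ring

end

/-! ### Comparison of T and W -/

section

variable {Ω : Type*} [MeasurableSpace Ω] {P : Measure Ω} [IsProbabilityMeasure P] {n : ℕ}
  {X : Fin n → Ω → ℝ} {g : Fin n → ℝ → ℝ} {T : (Fin n → ℝ) → ℝ} {D : Fin n → Ω → ℝ}

theorem ofReal_abs_measureReal_sub_le {A B : Set Ω} {b : ℝ≥0∞} (h1 : P (A \ B) ≤ b)
    (h2 : P (B \ A) ≤ b) : ENNReal.ofReal |P.real A - P.real B| ≤ b := by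
  have key : ∀ A B : Set Ω, P.real A - P.real B ≤ P.real (A \ B) := fun A B => by
    have := measureReal_mono (μ := P) (s₁ := A) (s₂ := B ∪ A \ B) (by
      rw [Set.union_sdiff_self]; exact Set.subset_union_right)
    linarith [measureReal_union_le (μ := P) B (A \ B)]
  rcases abs_cases (P.real A - P.real B) with ⟨h, -⟩ | ⟨h, -⟩
  · rw [h]
    refine (ENNReal.ofReal_le_ofReal (key A B)).trans ?_
    rwa [ofReal_measureReal]
  · rw [h, neg_sub]
    refine (ENNReal.ofReal_le_ofReal (key B A)).trans ?_
    rwa [ofReal_measureReal]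

theorem StandingAssumptions.summands (h : StandingAssumptions P X g T) :
    Summands P (fun i ω => g i (X i ω)) where
  meas i := (h.measurable_g i).comp (h.measurable_X i)
  indep := h.indep_X.comp g h.measurable_g
  memLp := h.memLp_g
  mean := h.mean_g
  var := h.var_g.le

theorem StandingAssumptions.measurable_statDelta (h : StandingAssumptions P X g T) :
    Measurable (statDelta X g T) := by
  have h1 := h.measurable_X
  have h2 := h.measurable_g
  have h3 := h.measurable_T
  unfold statDelta statT statW
  fun_prop

theorem IsLeaveOneOut.indepFun (hD : IsLeaveOneOut P X D) (i : Fin n) {F : ℝ → ℝ}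
    (hF : Measurable F) {G : Fin n → ℝ → ℝ} (hG : ∀ j, Measurable (G j)) :
    IndepFun (fun ω => F (X i ω))
      (fun ω => (D i ω, ∑ j, G j (X j ω) - G i (X i ω))) P := by
  have h1 := (hD i).2.comp (φ := F)
    (ψ := fun p : ℝ × ({j : Fin n // j ≠ i} → ℝ) => (p.1, ∑ j : {j : Fin n // j ≠ i}, G j.1 (p.2 j))) hF
    (by have := fun j : {j : Fin n // j ≠ i} => hG j.1; fun_prop)
  have e : ∀ ω, ∑ j : {j : Fin n // j ≠ i}, G j (X j ω) = ∑ j, G j (X j ω) - G i (X i ω) := by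
    intro ω
    rw [← Finset.add_sum_erase _ _ (Finset.mem_univ i), add_sub_cancel_left,
      Finset.sum_subtype (Finset.univ.erase i) (p := fun j => j ≠ i) (by simp)
        (fun j => G j (X j ω))]
  simp only [Function.comp_def, e] at h1
  exact h1

theorem StandingAssumptions.ofReal_abs_sub_le (h : StandingAssumptions P X g T)
    (hD : IsLeaveOneOut P X D) {δ : ℝ} (hδ : IsAdmissible P X g δ) (z : ℝ) :
    ENNReal.ofReal |P.real {ω | statT X T ω ≤ z} - P.real {ω | statW X g ω ≤ z}| ≤
      gammaTerm P X g T z + ENNReal.ofReal (Real.exp (-|z| / 3)) * tauTerm P X g T D δ := by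
  obtain ⟨hδ0, hκ⟩ := hδ
  have hg := h.measurable_g
  have hΔm := h.measurable_statDelta
  have hΔ : ∀ ω, statDelta X g T ω = statT X T ω - statW X g ω := fun _ => rfl
  -- The parameter `c` places the interval: `c = 0` puts it to the right of the level, `c = 1` to
  -- the left. For z ≤ 0 the bound is applied to the negated summands at level -z.
  have main : ∀ (c : ℝ) (S : Set Ω), 0 ≤ c → c ≤ 1 →
      ((0 ≤ z ∧ ∀ ω ∈ S, z - c * |statDelta X g T ω| ≤ statW X g ω ∧
        statW X g ω ≤ z + (1 - c) * |statDelta X g T ω|) ∨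
      (z ≤ 0 ∧ ∀ ω ∈ S, -z - c * |statDelta X g T ω| ≤ -statW X g ω ∧
        -statW X g ω ≤ -z + (1 - c) * |statDelta X g T ω|)) →
      P S ≤ gammaTerm P X g T z + ENNReal.ofReal (Real.exp (-|z| / 3)) * tauTerm P X g T D δ := by
    intro c S hc0 hc1 hS
    unfold gammaTerm tauTerm crossTerm
    rcases hS with ⟨hz, hS⟩ | ⟨hz, hS⟩
    · rw [abs_of_nonneg hz]
      exact h.summands.measure_random_interval_le hΔm (fun i => (hD i).1)
        (fun i => hD.indepFun i (hg i) (G := fun j x => min (g j x) 1)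
          (fun j => by have := hg j; fun_prop)) hz hδ0.le hc0 hc1 hκ hS
    · rw [abs_of_nonpos hz]
      have h1 := h.summands.neg.measure_random_interval_le hΔm (fun i => (hD i).1)
        (fun i => hD.indepFun i (hg i).neg (G := fun j x => min (-g j x) 1)
          (fun j => by have := hg j; fun_prop)) (neg_nonneg.2 hz) hδ0.le hc0 hc1
          (by simpa only [abs_neg] using hκ) (S := S)
          (by simp only [Finset.sum_neg_distrib]; exact hS)
      have e1 : ∀ ω i, |∑ j, -g j (X j ω) - -g i (X i ω)| = |statW X g ω - g i (X i ω)| := by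
        intro ω i
        rw [← abs_neg, Finset.sum_neg_distrib]
        congr 1
        unfold statW
        ring
      have e2 : ∀ i, eLpNorm (fun ω => -g i (X i ω)) 2 P = eLpNorm (fun ω => g i (X i ω)) 2 P :=
        fun i => eLpNorm_neg (fun ω => g i (X i ω)) 2 P
      simp only [abs_neg, e1, e2] at h1
      exact h1
  -- If T ≤ z < W then z ≤ W ≤ z + |Δ|; if W ≤ z < T then z - |Δ| ≤ W ≤ z. Negation exchanges the
  -- two sides.
  refine ofReal_abs_measureReal_sub_le ?_ ?_
  · rcases le_total 0 z with hz | hz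
    · refine main 0 _ le_rfl zero_le_one (Or.inl ⟨hz, fun ω hω => ?_⟩)
      have h1 : statT X T ω ≤ z := hω.1
      have h2 : z < statW X g ω := not_le.1 hω.2
      have := neg_abs_le (statDelta X g T ω)
      have := hΔ ω
      constructor <;> linarith
    · refine main 1 _ zero_le_one le_rfl (Or.inr ⟨hz, fun ω hω => ?_⟩)
      have h1 : statT X T ω ≤ z := hω.1
      have h2 : z < statW X g ω := not_le.1 hω.2
      have := neg_abs_le (statDelta X g T ω)
      have := hΔ ω
      constructor <;> linarith
  · rcases le_total 0 z with hz | hz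
    · refine main 1 _ zero_le_one le_rfl (Or.inl ⟨hz, fun ω hω => ?_⟩)
      have h1 : statW X g ω ≤ z := hω.1
      have h2 : z < statT X T ω := not_le.1 hω.2
      have := le_abs_self (statDelta X g T ω)
      have := hΔ ω
      constructor <;> linarith
    · refine main 0 _ le_rfl zero_le_one (Or.inr ⟨hz, fun ω hω => ?_⟩)
      have h1 : statW X g ω ≤ z := hω.1
      have h2 : z < statT X T ω := not_le.1 hω.2
      have := le_abs_self (statDelta X g T ω)
      have := hΔ ω
      constructor <;> linarith

end

/-! ### Gaussian integrals and the Mills function -/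

section SteinEquation

open Set Filter Topology

/-- The unnormalized Gaussian distribution function. -/
noncomputable def gaussInt (w : ℝ) : ℝ := ∫ x in Iic w, Real.exp (-(x ^ 2) / 2)

theorem integrable_exp_neg_sq_half : Integrable (fun x : ℝ => Real.exp (-(x ^ 2) / 2)) := by
  have := integrable_exp_neg_mul_sq (b := 1 / 2) (by norm_num)
  refine this.congr (Eventually.of_forall fun x => ?_)
  simp only
  congr 1; ring

theorem integrable_mul_exp_neg_sq_half : Integrable (fun x : ℝ => x * Real.exp (-(x ^ 2) / 2)) := by
  have := integrable_mul_exp_neg_mul_sq (b := 1 / 2) (by norm_num)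
  refine this.congr (Eventually.of_forall fun x => ?_)
  simp only
  congr 2; ring

theorem integrable_sq_mul_exp_neg_sq_half :
    Integrable (fun x : ℝ => x ^ 2 * Real.exp (-(x ^ 2) / 2)) := by
  have := integrable_rpow_mul_exp_neg_mul_sq (b := 1 / 2) (by norm_num) (s := 2) (by norm_num)
  refine this.congr (Eventually.of_forall fun x => ?_)
  simp only [Real.rpow_ofNat]
  congr 2; ring

theorem hasDerivAt_exp_neg_sq_half (x : ℝ) :
    HasDerivAt (fun x : ℝ => Real.exp (-(x ^ 2) / 2)) (-x * Real.exp (-(x ^ 2) / 2)) x := by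
  have := (((hasDerivAt_pow 2 x).fun_neg).div_const 2).exp
  refine this.congr_deriv ?_
  push_cast; ring

theorem tendsto_exp_neg_sq_half_atBot :
    Tendsto (fun x : ℝ => Real.exp (-(x ^ 2) / 2)) atBot (𝓝 0) := by
  refine Real.tendsto_exp_atBot.comp ?_
  have : Tendsto (fun x : ℝ => x ^ 2 / 2) atBot atTop :=
    (Filter.Tendsto.atTop_div_const (by norm_num) (by
      simpa [pow_two] using tendsto_id.atBot_mul_atBot₀ tendsto_id))
  refine (tendsto_neg_atTop_atBot.comp this).congr fun x => ?_
  simp only [Function.comp]; ring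

theorem integral_Iic_mul_exp_neg_sq_half (w : ℝ) :
    ∫ x in Iic w, x * Real.exp (-(x ^ 2) / 2) = -Real.exp (-(w ^ 2) / 2) := by
  have h := integral_Iic_of_hasDerivAt_of_tendsto' (a := w) (m := 0)
    (f := fun x : ℝ => -Real.exp (-(x ^ 2) / 2)) (f' := fun x => x * Real.exp (-(x ^ 2) / 2))
    (fun x _ =>
      (hasDerivAt_exp_neg_sq_half x).fun_neg.congr_deriv (by ring))
    integrable_mul_exp_neg_sq_half.integrableOn
    (by simpa using tendsto_exp_neg_sq_half_atBot.neg)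
  simpa using h

theorem hasDerivAt_gaussInt (w : ℝ) : HasDerivAt gaussInt (Real.exp (-(w ^ 2) / 2)) w := by
  have hc : Continuous (fun x : ℝ => Real.exp (-(x ^ 2) / 2)) := by fun_prop
  have h := (intervalIntegral.integral_hasDerivAt_right
    (hc.intervalIntegrable 0 w) (hc.stronglyMeasurableAtFilter _ _) hc.continuousAt).const_add
    (gaussInt 0)
  refine h.congr_of_eventuallyEq (Eventually.of_forall fun x => ?_)
  simp only [gaussInt]
  rw [← intervalIntegral.integral_Iic_sub_Iic integrable_exp_neg_sq_half.integrableOn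
    integrable_exp_neg_sq_half.integrableOn]
  ring

theorem gaussInt_nonneg (w : ℝ) : 0 ≤ gaussInt w :=
  integral_nonneg fun _ => (Real.exp_pos _).le

theorem integral_exp_neg_sq_half : ∫ x : ℝ, Real.exp (-(x ^ 2) / 2) = √(2 * Real.pi) := by
  have := integral_gaussian (1 / 2)
  rw [show Real.pi / (1 / 2) = 2 * Real.pi by ring] at this
  rw [← this]
  congr 1
  funext x
  congr 1; ring

theorem gaussInt_add_neg (w : ℝ) : gaussInt w + gaussInt (-w) = √(2 * Real.pi) := by
  have h1 : gaussInt (-w) = ∫ x in Ioi w, Real.exp (-(x ^ 2) / 2) := by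
    have := integral_comp_neg_Ioi w (fun x : ℝ => Real.exp (-(x ^ 2) / 2))
    simp only [neg_sq] at this
    rw [this, gaussInt]
  rw [h1, gaussInt, ← integral_exp_neg_sq_half, ← compl_Iic]
  exact integral_add_compl measurableSet_Iic integrable_exp_neg_sq_half

theorem cdf_gaussianReal_eq (z : ℝ) :
    cdf (gaussianReal 0 1) z = gaussInt z / √(2 * Real.pi) := by
  rw [cdf_eq_real, Measure.real, gaussianReal_apply_eq_integral 0 (by norm_num),
    ENNReal.toReal_ofReal (setIntegral_nonneg measurableSet_Iic fun _ _ =>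
      gaussianPDFReal_nonneg _ _ _), gaussInt, div_eq_inv_mul, ← integral_const_mul]
  congr 1
  funext x
  simp [gaussianPDFReal]

theorem sqrt_two_pi_le : √(2 * Real.pi) ≤ 3 :=
  Real.sqrt_le_iff.2 ⟨by norm_num, by linarith [Real.pi_lt_d2]⟩

theorem one_le_sqrt_two_pi : 1 ≤ √(2 * Real.pi) :=
  Real.one_le_sqrt.2 (by linarith [Real.pi_gt_three])

/-- The Mills-type function `e^{w²/2} ∫_{x ≤ w} e^{-x²/2}`. -/
noncomputable def millsFun (w : ℝ) : ℝ := Real.exp (w ^ 2 / 2) * gaussInt w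

/-- The derivative of `millsFun`. -/
noncomputable def millsFun' (w : ℝ) : ℝ := w * millsFun w + 1

/-- The second derivative of `millsFun`. -/
noncomputable def millsFun'' (w : ℝ) : ℝ := millsFun w + w * millsFun' w

theorem exp_sq_half_mul (w : ℝ) : Real.exp (w ^ 2 / 2) * Real.exp (-(w ^ 2) / 2) = 1 := by
  rw [← Real.exp_add]; ring_nf; exact Real.exp_zero

theorem hasDerivAt_millsFun (w : ℝ) : HasDerivAt millsFun (millsFun' w) w := by
  have h1 := (((hasDerivAt_pow 2 w).div_const 2).exp).fun_mul (hasDerivAt_gaussInt w)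
  refine h1.congr_deriv ?_
  rw [exp_sq_half_mul, millsFun', millsFun]
  push_cast; ring

theorem hasDerivAt_millsFun' (w : ℝ) : HasDerivAt millsFun' (millsFun'' w) w := by
  have h1 := ((hasDerivAt_id w).fun_mul (hasDerivAt_millsFun w)).add_const 1
  refine h1.congr_deriv ?_
  simp [millsFun'']

theorem millsFun_nonneg (w : ℝ) : 0 ≤ millsFun w :=
  mul_nonneg (Real.exp_pos _).le (gaussInt_nonneg w)

/-- On x ≤ w one has w e^{-x²/2} ≥ x e^{-x²/2}, and the right side integrates to -e^{-w²/2}. -/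
theorem millsFun'_nonneg (w : ℝ) : 0 ≤ millsFun' w := by
  have h1 : -Real.exp (-(w ^ 2) / 2) ≤ w * gaussInt w := by
    rw [← integral_Iic_mul_exp_neg_sq_half, gaussInt, ← integral_const_mul]
    refine setIntegral_mono_on integrable_mul_exp_neg_sq_half.integrableOn
      (integrable_exp_neg_sq_half.const_mul w).integrableOn measurableSet_Iic fun x hx => ?_
    exact mul_le_mul_of_nonneg_right hx (Real.exp_pos _).le
  have h2 := mul_le_mul_of_nonneg_left h1 (Real.exp_pos (w ^ 2 / 2)).le
  rw [mul_neg, exp_sq_half_mul] at h2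
  unfold millsFun' millsFun
  linarith

theorem integral_Iic_sq_mul_exp_neg_sq_half (w : ℝ) :
    ∫ x in Iic w, x ^ 2 * Real.exp (-(x ^ 2) / 2) =
      gaussInt w - w * Real.exp (-(w ^ 2) / 2) := by
  have hder : ∀ x : ℝ, HasDerivAt (fun x : ℝ => x * Real.exp (-(x ^ 2) / 2))
      (Real.exp (-(x ^ 2) / 2) - x ^ 2 * Real.exp (-(x ^ 2) / 2)) x := fun x => by
    refine ((hasDerivAt_id x).fun_mul (hasDerivAt_exp_neg_sq_half x)).congr_deriv ?_
    simp only [id]; ring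
  have hint : Integrable (fun x : ℝ => Real.exp (-(x ^ 2) / 2) - x ^ 2 * Real.exp (-(x ^ 2) / 2)) :=
    integrable_exp_neg_sq_half.sub integrable_sq_mul_exp_neg_sq_half
  have htend : Tendsto (fun x : ℝ => x * Real.exp (-(x ^ 2) / 2)) atBot (𝓝 0) :=
    tendsto_zero_of_hasDerivAt_of_integrableOn_Iic (a := w) (fun x _ => hder x)
      hint.integrableOn integrable_mul_exp_neg_sq_half.integrableOn
  have h := integral_Iic_of_hasDerivAt_of_tendsto' (a := w) (fun x _ => hder x)
    hint.integrableOn htend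
  rw [integral_sub integrable_exp_neg_sq_half.integrableOn
    integrable_sq_mul_exp_neg_sq_half.integrableOn] at h
  rw [gaussInt]
  linarith

/-- The second derivative is e^{w²/2} times the integral of (x - w)² e^{-x²/2} over x ≤ w. -/
theorem millsFun''_nonneg (w : ℝ) : 0 ≤ millsFun'' w := by
  have h1 : 0 ≤ ∫ x in Iic w, (x - w) ^ 2 * Real.exp (-(x ^ 2) / 2) :=
    integral_nonneg fun x => mul_nonneg (sq_nonneg _) (Real.exp_pos _).le
  have e : ∀ x : ℝ, (x - w) ^ 2 * Real.exp (-(x ^ 2) / 2) = x ^ 2 * Real.exp (-(x ^ 2) / 2) +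
      (w ^ 2 * Real.exp (-(x ^ 2) / 2) - 2 * w * (x * Real.exp (-(x ^ 2) / 2))) := fun x => by ring
  have i1 := integrable_sq_mul_exp_neg_sq_half.integrableOn (s := Iic w)
  have i2 := (integrable_exp_neg_sq_half.const_mul (w ^ 2)).integrableOn (s := Iic w)
  have i3 := (integrable_mul_exp_neg_sq_half.const_mul (2 * w)).integrableOn (s := Iic w)
  have i4 : IntegrableOn (fun x : ℝ => w ^ 2 * Real.exp (-(x ^ 2) / 2) -
    2 * w * (x * Real.exp (-(x ^ 2) / 2))) (Iic w) := i2.sub i3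
  simp only [e] at h1
  rw [integral_add i1 i4, integral_sub i2 i3, integral_const_mul, integral_const_mul,
    integral_Iic_mul_exp_neg_sq_half, integral_Iic_sq_mul_exp_neg_sq_half] at h1
  have h2 := mul_nonneg (Real.exp_pos (w ^ 2 / 2)).le h1
  have e2 := exp_sq_half_mul w
  have e3 : Real.exp (w ^ 2 / 2) * (gaussInt w - w * Real.exp (-(w ^ 2) / 2) +
      (w ^ 2 * (∫ x in Iic w, Real.exp (-(x ^ 2) / 2)) - 2 * w * -Real.exp (-(w ^ 2) / 2))) =
      (1 + w ^ 2) * (Real.exp (w ^ 2 / 2) * gaussInt w) +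
      w * (Real.exp (w ^ 2 / 2) * Real.exp (-(w ^ 2) / 2)) := by
    rw [← gaussInt]; ring
  rw [e3, e2] at h2
  unfold millsFun'' millsFun' millsFun
  nlinarith

theorem millsFun_le_of_nonpos {w : ℝ} (hw : w ≤ 0) : millsFun w ≤ 2 := by
  have hm : Monotone millsFun := monotone_of_deriv_nonneg
    (fun w => (hasDerivAt_millsFun w).differentiableAt)
    (fun w => by rw [(hasDerivAt_millsFun w).deriv]; exact millsFun'_nonneg w)
  refine (hm hw).trans ?_
  have := gaussInt_add_neg 0
  rw [neg_zero] at this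
  simp only [millsFun]
  norm_num
  linarith [sqrt_two_pi_le]

theorem millsFun_bounds_of_nonpos {w : ℝ} (hw : w ≤ 0) :
    millsFun w ≤ 2 ∧ millsFun' w ≤ 2 ∧ millsFun'' w ≤ 2 := by
  have h0 := millsFun_le_of_nonpos hw
  have h1 := millsFun_nonneg w
  have h2 := millsFun'_nonneg w
  refine ⟨h0, ?_, ?_⟩
  · unfold millsFun'; nlinarith
  · unfold millsFun''; nlinarith

theorem gaussInt_le (w : ℝ) : gaussInt w ≤ 3 := by
  linarith [gaussInt_add_neg w, gaussInt_nonneg (-w), sqrt_two_pi_le]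

theorem millsFun_bounds_of_nonneg {w : ℝ} (hw : 0 ≤ w) :
    millsFun w ≤ 4 * (1 + w) ^ 2 * Real.exp (w ^ 2 / 2) ∧
    millsFun' w ≤ 4 * (1 + w) ^ 2 * Real.exp (w ^ 2 / 2) ∧
    millsFun'' w ≤ 4 * (1 + w) ^ 2 * Real.exp (w ^ 2 / 2) := by
  set E := Real.exp (w ^ 2 / 2) with hE
  have hE1 : 1 ≤ E := Real.one_le_exp (by positivity)
  have h0 : millsFun w ≤ 3 * E := by
    rw [millsFun, mul_comm]
    exact mul_le_mul_of_nonneg_right (gaussInt_le w) (by positivity)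
  have h1 : millsFun' w ≤ (3 * w + 1) * E := by
    unfold millsFun'; nlinarith
  have h2 : millsFun'' w ≤ (3 + w * (3 * w + 1)) * E := by
    unfold millsFun''; nlinarith
  refine ⟨h0.trans ?_, h1.trans ?_, h2.trans ?_⟩ <;>
    exact mul_le_mul_of_nonneg_right (by nlinarith) (by linarith)

theorem one_sub_cdf_gaussianReal (z : ℝ) :
    1 - cdf (gaussianReal 0 1) z = gaussInt (-z) / √(2 * Real.pi) := by
  have h0 := one_le_sqrt_two_pi
  rw [cdf_gaussianReal_eq, ← gaussInt_add_neg z]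
  rw [← gaussInt_add_neg z] at h0
  field_simp
  ring

theorem one_sub_cdf_gaussianReal_le {z : ℝ} (hz : 0 ≤ z) :
    1 - cdf (gaussianReal 0 1) z ≤ 2 * Real.exp (-(z ^ 2) / 2) := by
  rw [one_sub_cdf_gaussianReal]
  have h1 := millsFun_le_of_nonpos (neg_nonpos.2 hz)
  have h2 : gaussInt (-z) = Real.exp (-(z ^ 2) / 2) * millsFun (-z) := by
    rw [millsFun, neg_sq, ← mul_assoc, mul_comm (Real.exp (-(z ^ 2) / 2)), exp_sq_half_mul, one_mul]
  rw [h2]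
  refine (div_le_self (mul_nonneg (Real.exp_pos _).le (millsFun_nonneg _))
    one_le_sqrt_two_pi).trans ?_
  nlinarith [Real.exp_pos (-(z ^ 2) / 2)]

end SteinEquation

/-! ### The solution of Stein's equation -/

section SteinSolution

open Set

/-- The mean value inequality for two differentiable branches glued continuously at `z`, where the
derivative may jump. -/
theorem abs_ite_sub_le {φ₁ φ₂ φ₁' φ₂' : ℝ → ℝ} {z C a b : ℝ}
    (h₁ : ∀ x, HasDerivAt φ₁ (φ₁' x) x) (h₂ : ∀ x, HasDerivAt φ₂ (φ₂' x) x) (hz : φ₁ z = φ₂ z)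
    (b₁ : ∀ x ∈ uIcc a b, x ≤ z → |φ₁' x| ≤ C) (b₂ : ∀ x ∈ uIcc a b, z ≤ x → |φ₂' x| ≤ C) :
    |(if b ≤ z then φ₁ b else φ₂ b) - (if a ≤ z then φ₁ a else φ₂ a)| ≤ C * |b - a| := by
  wlog hab : a ≤ b generalizing a b
  · rw [abs_sub_comm, abs_sub_comm b a]
    rw [uIcc_comm] at b₁ b₂
    exact this b₁ b₂ (le_of_not_ge hab)
  rw [uIcc_of_le hab] at b₁ b₂
  have k₁ : ∀ u v, a ≤ u → u ≤ v → v ≤ b → v ≤ z → |φ₁ v - φ₁ u| ≤ C * (v - u) := by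
    intro u v hu huv hv hvz
    have := Convex.norm_image_sub_le_of_norm_hasDerivWithin_le (s := Icc u v)
      (fun x _ => (h₁ x).hasDerivWithinAt)
      (fun x hx => b₁ x ⟨hu.trans hx.1, hx.2.trans hv⟩ (hx.2.trans hvz)) (convex_Icc u v)
      (left_mem_Icc.2 huv) (right_mem_Icc.2 huv)
    simpa [abs_of_nonneg (sub_nonneg.2 huv)] using this
  have k₂ : ∀ u v, a ≤ u → u ≤ v → v ≤ b → z ≤ u → |φ₂ v - φ₂ u| ≤ C * (v - u) := by
    intro u v hu huv hv hvz
    have := Convex.norm_image_sub_le_of_norm_hasDerivWithin_le (s := Icc u v)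
      (fun x _ => (h₂ x).hasDerivWithinAt)
      (fun x hx => b₂ x ⟨hu.trans hx.1, hx.2.trans hv⟩ (hvz.trans hx.1)) (convex_Icc u v)
      (left_mem_Icc.2 huv) (right_mem_Icc.2 huv)
    simpa [abs_of_nonneg (sub_nonneg.2 huv)] using this
  rw [abs_of_nonneg (sub_nonneg.2 hab)]
  rcases le_total b z with hb | hb
  · rw [if_pos hb, if_pos (hab.trans hb)]
    exact k₁ a b le_rfl hab le_rfl hb
  have eb : (if b ≤ z then φ₁ b else φ₂ b) = φ₂ b := by
    split_ifs with hb'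
    · rw [le_antisymm hb' hb, hz]
    · rfl
  rw [eb]
  rcases le_total a z with ha | ha
  · rw [if_pos ha]
    have e1 := k₁ a z le_rfl ha hb le_rfl
    have e2 := k₂ z b ha hb le_rfl le_rfl
    rw [show φ₂ b - φ₁ a = (φ₂ b - φ₂ z) + (φ₁ z - φ₁ a) by rw [hz]; ring]
    refine (abs_add_le _ _).trans ?_
    linarith
  · have ea : (if a ≤ z then φ₁ a else φ₂ a) = φ₂ a := by
      split_ifs with ha'
      · rw [le_antisymm ha' ha, hz]
      · rfl
    rw [ea]
    exact k₂ a b le_rfl hab le_rfl ha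

/-- With d = z - w one has (z² - w²)/2 ≥ d²/2 ≥ d - 1/2. Gaussian growth is traded for exponential
growth, which can be integrated against sums of bounded summands. -/
theorem exp_sq_sub_le {w z : ℝ} (hw : 0 ≤ w) (hwz : w ≤ z) :
    Real.exp (w ^ 2 / 2) * Real.exp (-(z ^ 2) / 2) ≤ 2 * (Real.exp (-z) * Real.exp w) := by
  have h2 : Real.exp (1 / 2) ≤ 2 := by
    have h := Real.exp_one_lt_d9
    have h1 : Real.exp (1 / 2) * Real.exp (1 / 2) = Real.exp 1 := by rw [← Real.exp_add]; norm_num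
    nlinarith [Real.exp_pos (1 / 2)]
  calc Real.exp (w ^ 2 / 2) * Real.exp (-(z ^ 2) / 2)
      ≤ Real.exp (1 / 2) * (Real.exp (-z) * Real.exp w) := by
        rw [← Real.exp_add, ← Real.exp_add, ← Real.exp_add, Real.exp_le_exp]
        nlinarith [sq_nonneg (z - w - 1)]
    _ ≤ _ := mul_le_mul_of_nonneg_right h2 (by positivity)

/-- The growth bound for the solution of Stein's equation at level `z`. -/
noncomputable def steinBound (z w : ℝ) : ℝ := 16 * (1 + z) ^ 2 * Real.exp (-z) * (1 + Real.exp w)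

theorem steinBound_nonneg (z w : ℝ) : 0 ≤ steinBound z w := by
  unfold steinBound; positivity

theorem steinBound_mono (z : ℝ) : Monotone (steinBound z) := fun a b hab => by
  unfold steinBound
  gcongr

theorem one_sub_cdf_mul_millsFun_le {z w : ℝ} (hz : 0 ≤ z) (hw : w ≤ z) :
    (1 - cdf (gaussianReal 0 1) z) * millsFun w ≤ steinBound z w ∧
    (1 - cdf (gaussianReal 0 1) z) * millsFun' w ≤ steinBound z w ∧
    (1 - cdf (gaussianReal 0 1) z) * millsFun'' w ≤ steinBound z w := by
  have h0 := one_sub_cdf_gaussianReal_le hz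
  have h1 : 0 ≤ 1 - cdf (gaussianReal 0 1) z := by linarith [cdf_le_one (gaussianReal 0 1) z]
  have hp : 0 < Real.exp (-(z ^ 2) / 2) := Real.exp_pos _
  have key : ∀ r, 0 ≤ r → (w ≤ 0 → r ≤ 2) →
      (0 ≤ w → r ≤ 4 * (1 + w) ^ 2 * Real.exp (w ^ 2 / 2)) →
      (1 - cdf (gaussianReal 0 1) z) * r ≤ steinBound z w := by
    intro r hr ha hb
    rcases le_total w 0 with h | h
    · have e1 := exp_sq_sub_le le_rfl hz
      simp only [ne_eq, OfNat.ofNat_ne_zero, not_false_eq_true, zero_pow, zero_div, Real.exp_zero,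
        one_mul, mul_one] at e1
      have hzz : 1 ≤ (1 + z) ^ 2 := by nlinarith
      have hE := Real.exp_pos (-z)
      calc (1 - cdf (gaussianReal 0 1) z) * r ≤ (2 * Real.exp (-(z ^ 2) / 2)) * 2 :=
            mul_le_mul h0 (ha h) hr (by positivity)
        _ ≤ 16 * 1 * Real.exp (-z) * (1 + 0) := by linarith
        _ ≤ steinBound z w := by
            unfold steinBound
            gcongr
            exact (Real.exp_pos _).le
    · calc (1 - cdf (gaussianReal 0 1) z) * r
          ≤ (2 * Real.exp (-(z ^ 2) / 2)) * (4 * (1 + w) ^ 2 * Real.exp (w ^ 2 / 2)) :=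
            mul_le_mul h0 (hb h) hr (by positivity)
        _ = 8 * (1 + w) ^ 2 * (Real.exp (w ^ 2 / 2) * Real.exp (-(z ^ 2) / 2)) := by ring
        _ ≤ 8 * (1 + z) ^ 2 * (2 * (Real.exp (-z) * Real.exp w)) := by
            have := exp_sq_sub_le h hw
            gcongr
        _ ≤ steinBound z w := by
            unfold steinBound
            nlinarith [mul_nonneg (sq_nonneg (1 + z)) (Real.exp_pos (-z)).le]
  refine ⟨key _ (millsFun_nonneg w) (fun h => (millsFun_bounds_of_nonpos h).1)
    (fun h => (millsFun_bounds_of_nonneg h).1),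
    key _ (millsFun'_nonneg w) (fun h => (millsFun_bounds_of_nonpos h).2.1)
    (fun h => (millsFun_bounds_of_nonneg h).2.1),
    key _ (millsFun''_nonneg w) (fun h => (millsFun_bounds_of_nonpos h).2.2)
    (fun h => (millsFun_bounds_of_nonneg h).2.2)⟩

theorem cdf_mul_millsFun_neg_le {z w : ℝ} (hz : 0 ≤ z) (hw : z ≤ w) :
    cdf (gaussianReal 0 1) z * millsFun (-w) ≤ steinBound z w ∧
    cdf (gaussianReal 0 1) z * millsFun' (-w) ≤ steinBound z w ∧
    cdf (gaussianReal 0 1) z * millsFun'' (-w) ≤ steinBound z w := by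
  have h0 := cdf_nonneg (gaussianReal 0 1) z
  have h1 := cdf_le_one (gaussianReal 0 1) z
  have e : 1 ≤ Real.exp (-z) * Real.exp w := by
    rw [← Real.exp_add]; exact Real.one_le_exp (by linarith)
  have hb : 2 ≤ steinBound z w := by
    unfold steinBound
    have hzz : 1 ≤ (1 + z) ^ 2 := by nlinarith
    nlinarith [Real.exp_pos (-z), mul_le_mul hzz e zero_le_one (by positivity),
      mul_nonneg (sq_nonneg (1 + z)) (Real.exp_pos (-z)).le]
  obtain ⟨m0, m1, m2⟩ := millsFun_bounds_of_nonpos (w := -w) (by linarith)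
  exact ⟨(mul_le_of_le_one_left (millsFun_nonneg _) h1).trans (m0.trans hb),
    (mul_le_of_le_one_left (millsFun'_nonneg _) h1).trans (m1.trans hb),
    (mul_le_of_le_one_left (millsFun''_nonneg _) h1).trans (m2.trans hb)⟩

theorem one_sub_cdf_mul_millsFun_self (z : ℝ) :
    (1 - cdf (gaussianReal 0 1) z) * millsFun z = cdf (gaussianReal 0 1) z * millsFun (-z) := by
  rw [one_sub_cdf_gaussianReal, cdf_gaussianReal_eq, millsFun, millsFun, neg_sq]
  ring

/-- Existence of a solution of Stein's equation for the indicator of a half line, with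
exponentially decaying bounds. -/
theorem exists_stein_solution {z : ℝ} (hz : 0 ≤ z) {S : Set ℝ} (hS : MeasurableSet S)
    (hS1 : Iio z ⊆ S) (hS2 : S ⊆ Iic z) :
    ∃ f F : ℝ → ℝ, Measurable f ∧ Measurable F ∧
      (∀ w, F w - w * f w = S.indicator 1 w - cdf (gaussianReal 0 1) z) ∧
      (∀ w, |f w| ≤ steinBound z w) ∧ (∀ w, |F w| ≤ steinBound z w) ∧
      (∀ r s, |s| ≤ 1 → |f (r + s) - f r - s * F r| ≤
        |s| * (|s| * steinBound z (r + 1) + {x | |x - z| ≤ |s|}.indicator 1 r)) ∧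
      (∀ r s, |s| ≤ 1 → |F (r + s) - F r| ≤
        |s| * steinBound z (r + 1) + {x | |x - z| ≤ |s|}.indicator 1 r) := by
  set a := 1 - cdf (gaussianReal 0 1) z with ha
  set b := cdf (gaussianReal 0 1) z with hb
  have hself : a * millsFun z = b * millsFun (-z) := one_sub_cdf_mul_millsFun_self z
  -- The derivative of the solution jumps by 1 at `z`; once the indicator is subtracted, its two
  -- branches agree there.
  have hself' : a * millsFun' z - 1 = -(b * millsFun' (-z)) := by
    unfold millsFun'
    have : z * (a * millsFun z) = z * (b * millsFun (-z)) := by rw [hself]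
    linarith
  have ha0 : 0 ≤ a := by linarith [cdf_le_one (gaussianReal 0 1) z]
  have hb0 : 0 ≤ b := cdf_nonneg _ _
  have d1 : ∀ x, HasDerivAt (fun x => a * millsFun x) (a * millsFun' x) x :=
    fun x => (hasDerivAt_millsFun x).const_mul a
  have d1' : ∀ x, HasDerivAt (fun x => a * millsFun' x - 1) (a * millsFun'' x) x :=
    fun x => ((hasDerivAt_millsFun' x).const_mul a).sub_const 1
  have d2 : ∀ x, HasDerivAt (fun x => b * millsFun (-x)) (-(b * millsFun' (-x))) x := fun x =>
    (((hasDerivAt_millsFun (-x)).comp x (hasDerivAt_neg x)).const_mul b).congr_deriv (by ring)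
  have d2' : ∀ x, HasDerivAt (fun x => -(b * millsFun' (-x))) (b * millsFun'' (-x)) x := fun x =>
    ((((hasDerivAt_millsFun' (-x)).comp x (hasDerivAt_neg x)).const_mul b).fun_neg).congr_deriv
      (by ring)
  set f : ℝ → ℝ := fun w => if w ≤ z then a * millsFun w else b * millsFun (-w) with hf
  -- `H` is the derivative of the solution minus the indicator of `S`. It is continuous, equals w
  -- f(w) - Φ(z), and is locally Lipschitz through the second derivative of the Mills function.
  set H : ℝ → ℝ := fun w => if w ≤ z then a * millsFun' w - 1 else -(b * millsFun' (-w)) with hH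
  have meas : ∀ {φ₁ φ₂ φ₁' φ₂' : ℝ → ℝ}, (∀ x, HasDerivAt φ₁ (φ₁' x) x) →
      (∀ x, HasDerivAt φ₂ (φ₂' x) x) → Measurable (fun w => if w ≤ z then φ₁ w else φ₂ w) := by
    intro φ₁ φ₂ φ₁' φ₂' h₁ h₂
    refine Measurable.ite measurableSet_Iic ?_ ?_
    · exact (continuous_iff_continuousAt.2 fun x => (h₁ x).continuousAt).measurable
    · exact (continuous_iff_continuousAt.2 fun x => (h₂ x).continuousAt).measurable
  have hHlip : ∀ r s, |s| ≤ 1 → |H (r + s) - H r| ≤ |s| * steinBound z (r + 1) := by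
    intro r s hs
    have hle : ∀ x ∈ uIcc r (r + s), x ≤ r + 1 := fun x hx => by
      rw [mem_uIcc] at hx
      have := abs_le.1 hs
      rcases hx with h | h <;> linarith
    have := abs_ite_sub_le (a := r) (b := r + s) (C := steinBound z (r + 1)) d1' d2' hself'
      (fun x hx hxz => by
        rw [abs_of_nonneg (mul_nonneg ha0 (millsFun''_nonneg x))]
        exact (one_sub_cdf_mul_millsFun_le hz hxz).2.2.trans (steinBound_mono z (hle x hx)))
      (fun x hx hxz => by
        rw [abs_of_nonneg (mul_nonneg hb0 (millsFun''_nonneg _))]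
        exact (cdf_mul_millsFun_neg_le hz hxz).2.2.trans (steinBound_mono z (hle x hx)))
    rw [add_sub_cancel_left] at this
    exact this.trans_eq (mul_comm _ _)
  have hmem : ∀ w, w < z → w ∈ S := fun w hw => hS1 hw
  have hnmem : ∀ w, z < w → w ∉ S := fun w hw h => absurd (hS2 h) (not_le.2 hw)
  have hind : ∀ r s, |S.indicator (1 : ℝ → ℝ) (r + s) - S.indicator 1 r| ≤
      {x | |x - z| ≤ |s|}.indicator 1 r := by
    intro r s
    by_cases hr : |r - z| ≤ |s|
    · rw [indicator_of_mem (s := {x | |x - z| ≤ |s|}) hr]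
      by_cases h1 : r + s ∈ S <;> by_cases h2 : r ∈ S <;> simp [h1, h2]
    · rw [indicator_of_notMem (s := {x | |x - z| ≤ |s|}) hr]
      rw [not_le] at hr
      have hs := neg_abs_le s
      have hs' := le_abs_self s
      rcases lt_abs.1 hr with h | h
      · simp [hnmem r (by linarith [abs_nonneg s]), hnmem (r + s) (by linarith)]
      · simp [hmem r (by linarith [abs_nonneg s]), hmem (r + s) (by linarith)]
  -- The function min(·, z) is an antiderivative of the indicator, so it carries the irregular part
  -- of f; linearizing it fails only when r is within |s| of z.
  have hmin : ∀ r s, |min (r + s) z - min r z - s * S.indicator 1 r| ≤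
      |s| * {x | |x - z| ≤ |s|}.indicator 1 r := by
    intro r s
    by_cases hr : |r - z| ≤ |s|
    · rw [indicator_of_mem (s := {x | |x - z| ≤ |s|}) hr]
      have e1 : min r z ≤ max (min (r + s) z) (min (r + s) z - s) := by
        rcases le_total (r + s) z with h | h
        · rw [min_eq_left h]
          exact le_max_of_le_right (by linarith [min_le_left r z])
        · rw [min_eq_right h]
          exact le_max_of_le_left (min_le_right _ _)
      have e2 : min (r + s) z ≤ max (min r z) (min r z + s) := by
        rcases le_total r z with h | h
        · rw [min_eq_left h]
          exact le_max_of_le_right (min_le_left _ _)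
        · rw [min_eq_right h]
          exact le_max_of_le_left (min_le_right _ _)
      have hs := neg_abs_le s
      have hs' := le_abs_self s
      have e3 : ∀ x y : ℝ, 0 ≤ s → x ≤ max y (y - s) → x ≤ y := fun x y h0 hm =>
        hm.trans (max_le le_rfl (by linarith))
      have e4 : ∀ x y : ℝ, s ≤ 0 → x ≤ max y (y + s) → x ≤ y := fun x y h0 hm =>
        hm.trans (max_le le_rfl (by linarith))
      have e5 : ∀ x y : ℝ, 0 ≤ s → x ≤ max y (y + s) → x ≤ y + s := fun x y h0 hm =>
        hm.trans (max_le (by linarith) le_rfl)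
      have e6 : ∀ x y : ℝ, s ≤ 0 → x ≤ max y (y - s) → x ≤ y - s := fun x y h0 hm =>
        hm.trans (max_le (by linarith) le_rfl)
      simp only [Pi.one_apply, mul_one]
      rcases le_total 0 s with h0 | h0
      · have a1 := e3 _ _ h0 e1
        have a2 := e5 _ _ h0 e2
        rw [abs_of_nonneg h0]
        by_cases h2 : r ∈ S
        · simp only [h2, indicator_of_mem, Pi.one_apply, mul_one]
          rw [abs_le]; constructor <;> linarith
        · simp only [h2, not_false_eq_true, indicator_of_notMem, mul_zero]
          rw [abs_le]; constructor <;> linarith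
      · have a1 := e6 _ _ h0 e1
        have a2 := e4 _ _ h0 e2
        rw [abs_of_nonpos h0]
        by_cases h2 : r ∈ S
        · simp only [h2, indicator_of_mem, Pi.one_apply, mul_one]
          rw [abs_le]; constructor <;> linarith
        · simp only [h2, not_false_eq_true, indicator_of_notMem, mul_zero]
          rw [abs_le]; constructor <;> linarith
    · rw [indicator_of_notMem (s := {x | |x - z| ≤ |s|}) hr]
      rw [not_le] at hr
      have hs := neg_abs_le s
      have hs' := le_abs_self s
      rcases lt_abs.1 hr with h | h
      · rw [min_eq_right (by linarith), min_eq_right (by linarith [abs_nonneg s])]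
        simp [hnmem r (by linarith [abs_nonneg s])]
      · rw [min_eq_left (by linarith), min_eq_left (by linarith [abs_nonneg s])]
        simp [hmem r (by linarith [abs_nonneg s])]
  have hHval : ∀ w, H w = w * f w - b := by
    intro w
    simp only [hH, hf]
    split_ifs
    · unfold millsFun'; rw [ha]; ring
    · unfold millsFun'; ring
  -- The value of `F` at z depends on whether z ∈ `S`. This keeps Stein's equation exact for both
  -- the open and the closed half line.
  refine ⟨f, fun w => H w + S.indicator 1 w, meas d1 d2,
    (meas d1' d2').add (measurable_one.indicator hS), fun w => ?_, fun w => ?_, fun w => ?_,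
    fun r s hs => ?_, fun r s hs => ?_⟩
  · simp only [hHval]; ring
  · simp only [hf]
    split_ifs with h
    · rw [abs_of_nonneg (mul_nonneg ha0 (millsFun_nonneg _))]
      exact (one_sub_cdf_mul_millsFun_le hz h).1
    · rw [abs_of_nonneg (mul_nonneg hb0 (millsFun_nonneg _))]
      exact (cdf_mul_millsFun_neg_le hz (not_le.1 h).le).1
  · have hl : w ≤ z → |a * millsFun' w| ≤ steinBound z w := fun h => by
      rw [abs_of_nonneg (mul_nonneg ha0 (millsFun'_nonneg _))]
      exact (one_sub_cdf_mul_millsFun_le hz h).2.1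
    have hr : z ≤ w → |-(b * millsFun' (-w))| ≤ steinBound z w := fun h => by
      rw [abs_neg, abs_of_nonneg (mul_nonneg hb0 (millsFun'_nonneg _))]
      exact (cdf_mul_millsFun_neg_le hz h).2.1
    by_cases hw : w ∈ S
    · have hwz : w ≤ z := hS2 hw
      simpa [hH, hw, hwz] using hl hwz
    · have hwz : z ≤ w := not_lt.1 fun h => hw (hmem w h)
      have : H w = -(b * millsFun' (-w)) := by
        simp only [hH]
        split_ifs with h
        · rw [le_antisymm h hwz, hself']
        · rfl
      simpa [hw, this] using hr hwz
  -- The regular part f - min(·, z) has derivative `H`; after removal of the slope H(r), its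
  -- derivative is bounded by the Lipschitz estimate for `H`.
  · have hg := abs_ite_sub_le (a := r) (b := r + s) (C := |s| * steinBound z (r + 1)) (z := z)
      (φ₁ := fun x => a * millsFun x - x - x * H r) (φ₂ := fun x => b * millsFun (-x) - z - x * H r)
      (φ₁' := fun x => a * millsFun' x - 1 - 1 * H r)
      (φ₂' := fun x => -(b * millsFun' (-x)) - 1 * H r)
      (fun x => ((d1 x).sub (hasDerivAt_id x)).sub ((hasDerivAt_id x).mul_const _))
      (fun x => ((d2 x).sub_const z).sub ((hasDerivAt_id x).mul_const _))
      (by simp only [hself])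
      (fun x hx hxz => ?_) (fun x hx hxz => ?_)
    · have e : ∀ x, (if x ≤ z then a * millsFun x - x - x * H r else
          b * millsFun (-x) - z - x * H r) = f x - min x z - x * H r := fun x => by
        simp only [hf]
        split_ifs with h
        · rw [min_eq_left h]
        · rw [min_eq_right (not_le.1 h).le]
      rw [e, e, add_sub_cancel_left] at hg
      have hm := hmin r s
      rw [show f (r + s) - f r - s * (H r + S.indicator 1 r) =
        (f (r + s) - min (r + s) z - (r + s) * H r - (f r - min r z - r * H r)) +
        (min (r + s) z - min r z - s * S.indicator 1 r) by ring]
      refine (abs_add_le _ _).trans ?_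
      linarith
    · have hxr : |x - r| ≤ |s| := by
        have := abs_sub_left_of_mem_uIcc hx
        simpa using this
      have := hHlip r (x - r) (hxr.trans hs)
      rw [add_sub_cancel] at this
      simp only [one_mul]
      have e : a * millsFun' x - 1 = H x := by simp only [hH, if_pos hxz]
      rw [e]
      exact this.trans (mul_le_mul_of_nonneg_right hxr (steinBound_nonneg _ _))
    · have hxr : |x - r| ≤ |s| := by
        have := abs_sub_left_of_mem_uIcc hx
        simpa using this
      have := hHlip r (x - r) (hxr.trans hs)
      rw [add_sub_cancel] at this
      simp only [one_mul]
      have e : -(b * millsFun' (-x)) = H x := by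
        simp only [hH]
        split_ifs with h
        · rw [le_antisymm h hxz, hself']
        · rfl
      rw [e]
      exact this.trans (mul_le_mul_of_nonneg_right hxr (steinBound_nonneg _ _))
  · rw [show H (r + s) + S.indicator 1 (r + s) - (H r + S.indicator 1 r) =
      (H (r + s) - H r) + (S.indicator (1 : ℝ → ℝ) (r + s) - S.indicator 1 r) by ring]
    exact (abs_add_le _ _).trans (add_le_add (hHlip r s hs) (hind r s))

end SteinSolution

/-! ### Clipping at level one -/

section Clip

/-- Two-sided truncation at level one. -/
noncomputable def clip (x : ℝ) : ℝ := max (-1) (min x 1)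

@[fun_prop]
theorem measurable_clip : Measurable clip := by unfold clip; fun_prop

theorem clip_zero : clip 0 = 0 := by norm_num [clip]

theorem clip_le_one (x : ℝ) : clip x ≤ 1 := max_le (by norm_num) (min_le_right _ _)

theorem neg_one_le_clip (x : ℝ) : -1 ≤ clip x := le_max_left _ _

theorem abs_clip_le_one (x : ℝ) : |clip x| ≤ 1 := abs_le.2 ⟨neg_one_le_clip x, clip_le_one x⟩

theorem clip_of_abs_le {x : ℝ} (hx : |x| ≤ 1) : clip x = x := by
  obtain ⟨h1, h2⟩ := abs_le.1 hx
  rw [clip, min_eq_left h2, max_eq_right h1]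

theorem abs_clip (x : ℝ) : |clip x| = min |x| 1 := by
  unfold clip
  rcases le_total x 1 with h | h
  · rw [min_eq_left h]
    rcases le_total (-1) x with h' | h'
    · rw [max_eq_right h', min_eq_left (abs_le.2 ⟨h', h⟩)]
    · rw [max_eq_left h', abs_of_nonpos (by linarith), min_eq_right (by rw [abs_of_nonpos] <;> linarith)]
      norm_num
  · rw [min_eq_right h, max_eq_right (by norm_num), min_eq_right (h.trans (le_abs_self x)), abs_one]

theorem mul_clip_nonneg (x : ℝ) : 0 ≤ x * clip x := by
  rcases le_total 0 x with h | h
  · exact mul_nonneg h (le_max_of_le_right (le_min h zero_le_one))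
  · exact mul_nonneg_of_nonpos_of_nonpos h (max_le (by norm_num) (min_le_of_left_le h))

theorem min_abs_clip {δ : ℝ} (hδ : δ ≤ 1) (x : ℝ) : min δ |clip x| = min δ |x| := by
  rw [abs_clip, min_comm |x|, ← min_assoc, min_eq_left hδ]

theorem clip_sq_le (x : ℝ) : clip x ^ 2 ≤ x ^ 2 := by
  rw [sq_le_sq, abs_clip]; exact min_le_left _ _

theorem abs_clip_sub_le_sq (x : ℝ) : |clip x - x| ≤ x ^ 2 := by
  rcases le_or_gt |x| 1 with h | h
  · rw [clip_of_abs_le h, sub_self, abs_zero]; positivity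
  · rw [← sq_abs x]
    unfold clip
    rcases lt_abs.1 h with h' | h'
    · rw [min_eq_right h'.le, max_eq_right (by norm_num), abs_of_neg (by linarith)]
      nlinarith [le_abs_self x]
    · rw [min_eq_left (by linarith), max_eq_left (by linarith), abs_of_pos (by linarith)]
      nlinarith [neg_abs_le x]

theorem le_rpow_of_one_le {x p : ℝ} (hx : 1 ≤ x) (hp : 2 ≤ p) : x ^ 2 ≤ x ^ p := by
  rw [← Real.rpow_two]
  exact Real.rpow_le_rpow_of_exponent_le hx hp

theorem abs_clip_sub_le {p : ℝ} (hp : 2 ≤ p) (x : ℝ) : |clip x - x| ≤ |x| ^ p := by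
  rcases le_or_gt |x| 1 with h | h
  · rw [clip_of_abs_le h, sub_self, abs_zero]; positivity
  · refine (abs_clip_sub_le_sq x).trans ?_
    rw [← sq_abs]
    exact le_rpow_of_one_le h.le hp

theorem sq_sub_clip_sq_le {p : ℝ} (hp : 2 ≤ p) (x : ℝ) : x ^ 2 - clip x ^ 2 ≤ |x| ^ p := by
  rcases le_or_gt |x| 1 with h | h
  · rw [clip_of_abs_le h, sub_self]; positivity
  · have := le_rpow_of_one_le h.le hp
    rw [sq_abs] at this
    nlinarith [sq_nonneg (clip x)]

theorem abs_clip_pow_three_le {p : ℝ} (hp : 2 ≤ p) (hp3 : p ≤ 3) (x : ℝ) :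
    |clip x| ^ 3 ≤ |x| ^ p := by
  rcases le_or_gt |x| 1 with h | h
  · rw [clip_of_abs_le h]
    rcases eq_or_lt_of_le (abs_nonneg x) with h0 | h0
    · rw [← h0]; simp; positivity
    · rw [← Real.rpow_natCast]
      exact Real.rpow_le_rpow_of_exponent_ge h0 h (by simpa using hp3)
  · calc |clip x| ^ 3 ≤ 1 := pow_le_one₀ (abs_nonneg _) (abs_clip_le_one x)
      _ ≤ |x| ^ p := Real.one_le_rpow h.le (by linarith)

end Clip

/-! ### Concentration of clipped sums -/

section ClippedSums

variable {Ω : Type*} [MeasurableSpace Ω] {P : Measure Ω} [IsProbabilityMeasure P]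
variable {ι : Type*} [Fintype ι] [DecidableEq ι] {ξ : ι → Ω → ℝ}

theorem exp_one_half_le_two : Real.exp (1 / 2) ≤ 2 := by
  have h := Real.exp_one_lt_d9
  have h1 : Real.exp (1 / 2) * Real.exp (1 / 2) = Real.exp 1 := by rw [← Real.exp_add]; norm_num
  nlinarith [Real.exp_pos (1 / 2)]

theorem integrable_of_abs_le {f : Ω → ℝ} (hf : Measurable f) {C : ℝ} (hC : ∀ ω, |f ω| ≤ C) :
    Integrable f P :=
  Integrable.of_bound hf.aestronglyMeasurable C (Filter.Eventually.of_forall hC)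

/-- Two-sided clipping may raise the mean, but |clip x - x| ≤ x², so e^{clip x} ≤ 1 + x + 2x² and
the moment is at most e². -/
theorem Summands.integral_exp_sum_clip_le (h : Summands P ξ) :
    ∫ ω, Real.exp (∑ i, clip (ξ i ω)) ∂P ≤ 9 := by
  have h1 := h.integral_exp_sum_le measurable_clip (t := 1) (κ := 2) (by norm_num) fun i => by
    have hm := h.meas i
    have hle : ∀ ω, Real.exp (1 * clip (ξ i ω)) ≤ 1 + ξ i ω + 2 * ξ i ω ^ 2 := fun ω => by
      have e1 := Real.abs_exp_sub_one_sub_id_le (abs_clip_le_one (ξ i ω))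
      have e2 := abs_clip_sub_le_sq (ξ i ω)
      have e3 := clip_sq_le (ξ i ω)
      rw [one_mul]
      linarith [(abs_le.1 e1).2, (abs_le.1 e2).2]
    have i2 : Integrable (fun ω => 2 * ξ i ω ^ 2) P := (h.memLp i).integrable_sq.const_mul 2
    have i1 : Integrable (fun ω => 1 + ξ i ω) P := (integrable_const 1).add (h.integrable i)
    have i3 : Integrable (fun ω => 1 + ξ i ω + 2 * ξ i ω ^ 2) P := i1.add i2
    have := integral_mono (μ := P) (integrable_of_abs_le (C := Real.exp 1) (by fun_prop)
      fun ω => by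
        rw [abs_of_pos (Real.exp_pos _), Real.exp_le_exp, one_mul]
        exact clip_le_one _) i3 hle
    rw [integral_add i1 i2, integral_add (integrable_const 1) (h.integrable i), h.mean i,
      integral_const_mul] at this
    simp only [integral_const, probReal_univ, smul_eq_mul, mul_one, add_zero] at this
    linarith [Real.add_one_le_exp (2 * ∫ ω, ξ i ω ^ 2 ∂P)]
  simp only [one_mul] at h1
  refine h1.trans ?_
  have e := Real.exp_one_lt_d9
  have : Real.exp 2 = Real.exp 1 * Real.exp 1 := by rw [← Real.exp_add]; norm_num
  rw [this]
  nlinarith [Real.exp_pos 1]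

theorem Summands.measure_abs_sum_clip_sub_le (h : Summands P ξ) {δ s : ℝ} (z : ℝ) (hδ : 0 ≤ δ)
    (hδ1 : δ ≤ 1) (hκ : 1 / 4 ≤ ∑ i, ∫ ω, |ξ i ω| * min δ |ξ i ω| ∂P) (hs : 0 ≤ s) (hs1 : s ≤ 1) :
    P.real {ω | |∑ i, clip (ξ i ω) - z| ≤ s} ≤ 72 * Real.exp (-z / 2) * (s + δ) := by
  have hm := h.meas
  have hexp : ∫ ω, Real.exp (2 * (1 / 2) * ∑ j, clip (ξ j ω)) ∂P ≤ 9 := by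
    simpa using h.integral_exp_sum_clip_le
  -- The constant length 2s with `c = 1/2` gives the interval [z - s, z + s], and U = V_i kills the
  -- cross terms. The mean κ = 1/4 leaves room for a family with one summand removed.
  have h1 := h.concentration measurable_clip clip_zero mul_clip_nonneg (θ := 1 / 2) (δ := δ)
    (c := 1 / 2) (z := z) (K := 2 * s) (κ := 1 / 4) (M := 9) (E := Real.exp (1 / 2 * (z - s)))
    (by norm_num) hδ (by norm_num) (by norm_num) (Or.inr clip_le_one) hexp (by norm_num)
    (by simpa only [min_abs_clip hδ1] using hκ)
    (U := fun _ => 2 * s) measurable_const (fun _ => by positivity) (fun _ => le_rfl)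
    (V := fun _ _ => 2 * s) (fun _ => measurable_const) (fun _ _ => by positivity)
    (fun _ _ => le_rfl)
    (fun j => (h.indep_sub measurable_clip clip_zero j).comp (φ := id)
      (ψ := fun r : ℝ => ((2 * s : ℝ), r)) measurable_id (by fun_prop))
    (A := {ω | |∑ i, clip (ξ i ω) - z| ≤ s})
    (measurableSet_le (by fun_prop) measurable_const)
    (fun ω hω => by
      obtain ⟨a, b⟩ := abs_le.1 (show |∑ i, clip (ξ i ω) - z| ≤ s from hω)
      constructor <;> linarith)
    (fun ω hω => by
      obtain ⟨a, b⟩ := abs_le.1 (show |∑ i, clip (ξ i ω) - z| ≤ s from hω)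
      exact Real.exp_le_exp.2 (by linarith))
  have hbd : ∀ ω, ∑ j, clip (ξ j ω) ≤ Fintype.card ι := fun ω =>
    (Finset.sum_le_sum fun j _ => clip_le_one _).trans (by simp)
  have hL : MemLp (fun ω => Real.exp (1 / 2 * ∑ j, clip (ξ j ω))) 2 P :=
    MemLp.of_bound (Measurable.aestronglyMeasurable (by fun_prop))
      (Real.exp (1 / 2 * Fintype.card ι)) (Filter.Eventually.of_forall fun ω => by
        rw [Real.norm_of_nonneg (Real.exp_pos _).le, Real.exp_le_exp]
        linarith [hbd ω])
  have h2 := integral_mul_abs_le_sqrt h.memLp_sum hL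
  have e9 : √(9 : ℝ) = 3 := by
    rw [show (9 : ℝ) = 3 ^ 2 by norm_num]; exact Real.sqrt_sq (by norm_num)
  have h3 : ∫ ω, Real.exp (1 / 2 * ∑ j, clip (ξ j ω)) ^ 2 ∂P ≤ 9 := by
    refine le_trans (le_of_eq ?_) hexp
    congr 1
    funext ω
    rw [← Real.exp_nat_mul]
    congr 1; push_cast; ring
  have h4 : √(∫ ω, (∑ i, ξ i ω) ^ 2 ∂P) ≤ 1 :=
    Real.sqrt_le_one.2 (h.integral_sum_sq.trans_le h.var)
  have h5 : √(∫ ω, Real.exp (1 / 2 * ∑ j, clip (ξ j ω)) ^ 2 ∂P) ≤ 3 := by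
    rw [← e9]; exact Real.sqrt_le_sqrt h3
  have h6 : ∫ ω, |∑ i, ξ i ω| * |Real.exp (1 / 2 * ∑ j, clip (ξ j ω))| ∂P ≤ 3 :=
    h2.trans (by nlinarith [Real.sqrt_nonneg (∫ ω, (∑ i, ξ i ω) ^ 2 ∂P)])
  have h7 : ∫ ω, |∑ j, ξ j ω| * (Real.exp (1 / 2 * ∑ j, clip (ξ j ω)) * (2 * s)) ∂P ≤ 6 * s := by
    have : ∀ ω, |∑ j, ξ j ω| * (Real.exp (1 / 2 * ∑ j, clip (ξ j ω)) * (2 * s)) =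
        2 * s * (|∑ i, ξ i ω| * |Real.exp (1 / 2 * ∑ j, clip (ξ j ω))|) := fun ω => by
      rw [abs_of_pos (Real.exp_pos _)]; ring
    simp only [this, integral_const_mul]
    nlinarith
  simp only [sub_self, abs_zero, mul_zero, integral_zero, Finset.sum_const_zero, add_zero, e9] at h1
  set p := P.real {ω | |∑ i, clip (ξ i ω) - z| ≤ s} with hp
  have hp0 : 0 ≤ p := measureReal_nonneg
  have e1 : Real.exp (-z / 2) * Real.exp (1 / 2) * Real.exp (1 / 2 * (z - s)) =
      Real.exp (1 / 2 * (1 - s)) := by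
    rw [← Real.exp_add, ← Real.exp_add]; congr 1; ring
  have e2 : 1 ≤ Real.exp (1 / 2 * (1 - s)) := Real.one_le_exp (by linarith)
  have e3 : Real.exp (1 / 2 * (z - s)) * p ≤ 36 * (s + δ) := by linarith
  calc p ≤ Real.exp (1 / 2 * (1 - s)) * p := le_mul_of_one_le_left hp0 e2
    _ = Real.exp (-z / 2) * Real.exp (1 / 2) * (Real.exp (1 / 2 * (z - s)) * p) := by
        rw [← e1]; ring
    _ ≤ Real.exp (-z / 2) * 2 * (36 * (s + δ)) := by
        have := exp_one_half_le_two
        gcongr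
    _ = _ := by ring

/-- Fubini's theorem for the product law: the inner integral is bounded with the value of X frozen.
-/
theorem IndepFun.integral_comp_le {X R : Ω → ℝ} (hX : Measurable X) (hR : Measurable R)
    (hI : IndepFun X R P) {ρ : ℝ → ℝ → ℝ} (hρ : Measurable (Function.uncurry ρ))
    {q : ℝ → ℝ} (hq : Measurable q) (hρi : Integrable (fun ω => ρ (X ω) (R ω)) P)
    (hqi : Integrable (fun ω => q (X ω)) P) (hle : ∀ x, ∫ ω, ρ x (R ω) ∂P ≤ q x) :
    ∫ ω, ρ (X ω) (R ω) ∂P ≤ ∫ ω, q (X ω) ∂P := by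
  have hmap := (indepFun_iff_map_prod_eq_prod_map_map hX.aemeasurable hR.aemeasurable).1 hI
  have hXR : Measurable fun ω => (X ω, R ω) := hX.prodMk hR
  have e1 : ∫ ω, ρ (X ω) (R ω) ∂P =
      ∫ v, Function.uncurry ρ v ∂((P.map X).prod (P.map R)) := by
    rw [← hmap, integral_map hXR.aemeasurable hρ.aestronglyMeasurable]
    rfl
  have := Measure.isProbabilityMeasure_map (μ := P) hX.aemeasurable
  have := Measure.isProbabilityMeasure_map (μ := P) hR.aemeasurable
  have hint : Integrable (Function.uncurry ρ) ((P.map X).prod (P.map R)) := by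
    rw [← hmap, integrable_map_measure hρ.aestronglyMeasurable hXR.aemeasurable]
    exact hρi
  rw [e1, integral_prod _ hint, ← integral_map hX.aemeasurable hq.aestronglyMeasurable]
  refine integral_mono hint.integral_prod_left
    ((integrable_map_measure hq.aestronglyMeasurable hX.aemeasurable).2 hqi) fun x => ?_
  have hρx : Measurable (ρ x) := hρ.comp (measurable_const.prodMk measurable_id)
  simp only [Function.uncurry]
  rw [integral_map hR.aemeasurable hρx.aestronglyMeasurable]
  exact hle x

/-- With m = E|Y|, integrate (|Y| + m)(|Y| - m)² ≥ 0. -/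
theorem integral_sq_mul_integral_abs_le {Y : Ω → ℝ} (hY : Measurable Y) (hb : ∀ ω, |Y ω| ≤ 1) :
    (∫ ω, Y ω ^ 2 ∂P) * ∫ ω, |Y ω| ∂P ≤ ∫ ω, |Y ω| ^ 3 ∂P := by
  set m := ∫ ω, |Y ω| ∂P with hm
  have hm0 : 0 ≤ m := integral_nonneg fun _ => abs_nonneg _
  have i1 : Integrable (fun ω => |Y ω|) P := integrable_of_abs_le (C := 1) (by fun_prop)
    fun ω => by simpa using hb ω
  have i2 : Integrable (fun ω => Y ω ^ 2) P := integrable_of_abs_le (C := 1) (by fun_prop)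
    fun ω => by
      rw [abs_pow]; exact pow_le_one₀ (abs_nonneg _) (hb ω)
  have i3 : Integrable (fun ω => |Y ω| ^ 3) P := integrable_of_abs_le (C := 1) (by fun_prop)
    fun ω => by
      rw [abs_pow, abs_abs]; exact pow_le_one₀ (abs_nonneg _) (hb ω)
  have j2 : Integrable (fun ω => m * Y ω ^ 2) P := i2.const_mul m
  have j1 : Integrable (fun ω => m ^ 2 * |Y ω|) P := i1.const_mul _
  have j3 : Integrable (fun ω => m * Y ω ^ 2 + m ^ 2 * |Y ω|) P := j2.add j1
  have j4 : Integrable (fun ω => |Y ω| ^ 3 + m ^ 3) P := i3.add (integrable_const _)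
  have := integral_mono j3 j4 fun ω => by
    have h1 := abs_nonneg (Y ω)
    have h2 : Y ω ^ 2 = |Y ω| ^ 2 := (sq_abs _).symm
    simp only
    rw [h2]
    nlinarith [mul_nonneg (add_nonneg h1 hm0) (sq_nonneg (|Y ω| - m))]
  rw [integral_add j2 j1, integral_add i3 (integrable_const _), integral_const_mul,
    integral_const_mul, ← hm] at this
  simp only [integral_const, probReal_univ, one_smul] at this
  nlinarith

end ClippedSums

/-! ### Stein's method for clipped sums -/

section ClippedBerryEsseen

variable {Ω : Type*} [MeasurableSpace Ω] {P : Measure Ω} [IsProbabilityMeasure P]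
variable {ι : Type*} [Fintype ι] [DecidableEq ι] {ξ : ι → Ω → ℝ}

/-- The modulus of continuity of the derivative of the Stein solution. -/
noncomputable def steinModulus (z s r : ℝ) : ℝ :=
  |s| * steinBound z (r + 1) + {x | |x - z| ≤ |s|}.indicator 1 r

@[fun_prop]
theorem measurable_steinBound (z : ℝ) : Measurable (steinBound z) := by
  unfold steinBound; fun_prop

theorem measurable_steinModulus (z : ℝ) : Measurable (Function.uncurry (steinModulus z)) := by
  have h1 : Measurable (fun v : ℝ × ℝ => {x | |x - z| ≤ |v.1|}.indicator (1 : ℝ → ℝ) v.2) := by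
    simp only [Set.indicator_apply]
    exact Measurable.ite (p := fun v : ℝ × ℝ => |v.2 - z| ≤ |v.1|)
      (measurableSet_le (by fun_prop) (by fun_prop)) measurable_const measurable_const
  exact Measurable.add (f := fun v : ℝ × ℝ => |v.1| * steinBound z (v.2 + 1)) (by fun_prop) h1

theorem steinModulus_nonneg (z s r : ℝ) : 0 ≤ steinModulus z s r :=
  add_nonneg (mul_nonneg (abs_nonneg _) (steinBound_nonneg _ _))
    (Set.indicator_nonneg (fun _ _ => zero_le_one) _)

theorem steinModulus_le {z s r c : ℝ} (hs : |s| ≤ 1) (hr : r ≤ c) :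
    steinModulus z s r ≤ steinBound z (c + 1) + 1 := by
  unfold steinModulus
  refine add_le_add ?_ (Set.indicator_le_self' (fun _ _ => zero_le_one) _)
  calc |s| * steinBound z (r + 1) ≤ 1 * steinBound z (c + 1) :=
        mul_le_mul hs (steinBound_mono z (by linarith)) (steinBound_nonneg _ _) zero_le_one
    _ = _ := one_mul _

theorem abs_sum_clip_le (ω : Ω) : |∑ i, clip (ξ i ω)| ≤ Fintype.card ι :=
  (Finset.abs_sum_le_sum_abs _ _).trans
    ((Finset.sum_le_sum fun j _ => abs_clip_le_one _).trans (by simp))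

theorem Summands.integral_steinBound_le (h : Summands P ξ) {z : ℝ} (hz : 0 ≤ z) {b : ℝ}
    (hb1 : b ≤ 1) :
    ∫ ω, steinBound z (∑ i, clip (ξ i ω) + b) ∂P ≤ 416 * ((1 + z) ^ 2 * Real.exp (-z / 2)) := by
  have hm := h.meas
  have hi : Integrable (fun ω => Real.exp (∑ i, clip (ξ i ω))) P :=
    integrable_of_abs_le (C := Real.exp (Fintype.card ι)) (by fun_prop) fun ω => by
      rw [abs_of_pos (Real.exp_pos _), Real.exp_le_exp]
      exact (abs_le.1 (abs_sum_clip_le ω)).2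
  have hi' : Integrable (fun ω => Real.exp b * Real.exp (∑ i, clip (ξ i ω))) P := hi.const_mul _
  have e : ∀ ω, steinBound z (∑ i, clip (ξ i ω) + b) = 16 * (1 + z) ^ 2 * Real.exp (-z) *
      (1 + Real.exp b * Real.exp (∑ i, clip (ξ i ω))) := fun ω => by
    rw [steinBound, Real.exp_add, mul_comm (Real.exp b)]
  simp only [e]
  rw [integral_const_mul, integral_add (integrable_const _) hi', integral_const_mul]
  simp only [integral_const, probReal_univ, one_smul]
  have h9 := h.integral_exp_sum_clip_le
  have h0 : 0 ≤ ∫ ω, Real.exp (∑ i, clip (ξ i ω)) ∂P := integral_nonneg fun _ => (Real.exp_pos _).le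
  have hE : Real.exp b ≤ 2.72 := (Real.exp_le_exp.2 hb1).trans (by linarith [Real.exp_one_lt_d9])
  have hz2 : Real.exp (-z) ≤ Real.exp (-z / 2) := Real.exp_le_exp.2 (by linarith)
  have h25 : 1 + Real.exp b * ∫ ω, Real.exp (∑ i, clip (ξ i ω)) ∂P ≤ 26 := by
    have := mul_le_mul hE h9 h0 (by norm_num)
    linarith
  calc 16 * (1 + z) ^ 2 * Real.exp (-z) * (1 + Real.exp b * ∫ ω, Real.exp (∑ i, clip (ξ i ω)) ∂P)
      ≤ 16 * (1 + z) ^ 2 * Real.exp (-z / 2) * 26 := by gcongr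
    _ = _ := by ring

theorem Summands.integral_steinModulus_le (h : Summands P ξ) {z δ s : ℝ} (hz : 0 ≤ z) (hδ : 0 ≤ δ)
    (hδ1 : δ ≤ 1) (hκ : 1 / 4 ≤ ∑ i, ∫ ω, |ξ i ω| * min δ |ξ i ω| ∂P) (hs : |s| ≤ 1) :
    ∫ ω, steinModulus z s (∑ i, clip (ξ i ω)) ∂P ≤
      500 * ((1 + z) ^ 2 * Real.exp (-z / 2)) * (|s| + δ) := by
  have hm := h.meas
  have h1 := h.integral_steinBound_le hz le_rfl
  have h2 := h.measure_abs_sum_clip_sub_le z hδ hδ1 hκ (abs_nonneg s) hs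
  have hA : MeasurableSet {ω | |∑ i, clip (ξ i ω) - z| ≤ |s|} :=
    measurableSet_le (by fun_prop) measurable_const
  have e : ∀ ω, {x | |x - z| ≤ |s|}.indicator (1 : ℝ → ℝ) (∑ i, clip (ξ i ω)) =
      {ω | |∑ i, clip (ξ i ω) - z| ≤ |s|}.indicator 1 ω := fun ω => rfl
  unfold steinModulus
  have i1 : Integrable (fun ω => |s| * steinBound z (∑ i, clip (ξ i ω) + 1)) P :=
    (integrable_of_abs_le (C := steinBound z (Fintype.card ι + 1)) (by fun_prop) fun ω => by
      rw [abs_of_nonneg (steinBound_nonneg _ _)]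
      exact steinBound_mono z (by linarith [(abs_le.1 (abs_sum_clip_le (ξ := ξ) ω)).2])).const_mul _
  have i2 : Integrable ({ω | |∑ i, clip (ξ i ω) - z| ≤ |s|}.indicator (1 : Ω → ℝ)) P :=
    (integrable_const (1 : ℝ)).indicator hA
  simp only [e]
  rw [integral_add i1 i2, integral_const_mul, integral_indicator_one hA]
  have hz2 : 1 ≤ (1 + z) ^ 2 := by nlinarith
  have hq : Real.exp (-z / 2) ≤ (1 + z) ^ 2 * Real.exp (-z / 2) :=
    le_mul_of_one_le_left (Real.exp_pos _).le hz2
  have h0 := abs_nonneg s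
  have a1 := mul_le_mul_of_nonneg_left h1 h0
  have a2 : 72 * Real.exp (-z / 2) * (|s| + δ) ≤
      72 * ((1 + z) ^ 2 * Real.exp (-z / 2)) * (|s| + δ) := by gcongr
  have hq0 : 0 ≤ (1 + z) ^ 2 * Real.exp (-z / 2) := by positivity
  nlinarith [mul_nonneg hq0 hδ, mul_nonneg hq0 h0]

/-- With ξ_i frozen, the leave-one-out sum satisfies the concentration bound, since 1/2 - δ ≥ 1/4.
It is used for ψ = x² (Taylor error of f) and ψ = 1 (change of F). -/
theorem Summands.integral_mul_steinModulus_le (h : Summands P ξ) {z δ : ℝ} (hz : 0 ≤ z)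
    (hδ : 0 ≤ δ) (hδ1 : δ ≤ 1 / 4) (hκ : 1 / 2 ≤ ∑ i, ∫ ω, |ξ i ω| * min δ |ξ i ω| ∂P) (i : ι)
    {ψ : ℝ → ℝ} (hψ : Measurable ψ) (hψ0 : ∀ x, 0 ≤ ψ x) (hψ1 : ∀ x, |x| ≤ 1 → ψ x ≤ 1) :
    ∫ ω, ψ (clip (ξ i ω)) *
        steinModulus z (clip (ξ i ω)) (∑ j, clip (ξ j ω) - clip (ξ i ω)) ∂P ≤
      500 * ((1 + z) ^ 2 * Real.exp (-z / 2)) *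
        ∫ ω, ψ (clip (ξ i ω)) * (|clip (ξ i ω)| + δ) ∂P := by
  have hm := h.meas
  have hR : ∀ ω, ∑ j, clip (ξ j ω) - clip (ξ i ω) ≤ Fintype.card ι + 1 := fun ω => by
    linarith [(abs_le.1 (abs_sum_clip_le (ξ := ξ) ω)).2, neg_one_le_clip (ξ i ω)]
  have hMm := measurable_steinModulus z
  rw [← integral_const_mul]
  refine IndepFun.integral_comp_le (hm i) (by fun_prop) (h.indep_sub measurable_clip clip_zero i)
    (ρ := fun x r => ψ (clip x) * steinModulus z (clip x) r)
    (q := fun x => 500 * ((1 + z) ^ 2 * Real.exp (-z / 2)) * (ψ (clip x) * (|clip x| + δ)))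
    ?_ (by fun_prop) ?_ ?_ fun x => ?_
  · refine Measurable.mul (f := fun v : ℝ × ℝ => ψ (clip v.1)) (by fun_prop) ?_
    exact hMm.comp (f := fun v : ℝ × ℝ => (clip v.1, v.2)) (by fun_prop)
  · have hmeas : Measurable fun ω => steinModulus z (clip (ξ i ω))
        (∑ j, clip (ξ j ω) - clip (ξ i ω)) :=
      hMm.comp (f := fun ω => (clip (ξ i ω), ∑ j, clip (ξ j ω) - clip (ξ i ω))) (by fun_prop)
    refine integrable_of_abs_le (C := 1 * (steinBound z (Fintype.card ι + 1 + 1) + 1))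
      (by fun_prop) fun ω => ?_
    rw [abs_of_nonneg (mul_nonneg (hψ0 _) (steinModulus_nonneg _ _ _))]
    exact mul_le_mul (hψ1 _ (abs_clip_le_one _)) (steinModulus_le (abs_clip_le_one _) (hR ω))
      (steinModulus_nonneg _ _ _) zero_le_one
  · refine (integrable_of_abs_le (C := 1 * (1 + δ)) (by fun_prop) fun ω => ?_).const_mul _
    rw [abs_of_nonneg (mul_nonneg (hψ0 _) (add_nonneg (abs_nonneg _) hδ))]
    exact mul_le_mul (hψ1 _ (abs_clip_le_one _)) (add_le_add_left (abs_clip_le_one _) _)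
      (add_nonneg (abs_nonneg _) hδ) zero_le_one
  · rw [integral_const_mul]
    have hk := h.sub_le_sum_zeroAt hδ hκ i
    have := (h.zeroAt i).integral_steinModulus_le hz hδ (by linarith) (by linarith)
      (abs_clip_le_one x)
    simp only [sum_zeroAt clip_zero] at this
    calc ψ (clip x) * ∫ ω, steinModulus z (clip x) (∑ j, clip (ξ j ω) - clip (ξ i ω)) ∂P
        ≤ ψ (clip x) * (500 * ((1 + z) ^ 2 * Real.exp (-z / 2)) * (|clip x| + δ)) :=
          mul_le_mul_of_nonneg_left this (hψ0 _)
      _ = _ := by ring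

/-- Berry–Esseen bound with exponential decay for sums of clipped summands. -/
theorem Summands.abs_measureReal_sum_clip_sub_cdf_le (h : Summands P ξ) {z δ β : ℝ} (hz : 0 ≤ z)
    (hδ : 0 ≤ δ) (hδ1 : δ ≤ 1 / 4) (hκ : 1 / 2 ≤ ∑ i, ∫ ω, |ξ i ω| * min δ |ξ i ω| ∂P)
    (hβ2 : 1 - β ≤ ∑ i, ∫ ω, clip (ξ i ω) ^ 2 ∂P)
    (hβ3 : ∑ i, ∫ ω, |clip (ξ i ω)| ^ 3 ∂P ≤ β) (hβ1 : ∑ i, |∫ ω, clip (ξ i ω) ∂P| ≤ β)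
    {S : Set ℝ} (hS : MeasurableSet S) (hS1 : Set.Iio z ⊆ S) (hS2 : S ⊆ Set.Iic z) :
    |P.real {ω | ∑ i, clip (ξ i ω) ∈ S} - cdf (gaussianReal 0 1) z| ≤
      2000 * ((1 + z) ^ 2 * Real.exp (-z / 2)) * (β + δ) := by
  have hm := h.meas
  obtain ⟨f, F, hf, hF, hfF, hfb, hFb, hT, hL⟩ := exists_stein_solution hz hS hS1 hS2
  set q := (1 + z) ^ 2 * Real.exp (-z / 2) with hq
  have hq0 : 0 ≤ q := by positivity
  set N : ℝ := (Fintype.card ι : ℝ) with hN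
  set W : Ω → ℝ := fun ω => ∑ j, clip (ξ j ω) with hW
  have hWm : Measurable W := by fun_prop
  have hWN : ∀ ω, |W ω| ≤ N := abs_sum_clip_le
  set R : ι → Ω → ℝ := fun i ω => W ω - clip (ξ i ω) with hR
  have hRm : ∀ i, Measurable (R i) := fun i => by fun_prop
  have hRN : ∀ i ω, R i ω ≤ N + 1 := fun i ω => by
    linarith [(abs_le.1 (hWN ω)).2, neg_one_le_clip (ξ i ω)]
  set B := steinBound z (N + 1) with hB
  have hB0 : 0 ≤ B := steinBound_nonneg _ _
  have hfW : ∀ ω, |f (W ω)| ≤ B := fun ω => (hfb _).trans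
    (steinBound_mono z (by linarith [(abs_le.1 (hWN ω)).2]))
  have hFW : ∀ ω, |F (W ω)| ≤ B := fun ω => (hFb _).trans
    (steinBound_mono z (by linarith [(abs_le.1 (hWN ω)).2]))
  have hfR : ∀ i ω, |f (R i ω)| ≤ B := fun i ω => (hfb _).trans (steinBound_mono z (hRN i ω))
  have hFR : ∀ i ω, |F (R i ω)| ≤ B := fun i ω => (hFb _).trans (steinBound_mono z (hRN i ω))
  have ifW : Integrable (fun ω => f (W ω)) P := integrable_of_abs_le (by fun_prop) hfW
  have iFW : Integrable (fun ω => F (W ω)) P := integrable_of_abs_le (by fun_prop) hFW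
  have ifR : ∀ i, Integrable (fun ω => f (R i ω)) P := fun i =>
    integrable_of_abs_le (by have := hRm i; fun_prop) (hfR i)
  have iFR : ∀ i, Integrable (fun ω => F (R i ω)) P := fun i =>
    integrable_of_abs_le (by have := hRm i; fun_prop) (hFR i)
  have hmul : ∀ {g : Ω → ℝ} {i : ι}, Measurable g → (∀ ω, |g ω| ≤ B) →
      Integrable (fun ω => clip (ξ i ω) * g ω) P := fun {g i} hg hb =>
    integrable_of_abs_le (C := 1 * B) (by fun_prop) fun ω => by
      rw [abs_mul]
      exact mul_le_mul (abs_clip_le_one _) (hb ω) (abs_nonneg _) zero_le_one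
  have hmul2 : ∀ {g : Ω → ℝ} {i : ι}, Measurable g → (∀ ω, |g ω| ≤ B) →
      Integrable (fun ω => clip (ξ i ω) ^ 2 * g ω) P := fun {g i} hg hb =>
    integrable_of_abs_le (C := 1 * B) (by fun_prop) fun ω => by
      rw [abs_mul, abs_pow]
      exact mul_le_mul (pow_le_one₀ (abs_nonneg _) (abs_clip_le_one _)) (hb ω) (abs_nonneg _)
        zero_le_one
  have iModulus : ∀ i, Integrable (fun ω => steinModulus z (clip (ξ i ω)) (R i ω)) P := fun i =>
    integrable_of_abs_le (C := steinBound z (N + 1 + 1) + 1)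
      ((measurable_steinModulus z).comp (f := fun ω => (clip (ξ i ω), R i ω))
        (by have := hRm i; fun_prop)) fun ω => by
      rw [abs_of_nonneg (steinModulus_nonneg _ _ _)]
      exact steinModulus_le (abs_clip_le_one _) (hRN i ω)
  have iModulus2 : ∀ i, Integrable
      (fun ω => clip (ξ i ω) ^ 2 * steinModulus z (clip (ξ i ω)) (R i ω)) P := fun i =>
    (iModulus i).bdd_mul (c := 1) (Measurable.aestronglyMeasurable (by fun_prop))
      (Filter.Eventually.of_forall fun ω => by
        rw [Real.norm_eq_abs, abs_pow]
        exact pow_le_one₀ (abs_nonneg _) (abs_clip_le_one _))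
  have hSW : MeasurableSet {ω | W ω ∈ S} := hWm hS
  -- Stein's equation, integrated.
  have hmain : P.real {ω | W ω ∈ S} - cdf (gaussianReal 0 1) z =
      ∫ ω, F (W ω) ∂P - ∑ i, ∫ ω, clip (ξ i ω) * f (W ω) ∂P := by
    rw [← integral_finsetSum _ fun i _ => hmul (by fun_prop) hfW]
    have e1 : ∀ ω, ∑ i, clip (ξ i ω) * f (W ω) = W ω * f (W ω) := fun ω => by
      rw [← Finset.sum_mul]
    have i1 : Integrable (fun ω => W ω * f (W ω)) P := by
      simp only [← e1]
      exact integrable_finsetSum _ fun i _ => hmul (by fun_prop) hfW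
    have i2 : Integrable ({ω | W ω ∈ S}.indicator (1 : Ω → ℝ)) P :=
      (integrable_const (1 : ℝ)).indicator hSW
    have e2 : ∀ ω, F (W ω) - W ω * f (W ω) =
        {ω | W ω ∈ S}.indicator 1 ω - cdf (gaussianReal 0 1) z := fun ω => hfF (W ω)
    simp only [e1]
    rw [← integral_sub iFW i1]
    simp only [e2]
    rw [integral_sub i2 (integrable_const _), integral_indicator_one hSW]
    simp
  set σ : ι → ℝ := fun i => ∫ ω, clip (ξ i ω) ^ 2 ∂P with hσ
  have hσ0 : ∀ i, 0 ≤ σ i := fun i => integral_nonneg fun _ => sq_nonneg _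
  set c : ι → ℝ := fun i => ∫ ω, |clip (ξ i ω)| ^ 3 ∂P with hc
  set m : ι → ℝ := fun i => ∫ ω, clip (ξ i ω) ∂P with hm'
  have ic1 : ∀ i, Integrable (fun ω => |clip (ξ i ω)|) P := fun i =>
    integrable_of_abs_le (C := 1) (by fun_prop) fun ω => by simpa using abs_clip_le_one _
  have ic2 : ∀ i, Integrable (fun ω => clip (ξ i ω) ^ 2) P := fun i =>
    integrable_of_abs_le (C := 1) (by fun_prop) fun ω => by
      rw [abs_pow]; exact pow_le_one₀ (abs_nonneg _) (abs_clip_le_one _)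
  have ic3 : ∀ i, Integrable (fun ω => |clip (ξ i ω)| ^ 3) P := fun i =>
    integrable_of_abs_le (C := 1) (by fun_prop) fun ω => by
      rw [abs_pow, abs_abs]; exact pow_le_one₀ (abs_nonneg _) (abs_clip_le_one _)
  have hσ1 : ∑ i, σ i ≤ 1 := (Finset.sum_le_sum fun i _ =>
    integral_mono (ic2 i) (h.memLp i).integrable_sq fun ω => clip_sq_le _).trans h.var
  have hind1 : ∀ i, ∫ ω, clip (ξ i ω) * f (R i ω) ∂P = m i * ∫ ω, f (R i ω) ∂P := fun i =>
    ((h.indep_sub measurable_clip clip_zero i).comp measurable_clip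
      hf).integral_fun_mul_eq_mul_integral (Measurable.aestronglyMeasurable (by fun_prop))
      (Measurable.aestronglyMeasurable (by fun_prop))
  have hind2 : ∀ i, ∫ ω, clip (ξ i ω) ^ 2 * F (R i ω) ∂P = σ i * ∫ ω, F (R i ω) ∂P := fun i =>
    ((h.indep_sub measurable_clip clip_zero i).comp (φ := fun x => clip x ^ 2) (by fun_prop)
      hF).integral_fun_mul_eq_mul_integral (Measurable.aestronglyMeasurable (by fun_prop))
      (Measurable.aestronglyMeasurable (by fun_prop))
  have hRW : ∀ i ω, R i ω + clip (ξ i ω) = W ω := fun i ω => sub_add_cancel _ _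
  -- First-order expansion of f around the leave-one-out sum, which is independent of the clipped
  -- summand.
  have errT : ∀ i, |∫ ω, clip (ξ i ω) * f (W ω) ∂P - m i * ∫ ω, f (R i ω) ∂P -
      σ i * ∫ ω, F (R i ω) ∂P| ≤ 500 * q * (c i + δ * σ i) := by
    intro i
    have hRmi := hRm i
    have j1 := hmul (i := i) (g := fun ω => f (W ω)) (by fun_prop) hfW
    have j2 := hmul (i := i) (g := fun ω => f (R i ω)) (by fun_prop) (hfR i)
    have j3 := hmul2 (i := i) (g := fun ω => F (R i ω)) (by fun_prop) (hFR i)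
    have j12 : Integrable (fun ω => clip (ξ i ω) * f (W ω) - clip (ξ i ω) * f (R i ω)) P :=
      j1.sub j2
    rw [← hind1, ← hind2, ← integral_sub j1 j2, ← integral_sub j12 j3]
    have b1 := h.integral_mul_steinModulus_le hz hδ hδ1 hκ i (ψ := fun x => x ^ 2) (by fun_prop)
      (fun x => sq_nonneg x) (fun x hx => by
        rw [← sq_abs]; exact pow_le_one₀ (abs_nonneg _) hx)
    have b2 : ∫ ω, clip (ξ i ω) ^ 2 * (|clip (ξ i ω)| + δ) ∂P = c i + δ * σ i := by
      have : ∀ ω, clip (ξ i ω) ^ 2 * (|clip (ξ i ω)| + δ) =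
          |clip (ξ i ω)| ^ 3 + δ * clip (ξ i ω) ^ 2 := fun ω => by
        rw [← sq_abs]; ring
      simp only [this]
      rw [integral_add (ic3 i) ((ic2 i).const_mul δ), integral_const_mul]
    rw [b2] at b1
    refine (abs_integral_le_integral_abs).trans (le_trans ?_ b1)
    refine integral_mono (j12.sub j3).abs (iModulus2 i) fun ω => ?_
    have := hT (R i ω) (clip (ξ i ω)) (abs_clip_le_one _)
    rw [hRW] at this
    simp only
    rw [show clip (ξ i ω) * f (W ω) - clip (ξ i ω) * f (R i ω) - clip (ξ i ω) ^ 2 * F (R i ω) =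
      clip (ξ i ω) * (f (W ω) - f (R i ω) - clip (ξ i ω) * F (R i ω)) by ring, abs_mul]
    calc |clip (ξ i ω)| * |f (W ω) - f (R i ω) - clip (ξ i ω) * F (R i ω)|
        ≤ |clip (ξ i ω)| * (|clip (ξ i ω)| * steinModulus z (clip (ξ i ω)) (R i ω)) :=
          mul_le_mul_of_nonneg_left this (abs_nonneg _)
      _ = _ := by rw [← mul_assoc, ← sq, sq_abs]
  -- The product of E clip² and E|clip| is at most E|clip|³, so the change from F(W) to F(R_i) is
  -- also of third order.
  have errL : ∀ i, σ i * |∫ ω, F (W ω) ∂P - ∫ ω, F (R i ω) ∂P| ≤ 500 * q * (c i + δ * σ i) := by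
    intro i
    have b1 := h.integral_mul_steinModulus_le hz hδ hδ1 hκ i (ψ := fun _ => 1) (by fun_prop)
      (fun _ => zero_le_one) (fun _ _ => le_rfl)
    simp only [one_mul] at b1
    rw [integral_add (ic1 i) (integrable_const _)] at b1
    simp only [integral_const, probReal_univ, one_smul] at b1
    have b2 : |∫ ω, F (W ω) ∂P - ∫ ω, F (R i ω) ∂P| ≤
        500 * q * (∫ ω, |clip (ξ i ω)| ∂P + δ) := by
      rw [← integral_sub iFW (iFR i)]
      refine (abs_integral_le_integral_abs).trans (le_trans ?_ b1)
      refine integral_mono (iFW.sub (iFR i)).abs (iModulus i) fun ω => ?_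
      have := hL (R i ω) (clip (ξ i ω)) (abs_clip_le_one _)
      rw [hRW] at this
      exact this
    have b3 := integral_sq_mul_integral_abs_le (P := P) (Y := fun ω => clip (ξ i ω)) (by fun_prop)
      (fun ω => abs_clip_le_one _)
    calc σ i * |∫ ω, F (W ω) ∂P - ∫ ω, F (R i ω) ∂P|
        ≤ σ i * (500 * q * (∫ ω, |clip (ξ i ω)| ∂P + δ)) :=
          mul_le_mul_of_nonneg_left b2 (hσ0 i)
      _ = 500 * q * (σ i * ∫ ω, |clip (ξ i ω)| ∂P + δ * σ i) := by ring
      _ ≤ 500 * q * (c i + δ * σ i) := by gcongr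
  have bF : |∫ ω, F (W ω) ∂P| ≤ 416 * q := by
    have := h.integral_steinBound_le hz (b := 0) zero_le_one
    simp only [add_zero] at this
    refine (abs_integral_le_integral_abs).trans (le_trans ?_ this)
    exact integral_mono iFW.abs (integrable_of_abs_le (C := B) (by fun_prop) fun ω => by
      rw [abs_of_nonneg (steinBound_nonneg _ _)]
      exact steinBound_mono z (by linarith [(abs_le.1 (hWN ω)).2])) fun ω => hFb _
  have bf : ∀ i, |∫ ω, f (R i ω) ∂P| ≤ 416 * q := fun i => by
    have := (h.zeroAt i).integral_steinBound_le hz (b := 0) zero_le_one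
    simp only [add_zero, sum_zeroAt clip_zero] at this
    refine (abs_integral_le_integral_abs).trans (le_trans ?_ this)
    exact integral_mono (ifR i).abs (integrable_of_abs_le (C := B) (by fun_prop) fun ω => by
      rw [abs_of_nonneg (steinBound_nonneg _ _)]
      exact steinBound_mono z (hRN i ω)) fun ω => hfb _
  -- Four sources of error: the variance lost by clipping, the change of argument in F, the Taylor
  -- remainder of f, and the means created by clipping.
  have hdec : P.real {ω | W ω ∈ S} - cdf (gaussianReal 0 1) z =
      (1 - ∑ i, σ i) * (∫ ω, F (W ω) ∂P) +
      ∑ i, (σ i * (∫ ω, F (W ω) ∂P - ∫ ω, F (R i ω) ∂P) -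
        (∫ ω, clip (ξ i ω) * f (W ω) ∂P - m i * ∫ ω, f (R i ω) ∂P - σ i * ∫ ω, F (R i ω) ∂P) -
        m i * ∫ ω, f (R i ω) ∂P) := by
    rw [hmain]
    simp only [Finset.sum_sub_distrib, mul_sub, ← Finset.sum_mul]
    ring
  rw [show {ω | ∑ i, clip (ξ i ω) ∈ S} = {ω | W ω ∈ S} from rfl, hdec]
  have s1 : |(1 - ∑ i, σ i) * (∫ ω, F (W ω) ∂P)| ≤ β * (416 * q) := by
    rw [abs_mul, abs_of_nonneg (by linarith)]
    exact mul_le_mul (by linarith) bF (abs_nonneg _) (by linarith)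
  have s2 : |∑ i, (σ i * (∫ ω, F (W ω) ∂P - ∫ ω, F (R i ω) ∂P) -
        (∫ ω, clip (ξ i ω) * f (W ω) ∂P - m i * ∫ ω, f (R i ω) ∂P - σ i * ∫ ω, F (R i ω) ∂P) -
        m i * ∫ ω, f (R i ω) ∂P)| ≤
      ∑ i, (1000 * q * (c i + δ * σ i) + |m i| * (416 * q)) := by
    refine (Finset.abs_sum_le_sum_abs _ _).trans (Finset.sum_le_sum fun i _ => ?_)
    refine (abs_sub _ _).trans (add_le_add ((abs_sub _ _).trans ?_) ?_)
    · rw [abs_mul, abs_of_nonneg (hσ0 i)]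
      linarith [errT i, errL i]
    · rw [abs_mul]
      exact mul_le_mul_of_nonneg_left (bf i) (abs_nonneg _)
  rw [Finset.sum_add_distrib, ← Finset.mul_sum, Finset.sum_add_distrib, ← Finset.mul_sum,
    ← Finset.sum_mul] at s2
  refine (abs_add_le _ _).trans ((add_le_add s1 s2).trans ?_)
  have t1 : (∑ i, |m i|) * (416 * q) ≤ β * (416 * q) :=
    mul_le_mul_of_nonneg_right hβ1 (by positivity)
  have t2 : 1000 * q * (∑ i, c i + δ * ∑ i, σ i) ≤ 1000 * q * (β + δ) := by
    refine mul_le_mul_of_nonneg_left (add_le_add hβ3 ?_) (by positivity)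
    exact mul_le_of_le_one_right hδ hσ1
  have hβ0 : 0 ≤ β := le_trans (Finset.sum_nonneg fun i _ => abs_nonneg _) hβ1
  nlinarith [mul_nonneg hq0 hβ0, mul_nonneg hq0 hδ]

end ClippedBerryEsseen

/-! ### Polynomial tail bounds -/

section Tails

/-- From e^{v/c} ≥ (v/c)^{k+3}/(k+3)! and v^p ≤ v³; the constant is uniform over p ≤ 3. -/
theorem pow_mul_exp_neg_div_le {v p c : ℝ} (hv : 1 ≤ v) (hp : p ≤ 3) (hc : 0 < c) (k : ℕ) :
    v ^ k * Real.exp (-v / c) ≤ (k + 3).factorial * c ^ (k + 3) * v ^ (-p) := by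
  have hv0 : 0 < v := by linarith
  have h1 := Real.pow_div_factorial_le_exp (x := v / c) (by positivity) (k + 3)
  have hf : (0 : ℝ) < (k + 3).factorial := by positivity
  rw [div_le_iff₀ hf, div_pow, div_le_iff₀ (by positivity)] at h1
  have h2 : Real.exp (v / c) * Real.exp (-v / c) = 1 := by
    rw [← Real.exp_add, neg_div, add_neg_cancel, Real.exp_zero]
  have h3 : v ^ p ≤ v ^ (3 : ℕ) := by
    rw [← Real.rpow_natCast]; exact Real.rpow_le_rpow_of_exponent_le hv (by simpa using hp)
  have hvp : 0 < v ^ p := Real.rpow_pos_of_pos hv0 p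
  rw [Real.rpow_neg hv0.le, ← div_eq_mul_inv, le_div_iff₀ hvp]
  calc v ^ k * Real.exp (-v / c) * v ^ p ≤ v ^ k * Real.exp (-v / c) * v ^ (3 : ℕ) := by gcongr
    _ = v ^ (k + 3) * Real.exp (-v / c) := by ring
    _ ≤ (Real.exp (v / c) * (k + 3).factorial * c ^ (k + 3)) * Real.exp (-v / c) := by gcongr
    _ = (k + 3).factorial * c ^ (k + 3) * (Real.exp (v / c) * Real.exp (-v / c)) := by ring
    _ = _ := by rw [h2, mul_one]

theorem div_rpow_neg_le {v p c k : ℝ} (hv : 0 < v) (hp : p ≤ 3) (hc : 1 ≤ c)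
    (hk : c ^ 3 ≤ k) : (v / c) ^ (-p) ≤ k * v ^ (-p) := by
  have hc0 : 0 < c := by linarith
  rw [Real.div_rpow hv.le hc0.le, Real.rpow_neg hc0.le, div_inv_eq_mul, mul_comm]
  refine mul_le_mul_of_nonneg_right (le_trans ?_ hk) (Real.rpow_nonneg hv.le _)
  calc c ^ p ≤ c ^ (3 : ℝ) := Real.rpow_le_rpow_of_exponent_le hc hp
    _ = c ^ 3 := Real.rpow_ofNat c 3

variable {Ω : Type*} [MeasurableSpace Ω] {P : Measure Ω} [IsProbabilityMeasure P]
variable {ι : Type*} [Fintype ι] [DecidableEq ι] {ξ : ι → Ω → ℝ}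

theorem measureReal_le_abs_le {X : Ω → ℝ} {p a : ℝ} (hp : 0 ≤ p) (ha : 0 < a)
    (hX : Integrable (fun ω => |X ω| ^ p) P) :
    P.real {ω | a ≤ |X ω|} ≤ a ^ (-p) * ∫ ω, |X ω| ^ p ∂P := by
  have h1 := mul_meas_ge_le_integral_of_nonneg (μ := P)
    (Filter.Eventually.of_forall fun ω => Real.rpow_nonneg (abs_nonneg (X ω)) p) hX (a ^ p)
  have h2 : P.real {ω | a ≤ |X ω|} ≤ P.real {ω | a ^ p ≤ |X ω| ^ p} :=
    measureReal_mono (fun ω hω => Real.rpow_le_rpow ha.le hω hp) (measure_ne_top _ _)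
  have h3 : 0 < a ^ p := Real.rpow_pos_of_pos ha p
  rw [Real.rpow_neg ha.le, inv_mul_eq_div, le_div_iff₀ h3, mul_comm]
  exact (mul_le_mul_of_nonneg_left h2 h3.le).trans h1

theorem sum_measureReal_le_abs_le {p a : ℝ} (hp : 0 ≤ p) (ha : 0 < a)
    (hX : ∀ i, Integrable (fun ω => |ξ i ω| ^ p) P) :
    ∑ i, P.real {ω | a ≤ |ξ i ω|} ≤ a ^ (-p) * ∑ i, ∫ ω, |ξ i ω| ^ p ∂P := by
  rw [Finset.mul_sum]
  exact Finset.sum_le_sum fun i _ => measureReal_le_abs_le hp ha (hX i)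

theorem exp_nine_le : Real.exp 9 ≤ 8200 := by
  have h := Real.exp_one_lt_d9
  have e : Real.exp 9 = Real.exp 1 ^ 9 := by rw [← Real.exp_nat_mul]; norm_num
  rw [e]
  calc Real.exp 1 ^ 9 ≤ 2.7182818286 ^ 9 := by gcongr
    _ ≤ 8200 := by norm_num

/-- A Fuk–Nagaev type tail bound. -/
theorem Summands.measureReal_le_sum_le (h : Summands P ξ) {p t : ℝ} (hp : 2 < p) (hp3 : p ≤ 3)
    (hX : ∀ i, Integrable (fun ω => |ξ i ω| ^ p) P) (ht : 1 ≤ t) :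
    P.real {ω | t ≤ ∑ i, ξ i ω} ≤ (27 * ∑ i, ∫ ω, |ξ i ω| ^ p ∂P + 8200) * t ^ (-p) := by
  have hm := h.meas
  have ht0 : 0 < t := by linarith
  set a := t / 3 with ha
  have ha0 : 0 < a := by positivity
  -- With a = t/3 this choice gives e^{θa} = t² and e^{-θt} = t^{-6} ≤ t^{-p}, while the Bennett
  -- exponent stays below t²/a² = 9.
  set θ := Real.log (t ^ 2) / a with hθ
  have hθ0 : 0 ≤ θ := div_nonneg (Real.log_nonneg (one_le_pow₀ ht)) ha0.le
  have hθa : Real.exp (θ * a) = t ^ 2 := by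
    rw [hθ, div_mul_cancel₀ _ ha0.ne', Real.exp_log (by positivity)]
  have hsub : {ω | t ≤ ∑ i, ξ i ω} ⊆
      (⋃ i, {ω | a ≤ |ξ i ω|}) ∪ {ω | t ≤ ∑ i, min (ξ i ω) a} := by
    intro ω hω
    by_cases hE : ∃ i, a ≤ |ξ i ω|
    · exact Or.inl (Set.mem_iUnion.2 hE)
    · right
      push Not at hE
      have : ∑ i, min (ξ i ω) a = ∑ i, ξ i ω := Finset.sum_congr rfl fun i _ =>
        min_eq_left ((le_abs_self _).trans (hE i).le)
      rw [Set.mem_ofPred_eq, this]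
      exact hω
  have h1 : P.real (⋃ i, {ω | a ≤ |ξ i ω|}) ≤ 27 * (∑ i, ∫ ω, |ξ i ω| ^ p ∂P) * t ^ (-p) := by
    refine (measureReal_iUnion_fintype_le _).trans
      ((sum_measureReal_le_abs_le (by linarith) ha0 hX).trans ?_)
    have := div_rpow_neg_le ht0 hp3 (c := 3) (k := 27) (by norm_num) (by norm_num)
    have hs : 0 ≤ ∑ i, ∫ ω, |ξ i ω| ^ p ∂P := Finset.sum_nonneg fun i _ =>
      integral_nonneg fun ω => Real.rpow_nonneg (abs_nonneg _) _
    nlinarith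
  have h2 : P.real {ω | t ≤ ∑ i, min (ξ i ω) a} ≤ 8200 * t ^ (-p) := by
    have hb : ∀ ω, ∑ i, min (ξ i ω) a ≤ Fintype.card ι * a := fun ω =>
      (Finset.sum_le_sum fun i _ => min_le_right _ _).trans (by simp)
    have := measure_ge_le_exp_mul_mgf (μ := P) (X := fun ω => ∑ i, min (ξ i ω) a) t hθ0
      (integrable_of_abs_le (C := Real.exp (θ * (Fintype.card ι * a))) (by fun_prop) fun ω => by
        rw [abs_of_pos (Real.exp_pos _), Real.exp_le_exp]
        exact mul_le_mul_of_nonneg_left (hb ω) hθ0)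
    refine this.trans ?_
    have e1 : Real.exp (-θ * t) = (t ^ 6)⁻¹ := by
      rw [show -θ * t = -((3 : ℕ) * (θ * a)) by rw [ha]; push_cast; ring, Real.exp_neg,
        Real.exp_nat_mul, hθa]
      ring
    have e2 : mgf (fun ω => ∑ i, min (ξ i ω) a) P θ ≤ 8200 := by
      refine (h.integral_exp_sum_min_le hθ0 ha0).trans (le_trans ?_ exp_nine_le)
      rw [Real.exp_le_exp, hθa, div_le_iff₀ (by positivity), ha]
      have : 0 ≤ θ * (t / 3) := mul_nonneg hθ0 ha0.le
      nlinarith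
    have e3 : (t ^ 6)⁻¹ ≤ t ^ (-p) := by
      rw [Real.rpow_neg ht0.le, ← Real.rpow_natCast]
      exact inv_anti₀ (Real.rpow_pos_of_pos ht0 _)
        (Real.rpow_le_rpow_of_exponent_le ht (by push_cast; linarith))
    rw [e1]
    calc (t ^ 6)⁻¹ * mgf (fun ω => ∑ i, min (ξ i ω) a) P θ ≤ t ^ (-p) * 8200 :=
          mul_le_mul e3 e2 mgf_nonneg (Real.rpow_nonneg ht0.le _)
      _ = _ := mul_comm _ _
  have := (measureReal_mono hsub (measure_ne_top P _)).trans (measureReal_union_le _ _)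
  linarith

theorem Summands.measureReal_lt_abs_sum_le (h : Summands P ξ) {p v : ℝ} (hp : 2 < p) (hp3 : p ≤ 3)
    (hX : ∀ i, Integrable (fun ω => |ξ i ω| ^ p) P) (hv : 1 ≤ v) :
    P.real {ω | (v - 3) / 3 < |∑ i, ξ i ω|} ≤
      (12000 * ∑ i, ∫ ω, |ξ i ω| ^ p ∂P + 4000000) * v ^ (-p) := by
  have hv0 : 0 < v := by linarith
  have hs : 0 ≤ ∑ i, ∫ ω, |ξ i ω| ^ p ∂P := Finset.sum_nonneg fun i _ =>
    integral_nonneg fun ω => Real.rpow_nonneg (abs_nonneg _) _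
  have hvp : 0 ≤ v ^ (-p) := Real.rpow_nonneg hv0.le _
  have h6 := div_rpow_neg_le hv0 hp3 (c := 6) (k := 216) (by norm_num) (by norm_num)
  -- For v ≥ 6, (v-3)/3 ≥ v/6. For smaller v the right side exceeds 1.
  rcases le_or_gt v 6 with h6v | h6v
  · have : 1 ≤ (v / 6) ^ (-p) :=
      Real.one_le_rpow_of_pos_of_le_one_of_nonpos (by positivity) (by linarith) (by linarith)
    have h1 : P.real {ω | (v - 3) / 3 < |∑ i, ξ i ω|} ≤ 1 := measureReal_le_one
    nlinarith
  · have h1 := h.measureReal_le_sum_le hp hp3 hX (t := v / 6) (by linarith)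
    have h2 := h.neg.measureReal_le_sum_le hp hp3 (by simpa only [abs_neg] using hX) (t := v / 6)
      (by linarith)
    simp only [abs_neg] at h2
    have hsub : {ω | (v - 3) / 3 < |∑ i, ξ i ω|} ⊆
        {ω | v / 6 ≤ ∑ i, ξ i ω} ∪ {ω | v / 6 ≤ ∑ i, -ξ i ω} := by
      intro ω hω
      have hω' : (v - 3) / 3 < |∑ i, ξ i ω| := hω
      rcases lt_abs.1 hω' with h | h
      · left
        rw [Set.mem_ofPred_eq]; linarith
      · right
        rw [Set.mem_ofPred_eq, Finset.sum_neg_distrib]; linarith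
    have := (measureReal_mono hsub (measure_ne_top P _)).trans (measureReal_union_le _ _)
    have h3 : (27 * ∑ i, ∫ ω, |ξ i ω| ^ p ∂P + 8200) * (v / 6) ^ (-p) ≤
        (27 * ∑ i, ∫ ω, |ξ i ω| ^ p ∂P + 8200) * (216 * v ^ (-p)) :=
      mul_le_mul_of_nonneg_left h6 (by positivity)
    nlinarith

theorem Summands.measureReal_lt_abs_sub_le (h : Summands P ξ) {p v : ℝ} (hp : 2 < p) (hp3 : p ≤ 3)
    (hX : ∀ i, Integrable (fun ω => |ξ i ω| ^ p) P) (hv : 1 ≤ v) (i : ι) :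
    P.real {ω | (v - 3) / 3 < |∑ j, ξ j ω - ξ i ω|} ≤
      (12000 * ∑ i, ∫ ω, |ξ i ω| ^ p ∂P + 4000000) * v ^ (-p) := by
  have hp0 : p ≠ 0 := by linarith
  have hle : ∀ j ω, |_root_.zeroAt i ξ j ω| ^ p ≤ |ξ j ω| ^ p := fun j ω => by
    unfold _root_.zeroAt
    split_ifs
    · rw [abs_zero, Real.zero_rpow hp0]; positivity
    · exact le_rfl
  have hX' : ∀ j, Integrable (fun ω => |_root_.zeroAt i ξ j ω| ^ p) P := fun j => by
    refine (hX j).mono' (Measurable.aestronglyMeasurable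
      (by have := measurable_zeroAt h.meas i j; fun_prop)) (Filter.Eventually.of_forall fun ω => ?_)
    rw [Real.norm_of_nonneg (by positivity)]
    exact hle j ω
  have h1 := (h.zeroAt i).measureReal_lt_abs_sum_le hp hp3 hX' hv
  simp only [sum_zeroAt_id] at h1
  refine h1.trans (mul_le_mul_of_nonneg_right ?_ (by positivity))
  have : ∑ j, ∫ ω, |_root_.zeroAt i ξ j ω| ^ p ∂P ≤ ∑ j, ∫ ω, |ξ j ω| ^ p ∂P :=
    Finset.sum_le_sum fun j _ => integral_mono (hX' j) (hX j) fun ω => hle j ω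
  linarith

/-- The two tail sums in `gammaTerm` are of the order of the Lyapunov ratio. -/
theorem Summands.sum_tails_le (h : Summands P ξ) {p v : ℝ} (hp : 2 < p) (hp3 : p ≤ 3)
    (hX : ∀ i, Integrable (fun ω => |ξ i ω| ^ p) P) (hβ : ∑ i, ∫ ω, |ξ i ω| ^ p ∂P ≤ 1 / 8)
    (hv : 1 ≤ v) :
    ∑ i, P.real {ω | v / 3 < |ξ i ω|} +
      ∑ i, P.real {ω | (v - 3) / 3 < |∑ j, ξ j ω - ξ i ω|} * P.real {ω | 1 < |ξ i ω|} ≤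
      5000000 * v ^ (-p) * ∑ i, ∫ ω, |ξ i ω| ^ p ∂P := by
  have hv0 : 0 < v := by linarith
  have hvp : 0 ≤ v ^ (-p) := Real.rpow_nonneg hv0.le _
  set β := ∑ i, ∫ ω, |ξ i ω| ^ p ∂P with hβdef
  have hs : 0 ≤ β := Finset.sum_nonneg fun i _ =>
    integral_nonneg fun ω => Real.rpow_nonneg (abs_nonneg _) _
  have lt_le : ∀ (a : ℝ) i, P.real {ω | a < |ξ i ω|} ≤ P.real {ω | a ≤ |ξ i ω|} := fun a i =>
    measureReal_mono (fun ω (hω : a < |ξ i ω|) => show a ≤ |ξ i ω| from hω.le)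
      (measure_ne_top _ _)
  have h1 : ∑ i, P.real {ω | v / 3 < |ξ i ω|} ≤ 27 * v ^ (-p) * β :=
    (Finset.sum_le_sum fun i _ => lt_le _ i).trans
      ((sum_measureReal_le_abs_le (by linarith) (by positivity) hX).trans
        (mul_le_mul_of_nonneg_right (div_rpow_neg_le hv0 hp3 (by norm_num)
          (by norm_num)) hs))
  have h2 : ∑ i, P.real {ω | 1 < |ξ i ω|} ≤ β := by
    have := sum_measureReal_le_abs_le (p := p) (by linarith) one_pos hX
    rw [Real.one_rpow, one_mul] at this
    exact (Finset.sum_le_sum fun i _ => lt_le _ i).trans this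
  -- The leave-one-out tails are only O(v^{-p}); the factors P(|ξ_i| > 1), whose sum is at most β,
  -- supply the missing β.
  have h3 : ∑ i, P.real {ω | (v - 3) / 3 < |∑ j, ξ j ω - ξ i ω|} * P.real {ω | 1 < |ξ i ω|} ≤
      ((12000 * β + 4000000) * v ^ (-p)) * ∑ i, P.real {ω | 1 < |ξ i ω|} := by
    rw [Finset.mul_sum]
    exact Finset.sum_le_sum fun i _ => mul_le_mul_of_nonneg_right
      (h.measureReal_lt_abs_sub_le hp hp3 hX hv i) measureReal_nonneg
  have h4 : ((12000 * β + 4000000) * v ^ (-p)) * ∑ i, P.real {ω | 1 < |ξ i ω|} ≤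
      (4002000 * v ^ (-p)) * β :=
    mul_le_mul (mul_le_mul_of_nonneg_right (by linarith) hvp) h2
      (Finset.sum_nonneg fun i _ => measureReal_nonneg) (by positivity)
  nlinarith [mul_nonneg hvp hs]

end Tails

/-! ### Nonuniform Berry–Esseen bound for W -/

section NonuniformBerryEsseen

variable {Ω : Type*} [MeasurableSpace Ω] {P : Measure Ω} [IsProbabilityMeasure P]
variable {ι : Type*} [Fintype ι] [DecidableEq ι] {ξ : ι → Ω → ℝ}

theorem Summands.abs_integral_clip_le (h : Summands P ξ) {p : ℝ} (hp : 2 < p)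
    (hX : ∀ i, Integrable (fun ω => |ξ i ω| ^ p) P) (i : ι) :
    |∫ ω, clip (ξ i ω) ∂P| ≤ ∫ ω, |ξ i ω| ^ p ∂P := by
  have hm := h.meas i
  have i1 : Integrable (fun ω => clip (ξ i ω)) P :=
    integrable_of_abs_le (by fun_prop) fun ω => abs_clip_le_one _
  have e : ∫ ω, clip (ξ i ω) ∂P = ∫ ω, (clip (ξ i ω) - ξ i ω) ∂P := by
    rw [integral_sub i1 (h.integrable i), h.mean i, sub_zero]
  rw [e]
  exact abs_integral_le_integral_abs.trans (integral_mono (i1.sub (h.integrable i)).abs (hX i)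
    fun ω => abs_clip_sub_le hp.le _)

theorem Summands.integral_sq_sub_le (h : Summands P ξ) {p : ℝ} (hp : 2 < p)
    (hX : ∀ i, Integrable (fun ω => |ξ i ω| ^ p) P) (i : ι) :
    ∫ ω, ξ i ω ^ 2 ∂P - ∫ ω, clip (ξ i ω) ^ 2 ∂P ≤ ∫ ω, |ξ i ω| ^ p ∂P := by
  have hm := h.meas i
  have i1 : Integrable (fun ω => clip (ξ i ω) ^ 2) P :=
    integrable_of_abs_le (C := 1) (by fun_prop) fun ω => by
      rw [abs_pow]; exact pow_le_one₀ (abs_nonneg _) (abs_clip_le_one _)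
  have i2 := (h.memLp i).integrable_sq
  rw [← integral_sub i2 i1]
  exact integral_mono (i2.sub i1) (hX i) fun ω => sq_sub_clip_sq_le hp.le _

theorem Summands.integral_abs_clip_pow_le (h : Summands P ξ) {p : ℝ} (hp : 2 < p) (hp3 : p ≤ 3)
    (hX : ∀ i, Integrable (fun ω => |ξ i ω| ^ p) P) (i : ι) :
    ∫ ω, |clip (ξ i ω)| ^ 3 ∂P ≤ ∫ ω, |ξ i ω| ^ p ∂P := by
  have hm := h.meas i
  exact integral_mono (integrable_of_abs_le (C := 1) (by fun_prop) fun ω => by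
      rw [abs_pow, abs_abs]; exact pow_le_one₀ (abs_nonneg _) (abs_clip_le_one _)) (hX i)
    fun ω => abs_clip_pow_three_le hp.le hp3 _

theorem sq_sub_abs_mul_min_le {p δ : ℝ} (hp : 2 < p) (hδ : 0 < δ) (x : ℝ) :
    x ^ 2 - |x| * min δ |x| ≤ δ ^ (2 - p) * |x| ^ p := by
  have h0 : 0 ≤ δ ^ (2 - p) * |x| ^ p := by positivity
  rcases le_total |x| δ with h | h
  · rw [min_eq_right h, ← sq, sq_abs, sub_self]; exact h0
  · have hx : 0 < |x| := hδ.trans_le h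
    rw [min_eq_left h]
    have e : |x| ^ p = |x| ^ 2 * |x| ^ (p - 2) := by
      rw [← Real.rpow_two, ← Real.rpow_add hx]; congr 1; ring
    have e2 : 1 ≤ δ ^ (2 - p) * |x| ^ (p - 2) := by
      rw [show 2 - p = -(p - 2) by ring, Real.rpow_neg hδ.le, inv_mul_eq_div,
        one_le_div (Real.rpow_pos_of_pos hδ _)]
      exact Real.rpow_le_rpow hδ.le h (by linarith)
    calc x ^ 2 - |x| * δ ≤ |x| ^ 2 * 1 := by
          rw [sq_abs, mul_one]; linarith [mul_pos hx hδ]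
      _ ≤ |x| ^ 2 * (δ ^ (2 - p) * |x| ^ (p - 2)) := by gcongr
      _ = _ := by rw [e]; ring

/-- With δ = 2β the part of the variance lost is at most (2β)^{2-p} β = (2β)^{3-p}/2 ≤ 1/2, by p ≤ 3
and 2β ≤ 1. -/
theorem Summands.half_le_sum_of_lyapunov (h : Summands P ξ) (hv : ∑ i, ∫ ω, ξ i ω ^ 2 ∂P = 1)
    {p : ℝ} (hp : 2 < p) (hp3 : p ≤ 3) (hX : ∀ i, Integrable (fun ω => |ξ i ω| ^ p) P)
    (hβ0 : 0 < ∑ i, ∫ ω, |ξ i ω| ^ p ∂P) (hβ : ∑ i, ∫ ω, |ξ i ω| ^ p ∂P ≤ 1 / 8) :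
    1 / 2 ≤ ∑ i, ∫ ω, |ξ i ω| * min (2 * ∑ i, ∫ ω, |ξ i ω| ^ p ∂P) |ξ i ω| ∂P := by
  set β := ∑ i, ∫ ω, |ξ i ω| ^ p ∂P with hβdef
  have hδ : 0 < 2 * β := by positivity
  have h1 : ∑ i, (∫ ω, ξ i ω ^ 2 ∂P - ∫ ω, |ξ i ω| * min (2 * β) |ξ i ω| ∂P) ≤
      ∑ i, (2 * β) ^ (2 - p) * ∫ ω, |ξ i ω| ^ p ∂P := Finset.sum_le_sum fun i _ => by
    have i1 := (h.memLp i).integrable_sq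
    have i2 := h.integrable_abs_mul_min hδ.le i
    rw [← integral_sub i1 i2, ← integral_const_mul]
    exact integral_mono (i1.sub i2) ((hX i).const_mul _) fun ω => sq_sub_abs_mul_min_le hp hδ _
  rw [Finset.sum_sub_distrib, hv, ← Finset.mul_sum, ← hβdef] at h1
  have h2 : (2 * β) ^ (2 - p) * (2 * β) ≤ 1 := by
    nth_rewrite 2 [← Real.rpow_one (2 * β)]
    rw [← Real.rpow_add hδ]
    exact Real.rpow_le_one hδ.le (by linarith) (by linarith)
  linarith

theorem Summands.lyapunov_pos (h : Summands P ξ) (hv : ∑ i, ∫ ω, ξ i ω ^ 2 ∂P = 1)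
    {p : ℝ} (hp : 2 < p) (hX : ∀ i, Integrable (fun ω => |ξ i ω| ^ p) P) :
    0 < ∑ i, ∫ ω, |ξ i ω| ^ p ∂P := by
  have h0 : ∀ i, 0 ≤ ∫ ω, |ξ i ω| ^ p ∂P := fun i =>
    integral_nonneg fun ω => Real.rpow_nonneg (abs_nonneg _) _
  refine (Finset.sum_nonneg fun i _ => h0 i).lt_of_ne fun he => ?_
  have hz : ∑ i, ∫ ω, ξ i ω ^ 2 ∂P = 0 := Finset.sum_eq_zero fun i hi => by
    have := (Finset.sum_eq_zero_iff_of_nonneg fun i _ => h0 i).1 he.symm i hi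
    rw [integral_eq_zero_iff_of_nonneg (fun ω => Real.rpow_nonneg (abs_nonneg _) _) (hX i)] at this
    rw [integral_eq_zero_iff_of_nonneg (fun ω => sq_nonneg _) (h.memLp i).integrable_sq]
    filter_upwards [this] with ω hω
    have : |ξ i ω| ^ p = 0 := hω
    rw [Real.rpow_eq_zero (abs_nonneg _) (by linarith), abs_eq_zero] at this
    simp [this]
  linarith

theorem IndepFun.measureReal_inter_preimage {X Y : Ω → ℝ} (hI : IndepFun X Y P) {s t : Set ℝ}
    (hs : MeasurableSet s) (ht : MeasurableSet t) :
    P.real (X ⁻¹' s ∩ Y ⁻¹' t) = P.real (X ⁻¹' s) * P.real (Y ⁻¹' t) := by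
  simp only [Measure.real, hI.measure_inter_preimage_eq_mul s t hs ht, ENNReal.toReal_mul]

/-- A clipped summand is at most 1, so the others must reach z - 1; they are independent of ξ_i and
have a bounded exponential moment. -/
theorem Summands.measureReal_sum_clip_ge_le (h : Summands P ξ) (z : ℝ) (i : ι) :
    P.real ({ω | z ≤ ∑ j, clip (ξ j ω)} ∩ {ω | 1 < |ξ i ω|}) ≤
      9 * Real.exp (1 - z) * P.real {ω | 1 < |ξ i ω|} := by
  have hm := h.meas
  have hI := h.indep_sub measurable_clip clip_zero i
  have hsub : {ω | z ≤ ∑ j, clip (ξ j ω)} ∩ {ω | 1 < |ξ i ω|} ⊆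
      (ξ i ⁻¹' {x | 1 < |x|}) ∩
        ((fun ω => ∑ j, clip (ξ j ω) - clip (ξ i ω)) ⁻¹' Set.Ici (z - 1)) := by
    rintro ω ⟨hω, hω'⟩
    have hω : z ≤ ∑ j, clip (ξ j ω) := hω
    refine ⟨hω', ?_⟩
    rw [Set.mem_preimage, Set.mem_Ici]
    linarith [clip_le_one (ξ i ω)]
  have hind := IndepFun.measureReal_inter_preimage hI (s := {x | 1 < |x|}) (t := Set.Ici (z - 1))
    (measurableSet_lt (by fun_prop) (by fun_prop)) measurableSet_Ici
  have hz := (h.zeroAt i).integral_exp_sum_clip_le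
  simp only [sum_zeroAt clip_zero] at hz
  have hb : ∀ ω, ∑ j, clip (ξ j ω) - clip (ξ i ω) ≤ Fintype.card ι + 1 := fun ω => by
    linarith [(abs_le.1 (abs_sum_clip_le (ξ := ξ) ω)).2, neg_one_le_clip (ξ i ω)]
  have hch := measure_ge_le_exp_mul_mgf (μ := P)
    (X := fun ω => ∑ j, clip (ξ j ω) - clip (ξ i ω)) (z - 1) zero_le_one
    (integrable_of_abs_le (C := Real.exp (1 * (Fintype.card ι + 1))) (by fun_prop) fun ω => by
      rw [abs_of_pos (Real.exp_pos _), Real.exp_le_exp]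
      linarith [hb ω])
  simp only [mgf, one_mul] at hch
  have h2 : P.real ((fun ω => ∑ j, clip (ξ j ω) - clip (ξ i ω)) ⁻¹' Set.Ici (z - 1)) ≤
      9 * Real.exp (1 - z) := by
    refine le_trans hch ?_
    rw [show -1 * (z - 1) = 1 - z by ring, mul_comm (9 : ℝ)]
    exact mul_le_mul_of_nonneg_left hz (Real.exp_pos _).le
  refine (measureReal_mono hsub (measure_ne_top _ _)).trans ?_
  rw [hind, mul_comm]
  exact mul_le_mul_of_nonneg_right h2 measureReal_nonneg

theorem abs_measureReal_sub_le {A B : Set Ω} {a b : ℝ} (hA : MeasurableSet A) (hB : MeasurableSet B)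
    (h1 : P.real (A \ B) ≤ a) (h2 : P.real (B \ A) ≤ b) : |P.real A - P.real B| ≤ max a b := by
  have e1 := measureReal_sdiff_add_inter (μ := P) (s := A) hB
  have e2 := measureReal_sdiff_add_inter (μ := P) (s := B) hA
  rw [Set.inter_comm] at e2
  have n1 : 0 ≤ P.real (A \ B) := measureReal_nonneg
  have n2 : 0 ≤ P.real (B \ A) := measureReal_nonneg
  rw [abs_le]
  constructor <;> linarith [le_max_left a b, le_max_right a b]

theorem exp_one_third_le_two : Real.exp (1 / 3) ≤ 2 :=
  (Real.exp_le_exp.2 (by norm_num)).trans exp_one_half_le_two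

/-- Nonuniform Berry–Esseen bound on the positive half line, for closed and open half lines. -/
theorem Summands.abs_measureReal_sub_cdf_le (h : Summands P ξ)
    (hv : ∑ i, ∫ ω, ξ i ω ^ 2 ∂P = 1) {p z : ℝ} (hp : 2 < p) (hp3 : p ≤ 3)
    (hX : ∀ i, Integrable (fun ω => |ξ i ω| ^ p) P) (hβ : ∑ i, ∫ ω, |ξ i ω| ^ p ∂P ≤ 1 / 8)
    (hz : 0 ≤ z) {S : Set ℝ} (hS : MeasurableSet S) (hS1 : Set.Iio z ⊆ S) (hS2 : S ⊆ Set.Iic z) :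
    |P.real {ω | ∑ i, ξ i ω ∈ S} - cdf (gaussianReal 0 1) z| ≤
      60000000 * (z + 1) ^ (-p) * ∑ i, ∫ ω, |ξ i ω| ^ p ∂P := by
  have hm := h.meas
  have hβ0 := h.lyapunov_pos hv hp hX
  have hκ := h.half_le_sum_of_lyapunov hv hp hp3 hX hβ0 hβ
  set β := ∑ i, ∫ ω, |ξ i ω| ^ p ∂P with hβdef
  set v := z + 1 with hvdef
  have hv1 : 1 ≤ v := by linarith
  have hvp : 0 ≤ v ^ (-p) := by positivity
  have h1 := h.abs_measureReal_sum_clip_sub_cdf_le (β := β) hz (by positivity) (by linarith) hκ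
    (by
      have := Finset.sum_le_sum fun i (_ : i ∈ Finset.univ) => h.integral_sq_sub_le hp hX i
      rw [Finset.sum_sub_distrib, hv] at this
      linarith)
    (Finset.sum_le_sum fun i _ => h.integral_abs_clip_pow_le hp hp3 hX i)
    (Finset.sum_le_sum fun i _ => h.abs_integral_clip_le hp hX i) hS hS1 hS2
  have hdec : (1 + z) ^ 2 * Real.exp (-z / 2) ≤ 7680 * v ^ (-p) := by
    have := pow_mul_exp_neg_div_le (k := 2) (c := 2) hv1 hp3 (by norm_num)
    norm_num [Nat.factorial] at this
    have e : Real.exp (-z / 2) = Real.exp (1 / 2) * Real.exp (-v / 2) := by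
      rw [← Real.exp_add]; congr 1; rw [hvdef]; ring
    rw [e, add_comm 1 z, ← hvdef]
    calc v ^ 2 * (Real.exp (1 / 2) * Real.exp (-v / 2)) =
          Real.exp (1 / 2) * (v ^ 2 * Real.exp (-v / 2)) := by ring
      _ ≤ 2 * (3840 * v ^ (-p)) := by
          have := exp_one_half_le_two
          gcongr
      _ = _ := by ring
  have h1' : 2000 * ((1 + z) ^ 2 * Real.exp (-z / 2)) * (β + 2 * β) ≤
      2000 * (7680 * v ^ (-p)) * (β + 2 * β) := by gcongr
  have hne : ∀ ω, ∑ i, ξ i ω ≠ ∑ i, clip (ξ i ω) → ∃ i, 1 < |ξ i ω| := fun ω hω => by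
    by_contra! hc
    exact hω (Finset.sum_congr rfl fun i _ => (clip_of_abs_le (hc i)).symm)
  have hA : MeasurableSet {ω | ∑ i, ξ i ω ∈ S} :=
    (show Measurable fun ω => ∑ i, ξ i ω by fun_prop) hS
  have hB : MeasurableSet {ω | ∑ i, clip (ξ i ω) ∈ S} :=
    (show Measurable fun ω => ∑ i, clip (ξ i ω) by fun_prop) hS
  -- The sums differ only if some |ξ_i| > 1, and leaving `S` means being at least z. Here the
  -- clipped sum is the large one, so the bound is exponential.
  have h2 : P.real ({ω | ∑ i, ξ i ω ∈ S} \ {ω | ∑ i, clip (ξ i ω) ∈ S}) ≤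
      5000000 * v ^ (-p) * β := by
    have hsub : {ω | ∑ i, ξ i ω ∈ S} \ {ω | ∑ i, clip (ξ i ω) ∈ S} ⊆
        ⋃ i, {ω | z ≤ ∑ j, clip (ξ j ω)} ∩ {ω | 1 < |ξ i ω|} := by
      rintro ω ⟨ha, hb⟩
      obtain ⟨i, hi⟩ := hne ω fun he => hb (by rw [Set.mem_ofPred_eq, ← he]; exact ha)
      have hzW : z ≤ ∑ j, clip (ξ j ω) := not_lt.1 fun hlt => hb (hS1 hlt)
      exact Set.mem_iUnion.2 ⟨i, hzW, hi⟩
    have hs1 : ∑ i, P.real {ω | 1 < |ξ i ω|} ≤ β := by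
      have := sum_measureReal_le_abs_le (p := p) (by linarith) one_pos hX
      rw [Real.one_rpow, one_mul] at this
      exact (Finset.sum_le_sum fun i _ => measureReal_mono
        (fun ω (hω : 1 < |ξ i ω|) => show 1 ≤ |ξ i ω| from hω.le) (measure_ne_top _ _)).trans this
    have hexp : Real.exp (1 - z) ≤ 60 * v ^ (-p) := by
      have := pow_mul_exp_neg_div_le (k := 0) (c := 1) hv1 hp3 one_pos
      norm_num [Nat.factorial] at this
      have e : Real.exp (1 - z) = Real.exp 1 * Real.exp 1 * Real.exp (-v) := by
        rw [← Real.exp_add, ← Real.exp_add]; congr 1; rw [hvdef]; ring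
      have e1 := Real.exp_one_lt_d9
      rw [e]
      calc Real.exp 1 * Real.exp 1 * Real.exp (-v) ≤ 3 * 3 * (6 * v ^ (-p)) := by
            gcongr <;> linarith
        _ ≤ _ := by linarith
    refine (measureReal_mono hsub (measure_ne_top _ _)).trans
      ((measureReal_iUnion_fintype_le _).trans ?_)
    refine (Finset.sum_le_sum fun i _ => h.measureReal_sum_clip_ge_le z i).trans ?_
    rw [← Finset.mul_sum]
    calc 9 * Real.exp (1 - z) * ∑ i, P.real {ω | 1 < |ξ i ω|} ≤ 9 * (60 * v ^ (-p)) * β := by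
          gcongr
      _ ≤ _ := by nlinarith [mul_nonneg hvp hβ0.le]
  -- Here the unclipped sum is at least z, so either |ξ_i| > v/3 or the other summands are large:
  -- the events of `sum_tails_le`.
  have h3 : P.real ({ω | ∑ i, clip (ξ i ω) ∈ S} \ {ω | ∑ i, ξ i ω ∈ S}) ≤
      5000000 * v ^ (-p) * β := by
    have hsub : {ω | ∑ i, clip (ξ i ω) ∈ S} \ {ω | ∑ i, ξ i ω ∈ S} ⊆
        ⋃ i, ({ω | v / 3 < |ξ i ω|} ∪
          ((fun ω => ∑ j, ξ j ω - ξ i ω) ⁻¹' {x | (v - 3) / 3 < |x|} ∩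
            ξ i ⁻¹' {x | 1 < |x|})) := by
      rintro ω ⟨ha, hb⟩
      obtain ⟨i, hi⟩ := hne ω fun he => hb (by rw [Set.mem_ofPred_eq, he]; exact ha)
      have hzW : z ≤ ∑ j, ξ j ω := not_lt.1 fun hlt => hb (hS1 hlt)
      refine Set.mem_iUnion.2 ⟨i, ?_⟩
      rcases lt_or_ge (v / 3) |ξ i ω| with hl | hl
      · exact Or.inl hl
      · refine Or.inr ⟨?_, hi⟩
        rw [Set.mem_preimage, Set.mem_ofPred_eq]
        have := le_abs_self (∑ j, ξ j ω - ξ i ω)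
        have := le_abs_self (ξ i ω)
        linarith
    refine (measureReal_mono hsub (measure_ne_top _ _)).trans
      ((measureReal_iUnion_fintype_le _).trans ?_)
    refine (Finset.sum_le_sum fun i _ => measureReal_union_le _ _).trans ?_
    rw [Finset.sum_add_distrib]
    refine le_trans (le_of_eq ?_) (h.sum_tails_le hp hp3 hX hβ hv1)
    congr 1
    refine Finset.sum_congr rfl fun i _ => ?_
    exact IndepFun.measureReal_inter_preimage (h.indep_sub (φ := id) measurable_id rfl i).symm
      (measurableSet_lt (by fun_prop) (by fun_prop)) (measurableSet_lt (by fun_prop) (by fun_prop))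
  have h4 := abs_measureReal_sub_le hA hB h2 h3
  rw [max_self] at h4
  have h5 := abs_sub_le (P.real {ω | ∑ i, ξ i ω ∈ S}) (P.real {ω | ∑ i, clip (ξ i ω) ∈ S})
    (cdf (gaussianReal 0 1) z)
  have h6 : 0 ≤ v ^ (-p) * β := by positivity
  linarith

theorem cdf_gaussianReal_neg (z : ℝ) :
    cdf (gaussianReal 0 1) (-z) = 1 - cdf (gaussianReal 0 1) z := by
  rw [one_sub_cdf_gaussianReal, cdf_gaussianReal_eq]

/-- Nonuniform Berry–Esseen bound. -/
theorem Summands.abs_measureReal_le_sub_cdf_le (h : Summands P ξ)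
    (hv : ∑ i, ∫ ω, ξ i ω ^ 2 ∂P = 1) {p : ℝ} (hp : 2 < p) (hp3 : p ≤ 3)
    (hX : ∀ i, Integrable (fun ω => |ξ i ω| ^ p) P) (hβ : ∑ i, ∫ ω, |ξ i ω| ^ p ∂P ≤ 1 / 8)
    (z : ℝ) :
    |P.real {ω | ∑ i, ξ i ω ≤ z} - cdf (gaussianReal 0 1) z| ≤
      60000000 * (|z| + 1) ^ (-p) * ∑ i, ∫ ω, |ξ i ω| ^ p ∂P := by
  rcases le_or_gt 0 z with hz | hz
  · have := h.abs_measureReal_sub_cdf_le hv hp hp3 hX hβ hz measurableSet_Iic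
      (Set.Iio_subset_Iic_self) subset_rfl
    rw [abs_of_nonneg hz]
    exact this
  · have hm := h.meas
    -- The complement of W ≤ z is -W < -z, which is why open half lines had to be covered.
    have h1 := h.neg.abs_measureReal_sub_cdf_le (by simpa using hv) hp hp3
      (by simpa only [abs_neg] using hX) (by simpa only [abs_neg] using hβ) (z := -z) (by linarith)
      measurableSet_Iio subset_rfl Set.Iio_subset_Iic_self
    simp only [abs_neg, Finset.sum_neg_distrib, Set.mem_Iio, neg_lt_neg_iff] at h1
    have e : P.real {ω | z < ∑ i, ξ i ω} = 1 - P.real {ω | ∑ i, ξ i ω ≤ z} := by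
      rw [← probReal_compl_eq_one_sub (measurableSet_le (by fun_prop) measurable_const)]
      congr 1
      ext ω
      simp [not_le]
    rw [e, cdf_gaussianReal_neg, sub_sub_sub_cancel_left, abs_sub_comm] at h1
    rw [abs_of_neg hz]
    exact h1

end NonuniformBerryEsseen

/-! ### Normal approximation of T -/

section NormalApproximation

variable {Ω : Type*} [MeasurableSpace Ω] {P : Measure Ω} [IsProbabilityMeasure P] {n : ℕ}
  {X : Fin n → Ω → ℝ} {g : Fin n → ℝ → ℝ} {T : (Fin n → ℝ) → ℝ} {D : Fin n → Ω → ℝ}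

theorem one_sub_cdf_abs_le {z p : ℝ} (hp3 : p ≤ 3) :
    1 - cdf (gaussianReal 0 1) |z| ≤ 72 * (|z| + 1) ^ (-p) := by
  have hv1 : 1 ≤ |z| + 1 := by linarith [abs_nonneg z]
  have h1 := one_sub_cdf_gaussianReal_le (abs_nonneg z)
  have h2 := exp_sq_sub_le le_rfl (abs_nonneg z)
  norm_num at h2
  have h3 := pow_mul_exp_neg_div_le (k := 0) (c := 1) hv1 hp3 one_pos
  norm_num [Nat.factorial] at h3
  have e : Real.exp (-|z|) = Real.exp 1 * Real.exp (-1 + -|z|) := by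
    rw [← Real.exp_add]; congr 1; ring
  have e1 := Real.exp_one_lt_d9
  have h4 : Real.exp (-|z|) ≤ 3 * (6 * (|z| + 1) ^ (-p)) := by
    rw [e]
    gcongr
    linarith
  simp only [sq_abs] at h1
  linarith

theorem exp_neg_abs_div_three_le {z p : ℝ} (hp3 : p ≤ 3) :
    Real.exp (-|z| / 3) ≤ 324 * (|z| + 1) ^ (-p) := by
  have hv1 : 1 ≤ |z| + 1 := by linarith [abs_nonneg z]
  have h3 := pow_mul_exp_neg_div_le (k := 0) (c := 3) hv1 hp3 (by norm_num)
  norm_num [Nat.factorial] at h3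
  rw [show (-1 + -|z|) / 3 = -(|z| + 1) / 3 by ring] at h3
  have e : Real.exp (-|z| / 3) = Real.exp (1 / 3) * Real.exp (-(|z| + 1) / 3) := by
    rw [← Real.exp_add]; congr 1; ring
  rw [e]
  calc Real.exp (1 / 3) * Real.exp (-(|z| + 1) / 3) ≤ 2 * (162 * (|z| + 1) ^ (-p)) := by
        have := exp_one_third_le_two
        gcongr
    _ = _ := by ring

theorem abs_measureReal_le_sub_le_of_tails {Y : Ω → ℝ} (hY : Measurable Y) {z : ℝ} {μ : ℝ}
    (hμ : 1 - cdf (gaussianReal 0 1) |z| ≤ μ) {A : Set Ω}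
    (hA : ∀ ω, (0 ≤ z → z < Y ω → ω ∈ A) ∧ (z < 0 → Y ω ≤ z → ω ∈ A)) :
    |P.real {ω | Y ω ≤ z} - cdf (gaussianReal 0 1) z| ≤ P.real A + μ := by
  have hA0 : 0 ≤ P.real A := measureReal_nonneg
  have h1 := cdf_le_one (gaussianReal 0 1) |z|
  rcases le_or_gt 0 z with hz | hz
  · have e : P.real {ω | z < Y ω} = 1 - P.real {ω | Y ω ≤ z} := by
      rw [← probReal_compl_eq_one_sub (measurableSet_le hY measurable_const)]
      congr 1
      ext ω
      simp [not_le]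
    have h2 : P.real {ω | z < Y ω} ≤ P.real A :=
      measureReal_mono (fun ω hω => (hA ω).1 hz hω) (measure_ne_top _ _)
    have h3 : 0 ≤ P.real {ω | z < Y ω} := measureReal_nonneg
    rw [abs_of_nonneg hz] at hμ h1
    rw [abs_le]
    constructor <;> linarith
  · have h2 : P.real {ω | Y ω ≤ z} ≤ P.real A :=
      measureReal_mono (fun ω hω => (hA ω).2 hz hω) (measure_ne_top _ _)
    have h3 : 0 ≤ P.real {ω | Y ω ≤ z} := measureReal_nonneg
    rw [← cdf_gaussianReal_neg, abs_of_neg hz, neg_neg] at hμ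
    have h4 := cdf_nonneg (gaussianReal 0 1) z
    rw [abs_le]
    constructor <;> linarith

theorem StandingAssumptions.measurable_statT (h : StandingAssumptions P X g T) :
    Measurable (statT X T) :=
  h.measurable_T.comp (measurable_pi_lambda _ h.measurable_X)

/-- When β > 1/8, a bound of order v^{-p} is already of order β v^{-p}. Hence Gaussian tails and
tails of T suffice, and |T| ≥ |z| forces |Δ| > v/3 or |W| > (v-3)/3. -/
theorem StandingAssumptions.ofReal_abs_sub_cdf_le_of_large (h : StandingAssumptions P X g T)
    {p : ℝ} (hp : 2 < p) (hp3 : p ≤ 3) (hX : ∀ i, Integrable (fun ω => |g i (X i ω)| ^ p) P)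
    (hβ : 1 / 8 < ∑ i, ∫ ω, |g i (X i ω)| ^ p ∂P) (z : ℝ) :
    ENNReal.ofReal |P.real {ω | statT X T ω ≤ z} - cdf (gaussianReal 0 1) z| ≤
      P {ω | (|z| + 1) / 3 < |statDelta X g T ω|} +
        ENNReal.ofReal (100000000 * (|z| + 1) ^ (-p)) *
          ENNReal.ofReal (∑ i, ∫ ω, |g i (X i ω)| ^ p ∂P) := by
  set β := ∑ i, ∫ ω, |g i (X i ω)| ^ p ∂P with hβdef
  set v := |z| + 1 with hv
  have hv1 : 1 ≤ v := by linarith [abs_nonneg z]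
  have hvp : 0 ≤ v ^ (-p) := by positivity
  have hT := abs_measureReal_le_sub_le_of_tails (P := P) h.measurable_statT
    (one_sub_cdf_abs_le (z := z) hp3)
    (A := {ω | v / 3 < |statDelta X g T ω|} ∪ {ω | (v - 3) / 3 < |∑ i, g i (X i ω)|}) fun ω => by
    have hd : statDelta X g T ω = statT X T ω - ∑ i, g i (X i ω) := rfl
    have h1 := abs_le.1 (le_refl |statDelta X g T ω|)
    have key : v - 1 < |statT X T ω| ∨ v - 1 ≤ |statT X T ω| →
        ω ∈ {ω | v / 3 < |statDelta X g T ω|} ∪ {ω | (v - 3) / 3 < |∑ i, g i (X i ω)|} := by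
      intro hk
      have hk : v - 1 ≤ |statT X T ω| := hk.elim le_of_lt id
      rcases lt_or_ge (v / 3) |statDelta X g T ω| with hl | hl
      · exact Or.inl hl
      · right
        rw [Set.mem_ofPred_eq]
        have e : statT X T ω = statDelta X g T ω + ∑ i, g i (X i ω) := by rw [hd]; ring
        have := abs_add_le (statDelta X g T ω) (∑ i, g i (X i ω))
        rw [← e] at this
        linarith
    refine ⟨fun hz hlt => key (Or.inr ?_), fun hz hle => key (Or.inr ?_)⟩
    · rw [hv, abs_of_nonneg hz, add_sub_cancel_right]
      exact hlt.le.trans (le_abs_self _)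
    · rw [hv, abs_of_neg hz, add_sub_cancel_right]
      exact (neg_le_neg hle).trans (neg_le_abs _)
  have hW := h.summands.measureReal_lt_abs_sum_le hp hp3 hX hv1
  have hU := measureReal_union_le (μ := P) {ω | v / 3 < |statDelta X g T ω|}
    {ω | (v - 3) / 3 < |∑ i, g i (X i ω)|}
  have hfin : |P.real {ω | statT X T ω ≤ z} - cdf (gaussianReal 0 1) z| ≤
      P.real {ω | v / 3 < |statDelta X g T ω|} + 100000000 * v ^ (-p) * β := by
    have := mul_le_mul_of_nonneg_left hβ.le hvp
    nlinarith
  refine (ENNReal.ofReal_le_ofReal hfin).trans ?_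
  rw [ENNReal.ofReal_add measureReal_nonneg (by positivity), ENNReal.ofReal_mul (by positivity),
    ofReal_measureReal]

theorem StandingAssumptions.gammaTerm_le (h : StandingAssumptions P X g T)
    {p : ℝ} (hp : 2 < p) (hp3 : p ≤ 3) (hX : ∀ i, Integrable (fun ω => |g i (X i ω)| ^ p) P)
    (hβ : ∑ i, ∫ ω, |g i (X i ω)| ^ p ∂P ≤ 1 / 8) (z : ℝ) :
    gammaTerm P X g T z ≤ P {ω | (|z| + 1) / 3 < |statDelta X g T ω|} +
      ENNReal.ofReal (5000000 * (|z| + 1) ^ (-p)) *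
        ENNReal.ofReal (∑ i, ∫ ω, |g i (X i ω)| ^ p ∂P) := by
  have hv1 : 1 ≤ |z| + 1 := by linarith [abs_nonneg z]
  have h1 := h.summands.sum_tails_le hp hp3 hX hβ hv1
  have h2 := ENNReal.ofReal_le_ofReal h1
  rw [ENNReal.ofReal_mul (by positivity), ENNReal.ofReal_add
    (Finset.sum_nonneg fun i _ => measureReal_nonneg)
    (Finset.sum_nonneg fun i _ => mul_nonneg measureReal_nonneg measureReal_nonneg),
    ENNReal.ofReal_sum_of_nonneg (fun i _ => measureReal_nonneg),
    ENNReal.ofReal_sum_of_nonneg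
      (fun i _ => mul_nonneg measureReal_nonneg measureReal_nonneg)] at h2
  have hr : ∀ s : Set Ω, ENNReal.ofReal (P.real s) = P s := fun s => ofReal_measureReal
  simp only [ENNReal.ofReal_mul measureReal_nonneg, hr] at h2
  unfold gammaTerm
  rw [add_assoc, show |z| - 2 = |z| + 1 - 3 by ring]
  exact add_le_add le_rfl h2

theorem StandingAssumptions.ofReal_abs_sub_cdf_le_of_small (h : StandingAssumptions P X g T)
    (hD : IsLeaveOneOut P X D) {p : ℝ} (hp : 2 < p) (hp3 : p ≤ 3)
    (hX : ∀ i, Integrable (fun ω => |g i (X i ω)| ^ p) P)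
    (hβ : ∑ i, ∫ ω, |g i (X i ω)| ^ p ∂P ≤ 1 / 8) (z : ℝ) :
    ENNReal.ofReal |P.real {ω | statT X T ω ≤ z} - cdf (gaussianReal 0 1) z| ≤
      P {ω | (|z| + 1) / 3 < |statDelta X g T ω|} +
        ENNReal.ofReal (100000000 * (|z| + 1) ^ (-p)) *
          (eLpNorm (statDelta X g T) 2 P + crossTerm P X g T D +
            ENNReal.ofReal (∑ i, ∫ ω, |g i (X i ω)| ^ p ∂P)) := by
  have hβ0 := h.summands.lyapunov_pos h.var_g hp hX
  have hadm : IsAdmissible P X g (2 * ∑ i, ∫ ω, |g i (X i ω)| ^ p ∂P) :=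
    ⟨by positivity, h.summands.half_le_sum_of_lyapunov h.var_g hp hp3 hX hβ0 hβ⟩
  have hA := h.ofReal_abs_sub_le hD hadm z
  have hB := ENNReal.ofReal_le_ofReal
    (h.summands.abs_measureReal_le_sub_cdf_le h.var_g hp hp3 hX hβ z)
  have hG := h.gammaTerm_le hp hp3 hX hβ z
  have hE := ENNReal.ofReal_le_ofReal (exp_neg_abs_div_three_le (z := z) hp3)
  set β := ∑ i, ∫ ω, |g i (X i ω)| ^ p ∂P with hβdef
  have hvp : 0 ≤ (|z| + 1) ^ (-p) := by positivity
  set r := (|z| + 1) ^ (-p) with hr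
  set d := eLpNorm (statDelta X g T) 2 P with hd
  set c := crossTerm P X g T D with hc
  -- With δ = 2β the first term of τ is 44β, and 44 dominates the other two coefficients.
  have hτ : tauTerm P X g T D (2 * β) ≤ ENNReal.ofReal 44 * (d + c + ENNReal.ofReal β) := by
    unfold tauTerm
    rw [mul_add, mul_add, show 22 * (2 * β) = 44 * β by ring,
      ENNReal.ofReal_mul (by norm_num : (0 : ℝ) ≤ 44), add_comm _ (ENNReal.ofReal 44 * _),
      ← add_assoc]
    gcongr <;> norm_num
  rw [ENNReal.ofReal_mul (by positivity)] at hB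
  calc ENNReal.ofReal |P.real {ω | statT X T ω ≤ z} - cdf (gaussianReal 0 1) z|
      ≤ ENNReal.ofReal (|P.real {ω | statT X T ω ≤ z} - P.real {ω | statW X g ω ≤ z}| +
          |P.real {ω | statW X g ω ≤ z} - cdf (gaussianReal 0 1) z|) :=
        ENNReal.ofReal_le_ofReal (abs_sub_le _ _ _)
    _ = ENNReal.ofReal |P.real {ω | statT X T ω ≤ z} - P.real {ω | statW X g ω ≤ z}| +
          ENNReal.ofReal |P.real {ω | statW X g ω ≤ z} - cdf (gaussianReal 0 1) z| :=
        ENNReal.ofReal_add (abs_nonneg _) (abs_nonneg _)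
    _ ≤ (P {ω | (|z| + 1) / 3 < |statDelta X g T ω|} +
          ENNReal.ofReal (5000000 * r) * (d + c + ENNReal.ofReal β) +
          ENNReal.ofReal (324 * r) * (ENNReal.ofReal 44 * (d + c + ENNReal.ofReal β))) +
          ENNReal.ofReal (60000000 * r) * (d + c + ENNReal.ofReal β) := by
        refine add_le_add (hA.trans (add_le_add (hG.trans ?_) ?_)) (hB.trans ?_)
        · gcongr
          exact le_add_self
        · exact mul_le_mul' hE hτ
        · gcongr
          exact le_add_self
    _ = P {ω | (|z| + 1) / 3 < |statDelta X g T ω|} +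
          ENNReal.ofReal (5000000 * r + 324 * r * 44 + 60000000 * r) *
            (d + c + ENNReal.ofReal β) := by
        rw [ENNReal.ofReal_add (by positivity) (by positivity),
          ENNReal.ofReal_add (by positivity) (by positivity),
          ENNReal.ofReal_mul (p := 324 * r) (by positivity)]
        ring
    _ ≤ _ := by
        gcongr
        linarith

end NormalApproximation

theorem theorem2p2 :
    ∃ C : ℝ, 0 < C ∧
      ∀ (Ω : Type*) [MeasurableSpace Ω] (P : Measure Ω) [IsProbabilityMeasure P] (n : ℕ)
        (X : Fin n → Ω → ℝ) (g : Fin n → ℝ → ℝ) (T : (Fin n → ℝ) → ℝ) (D : Fin n → Ω → ℝ),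
        StandingAssumptions P X g T → IsLeaveOneOut P X D →
          (∀ δ : ℝ, IsAdmissible P X g δ → ∀ z : ℝ,
            ENNReal.ofReal |P.real {ω | statT X T ω ≤ z} - P.real {ω | statW X g ω ≤ z}| ≤
              gammaTerm P X g T z + ENNReal.ofReal (Real.exp (-|z| / 3)) * tauTerm P X g T D δ) ∧
          (∀ p : ℝ, 2 < p → p ≤ 3 →
            (∀ i, Integrable (fun ω => |g i (X i ω)| ^ p) P) → ∀ z : ℝ,
            ENNReal.ofReal |P.real {ω | statT X T ω ≤ z} - cdf (gaussianReal 0 1) z| ≤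
              P {ω | (|z| + 1) / 3 < |statDelta X g T ω|}
                + ENNReal.ofReal (C * (|z| + 1) ^ (-p)) *
                  (eLpNorm (statDelta X g T) 2 P + crossTerm P X g T D
                    + ENNReal.ofReal (∑ i, ∫ ω, |g i (X i ω)| ^ p ∂P))) := by
  -- For small β the constants add up to 5·10⁶ + 324 · 44 + 6·10⁷; for β > 1/8 one needs 12000 +
  -- 8(4·10⁶ + 72). Both are below 10⁸.
  refine ⟨100000000, by norm_num, fun Ω _ P _ n X g T D h hD =>
    ⟨fun δ hδ z => h.ofReal_abs_sub_le hD hδ z, fun p hp hp3 hX z => ?_⟩⟩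
  rcases le_or_gt (∑ i, ∫ ω, |g i (X i ω)| ^ p ∂P) (1 / 8) with hβ | hβ
  · exact h.ofReal_abs_sub_cdf_le_of_small hD hp hp3 hX hβ z
  · refine (h.ofReal_abs_sub_cdf_le_of_large hp hp3 hX hβ z).trans ?_
    gcongr
    exact le_add_self
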